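/- Fix an odd prime $p$ and an integer $g\ge 1$. For a pro-$p$ group $G$ put $d(G)=\dim H^1(G,\mathbb Z/p)$ and $r(G)=\dim H^2(G,\mathbb Z/p)$ (continuous cohomology, trivial action). A finitely generated pro-$p$ group $G$ is a Schur $\sigma$-group of rank $g$ if $d(G)=r(G)=g$, the topological abelianization $G^{\mathrm{ab}}$ is finite, and $G$ has an automorphism $\sigma$ of order $2$ acting as inversion on $G^{\mathrm{ab}}$; for such a $\sigma$ let $\mathrm{Aut}_\sigma(G)$ be the group of automorphisms of $G$ commuting with $\sigma$. Let $F$ be the free pro-$p$ group on $x_1,\dots,x_g$, let $\sigma$ be the automorphism of $F$ with $\sigma(x_i)=x_i^{-1}$, let $\Phi(F)$ be the closure of $[F,F]F^p$, and let $X=\{t^{-1}\sigma(t)\mid t\in\Phi(F)\}$, with the image of the normalized Haar measure of $\Phi(F)$ under $t\mapsto t^{-1}\sigma(t)$ as its measure. For a Schur $\sigma$-group $G$ of rank $g$ let $\mathrm{Meas}(G)$ be the measure of the set $Y(G)\subseteq X^g$ of those tuples $v$ for which the quotient of $F$ by the closed normal subgroup generated by $v$ is isomorphic to $G$. Call a set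 of isomorphism classes of Schur $\sigma$-groups of rank $g$ measurable if the set of tuples in $X^g$ presenting its members is measurable. Then: 1. A random tuple in $X^g$ presents a Schur $\sigma$-group of rank $g$ with probability $1$, so $\mathrm{Meas}$ is a probability measure on the set of isomorphism classes of Schur $\sigma$-groups of rank $g$; single classes are measurable, and the mass of the class of $G$ is $\mathrm{Meas}(G)$. 2. This probability measure gives each group mass proportional to $1/|\mathrm{Aut}_\sigma(G)|$: there is a constant $C\in(0,\infty)$, depending only on $p$ and $g$, such that $\mathrm{Meas}(G)=C/|\mathrm{Aut}_\sigma(G)|$ for every Schur $\sigma$-group $G$ of rank $g$ and every choice of $\sigma$ (both sides being $0$ if $\mathrm{Aut}_\sigma(G)$ is infinite). 3. The set of classes of finite Schur $\sigma$-groups of rank $g$ is measurable. A measure $Q$ on the set of classes is a probability measure carried by the finite groups with $Q(\{G\})=c/|\mathrm{Aut}_\sigma(G)|$ for some constant $c$ and all $G$ and $\sigma$ (with the same convention) if and only if the finite groups have positive $\mathrm{Meas}$ and $Q$ is $\mathrm{Meas}$ conditioned on the finite groups. -/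

import Mathlib

open MeasureTheory ProbabilityTheory
open scoped ENNReal

noncomputable section

/-! ### Pro-`p` groups, generator rank, relation rank -/

/-- A pro-`p` group: a compact, totally disconnected topological group all of whose open normal
subgroups have `p`-power index. -/
structure IsProP (p : ℕ) (G : Type*) [Group G] [TopologicalSpace G] : Prop where
  topologicalGroup : IsTopologicalGroup G
  compact : CompactSpace G
  totallyDisconnected : TotallyDisconnectedSpace G
  index_open_normal : ∀ U : Subgroup G, U.Normal → IsOpen (U : Set G) → ∃ n : ℕ, U.index = p ^ n

/-- `G` is topologically generated by finitely many elements. -/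
def IsTopFG (G : Type*) [Group G] [TopologicalSpace G] : Prop :=
  ∃ S : Finset G, Dense (Subgroup.closure (S : Set G) : Set G)

section Cohomology

variable (p : ℕ) (G : Type*) [Group G] [TopologicalSpace G]

/-- Continuous 1-cocycles of `G` in the trivial module `ℤ/p`: continuous homomorphisms. As the
1-coboundaries of a trivial module vanish, this is `H¹(G, ℤ/p)`. -/
def contH1 : Submodule (ZMod p) (G → ZMod p) where
  carrier := {f | Continuous f ∧ ∀ x y, f (x * y) = f x + f y}
  zero_mem' := ⟨continuous_const, by simp⟩
  add_mem' := by
    rintro a b ⟨ha, ha'⟩ ⟨hb, hb'⟩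
    refine ⟨ha.add hb, fun x y => ?_⟩
    simp only [Pi.add_apply, ha', hb']
    ring
  smul_mem' := by
    rintro c a ⟨ha, ha'⟩
    refine ⟨ha.const_smul c, fun x y => ?_⟩
    simp only [Pi.smul_apply, ha', smul_add]

/-- Continuous (inhomogeneous) 1-cochains. -/
def contC1 : Submodule (ZMod p) (G → ZMod p) where
  carrier := {f | Continuous f}
  zero_mem' := continuous_const
  add_mem' := fun ha hb => Continuous.add ha hb
  smul_mem' := fun c _ ha => Continuous.const_smul ha c

/-- Continuous (inhomogeneous) 2-cocycles with values in the trivial module `ℤ/p`. -/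
def contZ2 : Submodule (ZMod p) (G × G → ZMod p) where
  carrier := {c | Continuous c ∧
    ∀ x y z, c (y, z) - c (x * y, z) + c (x, y * z) - c (x, y) = 0}
  zero_mem' := ⟨continuous_const, by simp⟩
  add_mem' := by
    rintro a b ⟨ha, ha'⟩ ⟨hb, hb'⟩
    refine ⟨ha.add hb, fun x y z => ?_⟩
    simp only [Pi.add_apply]
    linear_combination ha' x y z + hb' x y z
  smul_mem' := by
    rintro c a ⟨ha, ha'⟩
    refine ⟨ha.const_smul c, fun x y z => ?_⟩
    simp only [Pi.smul_apply, smul_eq_mul]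
    linear_combination c * ha' x y z

/-- The coboundary `f ↦ ((x, y) ↦ f y - f (x y) + f x)` from 1-cochains to 2-cochains. -/
def coboundary1 : (G → ZMod p) →ₗ[ZMod p] (G × G → ZMod p) where
  toFun f := fun q => f q.2 - f (q.1 * q.2) + f q.1
  map_add' a b := by
    funext q
    simp only [Pi.add_apply]
    ring
  map_smul' c a := by
    funext q
    simp only [Pi.smul_apply, smul_eq_mul, RingHom.id_apply]
    ring

/-- 2-coboundaries of continuous 1-cochains. -/
def contB2 : Submodule (ZMod p) (G × G → ZMod p) :=
  (contC1 p G).map (coboundary1 p G)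

/-- Continuous cohomology `H²(G, ℤ/p)` with trivial action. -/
abbrev contH2 : Type _ := contZ2 p G ⧸ (contB2 p G).submoduleOf (contZ2 p G)

/-- The generator rank `d(G) = dim H¹(G, ℤ/p)`. -/
def genRank : ℕ := Module.finrank (ZMod p) (contH1 p G)

/-- The relation rank `r(G) = dim H²(G, ℤ/p)`. -/
def relRank : ℕ := Module.finrank (ZMod p) (contH2 p G)

end Cohomology

/-! ### Automorphisms and Schur `σ`-groups -/

/-- `Aut(G)`: the automorphisms of the topological group `G`. -/
def contAut (G : Type*) [Group G] [TopologicalSpace G] : Subgroup (MulAut G) where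
  carrier := {α | Continuous α ∧ Continuous α.symm}
  one_mem' := ⟨continuous_id, continuous_id⟩
  mul_mem' := fun ha hb => ⟨ha.1.comp hb.1, hb.2.comp ha.2⟩
  inv_mem' := fun ha => ⟨ha.2, ha.1⟩

/-- `σ ∈ Aut(G)` has order 2 and acts as inversion on the topological abelianization of `G`. -/
def IsSchurInvolution {G : Type*} [Group G] [TopologicalSpace G] [IsTopologicalGroup G]
    (σ : contAut G) : Prop :=
  orderOf σ = 2 ∧
    ∀ x : G, (QuotientGroup.mk ((σ : MulAut G) x) : TopologicalAbelianization G) =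
      (QuotientGroup.mk x)⁻¹

/-- `Aut_σ(G)`: the automorphisms of `G` which commute with `σ`. -/
def autSigma {G : Type*} [Group G] [TopologicalSpace G] (σ : contAut G) :
    Subgroup (contAut G) :=
  Subgroup.centralizer {σ}

/-- Schur `σ`-groups of rank `g`. -/
structure IsSchurSigma (p g : ℕ) (G : Type*) [Group G] [TopologicalSpace G]
    [IsTopologicalGroup G] : Prop where
  proP : IsProP p G
  topFG : IsTopFG G
  genRank_eq : genRank p G = g
  relRank_eq : relRank p G = g
  finite_ab : Finite (TopologicalAbelianization G)
  exists_involution : ∃ σ : contAut G, IsSchurInvolution σ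

/-- A bundled Schur `σ`-group of rank `g`. Being finitely generated pro-`p` groups, all Schur
`σ`-groups are isomorphic to one in `Type`. -/
structure SchurSigmaGrp (p g : ℕ) where
  carrier : Type
  [group : Group carrier]
  [topology : TopologicalSpace carrier]
  [topologicalGroup : IsTopologicalGroup carrier]
  isSchurSigma : IsSchurSigma p g carrier

attribute [instance] SchurSigmaGrp.group SchurSigmaGrp.topology SchurSigmaGrp.topologicalGroup

/-- Isomorphism (of topological groups) between Schur `σ`-groups. -/
instance SchurSigmaGrp.isoSetoid (p g : ℕ) : Setoid (SchurSigmaGrp p g) where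
  r G H := Nonempty (G.carrier ≃ₜ* H.carrier)
  iseqv :=
    ⟨fun _ => ⟨ContinuousMulEquiv.refl _⟩, fun ⟨e⟩ => ⟨e.symm⟩, fun ⟨e⟩ ⟨f⟩ => ⟨e.trans f⟩⟩

/-- The set of isomorphism classes of Schur `σ`-groups of rank `g`. -/
def SchurSigmaClass (p g : ℕ) : Type 1 := Quotient (SchurSigmaGrp.isoSetoid p g)

/-- The isomorphism class of a Schur `σ`-group. -/
def SchurSigmaGrp.cls {p g : ℕ} (G : SchurSigmaGrp p g) : SchurSigmaClass p g :=
  Quotient.mk (SchurSigmaGrp.isoSetoid p g) G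

/-- The isomorphism classes of finite Schur `σ`-groups of rank `g`. -/
def finiteSchurClasses (p g : ℕ) : Set (SchurSigmaClass p g) :=
  {c | ∃ G : SchurSigmaGrp p g, G.cls = c ∧ Finite G.carrier}

/-! ### The free pro-`p` group on `g` generators and its automorphism `σ` -/

/-- Normal subgroups of `p`-power index in the abstract free group on `g` generators. -/
structure PIndex (p g : ℕ) where
  N : Subgroup (FreeGroup (Fin g))
  normal : N.Normal
  index_eq : ∃ n : ℕ, N.index = p ^ n

attribute [instance] PIndex.normal

/-- The finite `p`-group quotient of the free group belonging to `N`, with discrete topology. -/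
def PIndex.Quot {p g : ℕ} (N : PIndex p g) : Type := FreeGroup (Fin g) ⧸ N.N

instance {p g : ℕ} (N : PIndex p g) : Group N.Quot :=
  inferInstanceAs (Group (FreeGroup (Fin g) ⧸ N.N))

instance {p g : ℕ} (N : PIndex p g) : TopologicalSpace N.Quot := ⊥

instance {p g : ℕ} (N : PIndex p g) : DiscreteTopology N.Quot := ⟨rfl⟩

instance {p g : ℕ} [hp : Fact p.Prime] (N : PIndex p g) : Finite N.Quot := by
  obtain ⟨n, hn⟩ := N.index_eq
  have h : N.N.index ≠ 0 := by
    rw [hn]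
    exact pow_ne_zero n hp.out.ne_zero
  have : N.N.FiniteIndex := ⟨h⟩
  exact inferInstanceAs (Finite (FreeGroup (Fin g) ⧸ N.N))

/-- The projection of the free group to a finite `p`-quotient. -/
def PIndex.proj {p g : ℕ} (N : PIndex p g) : FreeGroup (Fin g) →* N.Quot :=
  QuotientGroup.mk' N.N

/-- The diagonal map of the free group to the product of all its finite `p`-quotients. -/
def freeDiag (p g : ℕ) : FreeGroup (Fin g) →* ((N : PIndex p g) → N.Quot) :=
  MonoidHom.pi fun N => N.proj

/-- The closure of the free group in the product of all its finite `p`-quotients. -/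
def freeProPSubgroup (p g : ℕ) : Subgroup ((N : PIndex p g) → N.Quot) :=
  (freeDiag p g).range.topologicalClosure

/-- The free pro-`p` group `F` on `g` generators: the pro-`p` completion of the free group. -/
def FreeProP (p g : ℕ) : Type := freeProPSubgroup p g

instance (p g : ℕ) : Group (FreeProP p g) := inferInstanceAs (Group (freeProPSubgroup p g))

instance (p g : ℕ) : TopologicalSpace (FreeProP p g) :=
  inferInstanceAs (TopologicalSpace (freeProPSubgroup p g))

instance (p g : ℕ) : IsTopologicalGroup (FreeProP p g) :=
  inferInstanceAs (IsTopologicalGroup (freeProPSubgroup p g))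

instance (p g : ℕ) [Fact p.Prime] : CompactSpace (FreeProP p g) :=
  isCompact_iff_compactSpace.mp
    (Subgroup.isClosed_topologicalClosure (freeDiag p g).range).isCompact

instance (p g : ℕ) : MeasurableSpace (FreeProP p g) := borel _

instance (p g : ℕ) : BorelSpace (FreeProP p g) := ⟨rfl⟩

/-- The canonical map of the abstract free group to `F`. -/
def FreeProP.ofFree (p g : ℕ) : FreeGroup (Fin g) →* FreeProP p g :=
  (freeDiag p g).codRestrict (freeProPSubgroup p g)
    (fun w => Subgroup.le_topologicalClosure _ ⟨w, rfl⟩)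

/-- The free generators `x_i` of `F`. -/
def FreeProP.gen (p g : ℕ) (i : Fin g) : FreeProP p g := FreeProP.ofFree p g (FreeGroup.of i)

/-- The automorphism `x_i ↦ x_i⁻¹` of the abstract free group. -/
def freeInvert (g : ℕ) : FreeGroup (Fin g) →* FreeGroup (Fin g) :=
  FreeGroup.lift fun i => (FreeGroup.of i)⁻¹

theorem freeInvert_freeInvert (g : ℕ) (w : FreeGroup (Fin g)) :
    freeInvert g (freeInvert g w) = w := by
  have h : (freeInvert g).comp (freeInvert g) = MonoidHom.id _ := by
    ext i
    simp [freeInvert]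
  exact DFunLike.congr_fun h w

/-- The preimage of `N` under `x_i ↦ x_i⁻¹`. -/
def PIndex.invert {p g : ℕ} (N : PIndex p g) : PIndex p g where
  N := N.N.comap (freeInvert g)
  normal := N.normal.comap _
  index_eq := by
    rw [Subgroup.index_comap_of_surjective N.N
      (fun w => ⟨freeInvert g w, freeInvert_freeInvert g w⟩)]
    exact N.index_eq

/-- The map of finite `p`-quotients induced by `x_i ↦ x_i⁻¹`. -/
def PIndex.invertMap {p g : ℕ} (N : PIndex p g) : N.invert.Quot →* N.Quot :=
  QuotientGroup.map (N.N.comap (freeInvert g)) N.N (freeInvert g) le_rfl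

/-- The map induced by `x_i ↦ x_i⁻¹` on the product of the finite `p`-quotients. -/
def prodInvert (p g : ℕ) : ((N : PIndex p g) → N.Quot) →* ((N : PIndex p g) → N.Quot) :=
  MonoidHom.pi fun N => N.invertMap.comp (Pi.evalMonoidHom _ N.invert)

theorem continuous_prodInvert (p g : ℕ) : Continuous (prodInvert p g) :=
  continuous_pi fun N =>
    (continuous_of_discreteTopology (f := N.invertMap)).comp (continuous_apply N.invert)

theorem prodInvert_freeDiag (p g : ℕ) (w : FreeGroup (Fin g)) :
    prodInvert p g (freeDiag p g w) = freeDiag p g (freeInvert g w) := rfl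

theorem prodInvert_mem (p g : ℕ) {f : (N : PIndex p g) → N.Quot}
    (hf : f ∈ freeProPSubgroup p g) : prodInvert p g f ∈ freeProPSubgroup p g := by
  refine map_mem_closure (continuous_prodInvert p g) hf ?_
  rintro _ ⟨w, rfl⟩
  exact ⟨freeInvert g w, rfl⟩

theorem prodInvert_prodInvert (p g : ℕ) {f : (N : PIndex p g) → N.Quot}
    (hf : f ∈ freeProPSubgroup p g) : prodInvert p g (prodInvert p g f) = f := by
  have hc : IsClosed {f | prodInvert p g (prodInvert p g f) = f} :=
    isClosed_eq ((continuous_prodInvert p g).comp (continuous_prodInvert p g)) continuous_id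
  have hs : ((freeDiag p g).range : Set _) ⊆ {f | prodInvert p g (prodInvert p g f) = f} := by
    rintro _ ⟨w, rfl⟩
    simp only [Set.mem_ofPred_eq, prodInvert_freeDiag, freeInvert_freeInvert]
  exact closure_minimal hs hc hf

/-- The automorphism `σ` of `F` determined by `σ(x_i) = x_i⁻¹`. -/
def FreeProP.sigma (p g : ℕ) : FreeProP p g ≃ₜ* FreeProP p g where
  toFun f := ⟨prodInvert p g f.1, prodInvert_mem p g f.2⟩
  invFun f := ⟨prodInvert p g f.1, prodInvert_mem p g f.2⟩
  left_inv f := Subtype.ext (prodInvert_prodInvert p g f.2)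
  right_inv f := Subtype.ext (prodInvert_prodInvert p g f.2)
  map_mul' a b := Subtype.ext (map_mul (prodInvert p g) a.1 b.1)
  continuous_toFun :=
    ((continuous_prodInvert p g).comp continuous_subtype_val).subtype_mk _
  continuous_invFun :=
    ((continuous_prodInvert p g).comp continuous_subtype_val).subtype_mk _

theorem FreeProP.sigma_gen (p g : ℕ) (i : Fin g) :
    FreeProP.sigma p g (FreeProP.gen p g i) = (FreeProP.gen p g i)⁻¹ := by
  have h : FreeProP.sigma p g (FreeProP.gen p g i) =
      FreeProP.ofFree p g (freeInvert g (FreeGroup.of i)) := rfl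
  rw [h]
  simp [freeInvert, FreeProP.gen]

/-! ### Random Schur-type relators and the measure `Meas` -/

/-- The Frattini subgroup `Φ(G)`: the closure of `[G, G] Gᵖ`. -/
def frattiniProP (p : ℕ) (G : Type*) [Group G] [TopologicalSpace G] [IsTopologicalGroup G] :
    Subgroup G :=
  (commutator G ⊔ Subgroup.closure (Set.range fun x : G => x ^ p)).topologicalClosure

instance (p g : ℕ) [Fact p.Prime] : CompactSpace (frattiniProP p (FreeProP p g)) :=
  isCompact_iff_compactSpace.mp
    (Subgroup.isClosed_topologicalClosure _).isCompact

/-- The set `X = {t⁻¹ σ(t) | t ∈ Φ(F)}`. -/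
def schurRelators (p g : ℕ) : Set (FreeProP p g) :=
  {s | ∃ t ∈ frattiniProP p (FreeProP p g), s = t⁻¹ * FreeProP.sigma p g t}

/-- The surjection `Φ(F) → X`, `t ↦ t⁻¹ σ(t)`; its fibres are cosets of the group of fixed points
of `σ`. -/
def toRelator (p g : ℕ) (t : frattiniProP p (FreeProP p g)) : schurRelators p g :=
  ⟨(t : FreeProP p g)⁻¹ * FreeProP.sigma p g t, t, t.2, rfl⟩

/-- The uniform probability measure on `X`: the image of the normalized Haar measure of `Φ(F)`
under `t ↦ t⁻¹ σ(t)`. On every finite level `X_c = {t⁻¹ σ(t) | t ∈ Φ(F/P_c(F))}` it induces the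
normalized counting measure. -/
def relatorMeasure (p g : ℕ) [Fact p.Prime] : Measure (schurRelators p g) :=
  (Measure.haarMeasure (⊤ : TopologicalSpace.PositiveCompacts
    (frattiniProP p (FreeProP p g)))).map (toRelator p g)

/-- The normalized measure on `X^g`. -/
def relatorTupleMeasure (p g : ℕ) [Fact p.Prime] : Measure (Fin g → schurRelators p g) :=
  Measure.pi fun _ => relatorMeasure p g

/-- The closed normal subgroup of `F` generated by a tuple of relators. -/
def relationSubgroup {p g : ℕ} (v : Fin g → schurRelators p g) : Subgroup (FreeProP p g) :=
  (Subgroup.normalClosure (Set.range fun i => (v i : FreeProP p g))).topologicalClosure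

instance {p g : ℕ} (v : Fin g → schurRelators p g) : (relationSubgroup v).Normal :=
  Subgroup.is_normal_topologicalClosure _

/-- The pro-`p` group presented by a tuple of relators. -/
abbrev PresentedGroupProP {p g : ℕ} (v : Fin g → schurRelators p g) : Type :=
  FreeProP p g ⧸ relationSubgroup v

/-- `Y(G)`: the `g`-tuples from `X` which present a group isomorphic to `G`. -/
def presentingTuples (p g : ℕ) (G : Type*) [Group G] [TopologicalSpace G] :
    Set (Fin g → schurRelators p g) :=
  {v | Nonempty (PresentedGroupProP v ≃ₜ* G)}

/-- `Meas(G)`: the relative measure of `Y(G)` in `X^g`. -/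
def meas (p g : ℕ) [Fact p.Prime] (G : Type*) [Group G] [TopologicalSpace G] : ℝ≥0∞ :=
  relatorTupleMeasure p g (presentingTuples p g G)

/-- The `g`-tuples from `X` which present a Schur `σ`-group of rank `g`. -/
def schurTuples (p g : ℕ) : Set (Fin g → schurRelators p g) :=
  {v | IsSchurSigma p g (PresentedGroupProP v)}

/-- The isomorphism class of the Schur `σ`-group presented by a tuple of relators. -/
def presentedClass (p g : ℕ) (v : schurTuples p g) : SchurSigmaClass p g :=
  SchurSigmaGrp.cls ⟨PresentedGroupProP v.1, v.2⟩

/-- A set of isomorphism classes is measurable when the set of tuples of relators presenting its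
members is. -/
instance (p g : ℕ) : MeasurableSpace (SchurSigmaClass p g) :=
  MeasurableSpace.map (presentedClass p g) inferInstance

/-- `Meas` as a measure on the set of isomorphism classes of Schur `σ`-groups of rank `g`: the
distribution of the group presented by a random tuple in `X^g`. -/
def schurMeas (p g : ℕ) [Fact p.Prime] : Measure (SchurSigmaClass p g) :=
  ((relatorTupleMeasure p g).comap (Subtype.val : schurTuples p g → _)).map (presentedClass p g)

/-- The mass of each Schur `σ`-group `G` of rank `g` under `Q` is `C / |Aut_σ(G)|`, for every choice
of the involution `σ` (and is `0` when `Aut_σ(G)` is infinite). -/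
def HasMassInvAutSigma {p g : ℕ} (Q : Measure (SchurSigmaClass p g)) (C : ℝ≥0∞) : Prop :=
  ∀ (G : SchurSigmaGrp p g) (σ : contAut G.carrier), IsSchurInvolution σ →
    Q {G.cls} = C / ((ENat.card (autSigma σ) : ℕ∞) : ℝ≥0∞)

end

set_option linter.unusedSectionVars false

/-! ### Basic facts on pro-`p` groups -/

/-! Since `p` is odd, square roots exist and are unique in pro-`p` groups. For an involution `σ`,
the root `y` of `x σ(x)⁻¹` is inverted by `σ`; passing from `x` to `y` replaces the projection to a
`-1`-eigenspace. Hence `X` consists of the elements of `Φ(F)` inverted by `σ`, and inverted elements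
lift along equivariant surjections. Haar invariance makes the image of a random relator uniform on
the image of `X` in any finite quotient (`relatorMeasure_fiber`).

Let `G = F/R` with `R ≤ Φ(F)`. As `F` is free, transgression identifies `H²(G, ℤ/p)` with the
`F`-invariant homomorphisms `R → ℤ/p` (`relRank_eq_finrank_invHom`), and by nilpotency of finite
`p`-groups a tuple normally generates `R` exactly when it separates these
(`closedNormalClosure_eq_iff`). If `Gᵃᵇ` is finite, fewer than `g` relators cannot suffice, by
counting solutions of linear equations over `ℤ/pⁿ`. So `g` relators from `X` present a Schur
`σ`-group as soon as the abelianization is finite, and a first moment estimate over functionals `F →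
ℤ/pⁿ⁺¹` shows that this happens almost surely. The same count applied to the elements `r σ(r)` shows
that `σ` acts as `-1` on the invariant homomorphisms (`invHom_sig`), so that relators take all
values under them.

For finite `G` fix `σ` and count pairs `(v, y)`, where `y` is a generating `g`-tuple of `G` inverted
by `σ` whose group of relations is normally generated by `v`. Each `v` in `Y(G)` occurs with exactly
`|Aut_σ(G)|` tuples `y`. One exists because two Schur involutions `σ, σ'` are always conjugate:
`σσ'` acts trivially on the Frattini quotient, so it has odd order on finite characteristic
quotients and a square root that is a limit of its powers. If `N` is the number of inverted elements
of `Φ(G)`, there are `|GL_g(𝔽_p)| N^g` tuples `y`, and each occurs with probability `|GL_g(𝔽_p)|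
(p^g N)^(-g)`. The factors `N^g` cancel, so `C = |GL_g(𝔽_p)|² p^(-g²)`.

When `Aut_σ(G)` is infinite, a cruder count in finite quotients gives `L · Meas(G) ≤ p^(g²)` for
every `L`, so the mass is `0`. When `Aut_σ(G)` is finite, the fixed points of `σ` near `1` are
central; this forces the centre of `G` modulo its centre to have finite index, and Schur's theorem
with finite `Gᵃᵇ` makes `G` finite. Finally, there are only countably many finite groups, so a
measure carried by them is determined by its point masses. -/

theorem IsPGroup.exists_hom_of_ne_top {p : ℕ} [Fact p.Prime] {P : Type*} [Group P] [Finite P]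
    (hP : IsPGroup p P) {H : Subgroup P} (hH : H ≠ ⊤) :
    ∃ χ : P →* Multiplicative (ZMod p), (∀ h ∈ H, χ h = 1) ∧ ∃ x, χ x ≠ 1 := by
  obtain ⟨M, hM, hHM⟩ := (eq_top_or_exists_le_coatom H).resolve_left hH
  have hnil : Group.IsNilpotent P := hP.isNilpotent
  have hMn : M.Normal := Subgroup.NormalizerCondition.normal_of_coatom _
    Group.normalizerCondition_of_isNilpotent hM
  have hQ : IsPGroup p (P ⧸ M) := hP.to_quotient M
  have : Nontrivial (P ⧸ M) := QuotientGroup.nontrivial_iff.mpr hM.1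
  have hdvd : p ∣ Nat.card (P ⧸ M) := by
    obtain ⟨n, hn0, hn⟩ := hQ.nontrivial_iff_card.mp this
    rw [hn]
    exact dvd_pow_self p hn0.ne'
  obtain ⟨y, hy⟩ := exists_prime_orderOf_dvd_card' p hdvd
  -- As `M` is maximal, its quotient has no proper non-trivial subgroup, so an element of order `p`
  -- generates it.
  have hz : Subgroup.zpowers y = ⊤ := by
    have hle : M ≤ (Subgroup.zpowers y).comap (QuotientGroup.mk' M) := by
      intro m hm
      rw [Subgroup.mem_comap, QuotientGroup.mk'_apply, (QuotientGroup.eq_one_iff m).mpr hm]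
      exact one_mem _
    rcases hM.le_iff.mp hle with h | h
    · rw [← Subgroup.map_comap_eq_self_of_surjective (QuotientGroup.mk'_surjective M)
        (Subgroup.zpowers y), h, ← MonoidHom.range_eq_map]
      exact MonoidHom.range_eq_top.mpr (QuotientGroup.mk'_surjective M)
    · exfalso
      have h1 : Subgroup.zpowers y = ⊥ := by
        rw [← Subgroup.map_comap_eq_self_of_surjective (QuotientGroup.mk'_surjective M)
          (Subgroup.zpowers y), h, QuotientGroup.map_mk'_self]
      rw [Subgroup.zpowers_eq_bot] at h1
      rw [h1, orderOf_one] at hy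
      exact (Fact.out : p.Prime).one_lt.ne hy
  have hcard : Nat.card (P ⧸ M) = p := by
    rw [← hy, ← Nat.card_zpowers, hz, Subgroup.card_top]
  let e : (P ⧸ M) ≃* Multiplicative (ZMod p) :=
    mulEquivOfPrimeCardEq hcard (by simp)
  refine ⟨e.toMonoidHom.comp (QuotientGroup.mk' M), fun h hh => ?_, ?_⟩
  · simp [(QuotientGroup.eq_one_iff h).mpr (hHM hh)]
  · obtain ⟨z, hz⟩ := exists_ne (1 : P ⧸ M)
    obtain ⟨x, rfl⟩ := QuotientGroup.mk'_surjective M z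
    exact ⟨x, fun h => hz (e.injective (h.trans (map_one e).symm))⟩

namespace IsProP

variable {p : ℕ} {G : Type*} [Group G] [TopologicalSpace G]

theorem t2Space (hG : IsProP p G) : T2Space G := by
  have := hG.topologicalGroup
  have := hG.totallyDisconnected
  infer_instance

theorem exists_openNormal (hG : IsProP p G) {W : Set G} (hW : IsOpen W) (h1 : (1 : G) ∈ W) :
    ∃ U : Subgroup G, U.Normal ∧ IsOpen (U : Set G) ∧ (U : Set G) ⊆ W := by
  have := hG.topologicalGroup
  have := hG.totallyDisconnected
  have := hG.compact
  obtain ⟨H, hH⟩ := ProfiniteGrp.exist_openNormalSubgroup_sub_open_nhds_of_one hW h1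
  exact ⟨H.toSubgroup, H.isNormal', H.isOpen', hH⟩

theorem exists_openNormal_separating (hG : IsProP p G) {C : Set G} (hC : IsClosed C) {x : G}
    (hx : x ∉ C) : ∃ U : Subgroup G, U.Normal ∧ IsOpen (U : Set G) ∧ ∀ c ∈ C, c⁻¹ * x ∉ U := by
  have := hG.topologicalGroup
  obtain ⟨U, hn, ho, hU⟩ := hG.exists_openNormal (W := (fun u => x * u⁻¹) ⁻¹' Cᶜ)
    (hC.isOpen_compl.preimage (by fun_prop)) (by simpa using hx)
  refine ⟨U, hn, ho, fun c hc h => ?_⟩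
  have := hU h
  simp only [Set.mem_preimage, mul_inv_rev, inv_inv, Set.mem_compl_iff] at this
  exact this (by simpa using hc)

theorem mem_of_forall_openNormal (hG : IsProP p G) {C : Set G} (hC : IsClosed C) {x : G}
    (h : ∀ U : Subgroup G, U.Normal → IsOpen (U : Set G) → ∃ c ∈ C, c⁻¹ * x ∈ U) : x ∈ C := by
  by_contra hx
  obtain ⟨U, hn, ho, hU⟩ := hG.exists_openNormal_separating hC hx
  obtain ⟨c, hc, hcU⟩ := h U hn ho
  exact hU c hc hcU

theorem eq_of_forall_openNormal (hG : IsProP p G) {x y : G}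
    (h : ∀ U : Subgroup G, U.Normal → IsOpen (U : Set G) → x⁻¹ * y ∈ U) : x = y := by
  have := hG.t2Space
  have := hG.mem_of_forall_openNormal (isClosed_singleton (x := x)) (x := y)
    fun U hn ho => ⟨x, rfl, h U hn ho⟩
  exact (Set.mem_singleton_iff.mp this).symm

theorem finite_quotient (hG : IsProP p G) {U : Subgroup G} (ho : IsOpen (U : Set G)) :
    Finite (G ⧸ U) := by
  have := hG.topologicalGroup
  have := hG.compact
  exact Subgroup.quotient_finite_of_isOpen U ho

theorem isPGroup_quotient (hG : IsProP p G) {U : Subgroup G} [hn : U.Normal]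
    (ho : IsOpen (U : Set G)) : IsPGroup p (G ⧸ U) := by
  obtain ⟨n, h⟩ := hG.index_open_normal U hn ho
  exact IsPGroup.of_card (n := n) (by rw [← h]; rfl)

theorem pow_mem_openNormal (hG : IsProP p G) {U : Subgroup G} (hn : U.Normal)
    (ho : IsOpen (U : Set G)) : ∃ n : ℕ, ∀ x : G, x ^ p ^ n ∈ U := by
  obtain ⟨n, h⟩ := hG.index_open_normal U hn ho
  refine ⟨n, fun x => ?_⟩
  rw [← h]
  exact U.pow_index_mem x

variable [hp : Fact p.Prime]

theorem of_isPGroup (h1 : IsTopologicalGroup G) (h2 : CompactSpace G)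
    (h3 : TotallyDisconnectedSpace G)
    (h : ∀ U : Subgroup G, U.Normal → IsOpen (U : Set G) → ∀ x, ∃ n : ℕ, x ^ p ^ n ∈ U) :
    IsProP p G where
  topologicalGroup := h1
  compact := h2
  totallyDisconnected := h3
  index_open_normal U hn ho := by
    have : Finite (G ⧸ U) := Subgroup.quotient_finite_of_isOpen U ho
    have hP : IsPGroup p (G ⧸ U) := by
      rintro ⟨x⟩
      obtain ⟨n, hx⟩ := h U hn ho x
      exact ⟨n, (QuotientGroup.eq_one_iff (x ^ p ^ n)).mpr hx⟩
    obtain ⟨n, hn⟩ := IsPGroup.iff_card.mp hP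
    exact ⟨n, hn⟩

theorem of_surjective (hG : IsProP p G) {H : Type*} [Group H] [TopologicalSpace H]
    (h1 : IsTopologicalGroup H) (h3 : TotallyDisconnectedSpace H) (π : G →* H)
    (hc : Continuous π) (hs : Function.Surjective π) : IsProP p H := by
  have := hG.compact
  refine of_isPGroup h1 (hs.compactSpace hc) h3 ?_
  · intro U hn ho y
    obtain ⟨x, rfl⟩ := hs y
    obtain ⟨n, h⟩ := hG.pow_mem_openNormal (hn.comap π) (ho.preimage hc)
    exact ⟨n, by simpa using h x⟩

theorem quotient (hG : IsProP p G) [IsTopologicalGroup G] (N : Subgroup G) [hn : N.Normal]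
    (hN : IsClosed (N : Set G)) : IsProP p (G ⧸ N) := by
  have := hG.compact
  refine hG.of_surjective inferInstance (?_ : TotallyDisconnectedSpace (G ⧸ N)) (QuotientGroup.mk' N) QuotientGroup.continuous_mk
    (QuotientGroup.mk'_surjective N)
  suffices TotallySeparatedSpace (G ⧸ N) from inferInstance
  refine ⟨?_⟩
  rintro x - y - hxy
  obtain ⟨x, rfl⟩ := QuotientGroup.mk'_surjective N x
  obtain ⟨y, rfl⟩ := QuotientGroup.mk'_surjective N y
  have hx : x⁻¹ * y ∉ N := fun h => hxy (QuotientGroup.eq.mpr h)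
  obtain ⟨U, hUn, hUo, hU⟩ := hG.exists_openNormal_separating hN hx
  have hxV : x⁻¹ * y ∉ N ⊔ U := by
    intro h
    obtain ⟨n, hn, u, hu, h⟩ := Subgroup.mem_sup_of_normal_right.mp h
    exact hU n hn (by rw [← h]; simpa using hu)
  have hVo : IsOpen ((N ⊔ U : Subgroup G) : Set G) :=
    Subgroup.isOpen_mono le_sup_right hUo
  have hmap : IsOpen (((N ⊔ U).map (QuotientGroup.mk' N) : Subgroup (G ⧸ N)) : Set (G ⧸ N)) :=
    QuotientGroup.isOpenMap_coe _ hVo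
  set V := (N ⊔ U).map (QuotientGroup.mk' N)
  have hV : IsClosed (V : Set (G ⧸ N)) := V.isClosed_of_isOpen hmap
  have hmem : ∀ z : G, (QuotientGroup.mk' N x)⁻¹ * QuotientGroup.mk' N z ∈ V ↔
      x⁻¹ * z ∈ N ⊔ U := by
    intro z
    rw [← map_inv, ← map_mul, ← Subgroup.mem_comap, Subgroup.comap_map_eq]
    simp
  refine ⟨(fun z => (QuotientGroup.mk' N x)⁻¹ * z) ⁻¹' V,
    (fun z => (QuotientGroup.mk' N x)⁻¹ * z) ⁻¹' (V : Set (G ⧸ N))ᶜ, ?_, ?_, ?_, ?_, ?_, ?_⟩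
  · exact hmap.preimage (by fun_prop)
  · exact hV.isOpen_compl.preimage (by fun_prop)
  · exact (hmem x).mpr (by simp)
  · exact fun h => hxV ((hmem y).mp h)
  · intro z _
    exact Classical.em _
  · exact Set.disjoint_left.mpr fun z h1 h2 => h2 h1

theorem of_discrete [IsTopologicalGroup G] [DiscreteTopology G] [Finite G] (h : IsPGroup p G) :
    IsProP p G :=
  of_isPGroup inferInstance inferInstance inferInstance fun U _ _ x => by
    obtain ⟨n, hn⟩ := h x
    exact ⟨n, by rw [hn]; exact one_mem U⟩

/-! ### Square roots -/

/-- Squaring is a bijection of every finite `p`-quotient because `2` is prime to `p`, and open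
normal subgroups separate points. -/
theorem sq_injective (hG : IsProP p G) (h2 : p ≠ 2) {y z : G} (h : y * y = z * z) : y = z := by
  refine hG.eq_of_forall_openNormal fun U hn ho => ?_
  have hco : p.Coprime 2 := (Nat.coprime_primes hp.out Nat.prime_two).mpr h2
  have := (hG.isPGroup_quotient ho).powEquiv hco |>.injective
    (a₁ := QuotientGroup.mk y) (a₂ := QuotientGroup.mk z) (by
      simp only [IsPGroup.powEquiv_apply, pow_two, ← QuotientGroup.mk_mul, h])
  exact QuotientGroup.eq.mp this

/-- Modulo an open normal subgroup of index `p ^ n`, the power `x ^ ((p ^ n + 1) / 2)` squares to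
`x`. So `x` is a limit of squares of elements of the closure `Z` of its powers, and these squares
form a compact set. Taking the root in `Z` puts it into every closed subgroup that contains `x`. -/
theorem exists_sqrt (hG : IsProP p G) (h2 : p ≠ 2) (x : G) :
    ∃ y, y * y = x ∧ ∀ H : Subgroup G, IsClosed (H : Set G) → x ∈ H → y ∈ H := by
  have := hG.topologicalGroup
  have := hG.compact
  have := hG.t2Space
  let Z : Subgroup G := (Subgroup.zpowers x).topologicalClosure
  have hZ : IsClosed (Z : Set G) := Subgroup.isClosed_topologicalClosure _
  have hC : IsClosed ((fun y => y * y) '' (Z : Set G)) :=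
    (hZ.isCompact.image (by fun_prop)).isClosed
  have hx : x ∈ (fun y => y * y) '' (Z : Set G) := by
    refine hG.mem_of_forall_openNormal hC fun U hn ho => ?_
    obtain ⟨n, h⟩ := hG.pow_mem_openNormal hn ho
    have hodd : Odd (p ^ n) := (hp.out.odd_of_ne_two h2).pow
    obtain ⟨k, hk⟩ := hodd
    refine ⟨_, ⟨x ^ (k + 1), Subgroup.le_topologicalClosure _
      (Subgroup.npow_mem_zpowers x _), rfl⟩, ?_⟩
    have : (x ^ (k + 1) * x ^ (k + 1)) = x * x ^ p ^ n := by
      rw [hk, ← pow_add, ← pow_succ']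
      congr 1
      ring
    simp only [this, mul_inv_rev, inv_mul_cancel_right]
    exact inv_mem (h x)
  obtain ⟨y, hy, hyx⟩ := hx
  refine ⟨y, hyx, fun H hH hxH => ?_⟩
  exact Subgroup.topologicalClosure_minimal _ (Subgroup.zpowers_le.mpr hxH) hH hy

/-- Both `σ y` and `y⁻¹` are square roots of `σ(x) x⁻¹`, so they agree. This is the non-commutative
substitute for projecting to the `-1`-eigenspace of `σ`. -/
theorem exists_inverted (hG : IsProP p G) (h2 : p ≠ 2) {σ : G →* G}
    (hσ : ∀ x, σ (σ x) = x) (x : G) :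
    ∃ y, y * y = x * (σ x)⁻¹ ∧ σ y = y⁻¹ ∧
      ∀ H : Subgroup G, IsClosed (H : Set G) → x ∈ H → σ x ∈ H → y ∈ H := by
  obtain ⟨y, hy, hH⟩ := hG.exists_sqrt h2 (x * (σ x)⁻¹)
  refine ⟨y, hy, hG.sq_injective h2 ?_, fun H hc h1 h2 => hH H hc (mul_mem h1 (inv_mem h2))⟩
  rw [← map_mul, hy, ← mul_inv_rev, hy, map_mul, map_inv, hσ, mul_inv_rev, inv_inv]

/-! ### Homomorphisms to `ℤ/p` -/

/-- The Burnside basis theorem in dual form: a proper closed subgroup stays proper in some finite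
`p`-quotient, where it lies in a normal subgroup of index `p`. -/
theorem exists_contH1 (hG : IsProP p G) {H : Subgroup G} (hH : IsClosed (H : Set G))
    (hne : H ≠ ⊤) : ∃ χ ∈ contH1 p G, χ ≠ 0 ∧ ∀ h ∈ H, χ h = 0 := by
  have := hG.topologicalGroup
  obtain ⟨x, hx⟩ : ∃ x, x ∉ H := by
    by_contra! h
    exact hne (eq_top_iff.mpr fun x _ => h x)
  obtain ⟨U, hn, ho, hU⟩ := hG.exists_openNormal_separating hH hx
  have := hG.finite_quotient ho
  have hd : DiscreteTopology (G ⧸ U) := QuotientGroup.discreteTopology ho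
  have hne' : H.map (QuotientGroup.mk' U) ≠ ⊤ := by
    intro h
    obtain ⟨c, hc, hcx⟩ : QuotientGroup.mk' U x ∈ H.map (QuotientGroup.mk' U) := h ▸ trivial
    exact hU c hc (QuotientGroup.eq.mp hcx)
  obtain ⟨χ, h1, y, hy⟩ := (hG.isPGroup_quotient ho).exists_hom_of_ne_top hne'
  refine ⟨fun g => (χ (QuotientGroup.mk' U g)).toAdd, ⟨?_, fun a b => by simp⟩, ?_, ?_⟩
  · exact (continuous_of_discreteTopology (f := fun q : G ⧸ U => (χ q).toAdd)).comp
      QuotientGroup.continuous_mk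
  · intro h
    obtain ⟨y, rfl⟩ := QuotientGroup.mk'_surjective U y
    exact hy (toAdd_eq_zero.mp (congrFun h y))
  · intro h hh
    exact toAdd_eq_zero.mpr (h1 _ ⟨h, hh, rfl⟩)

end IsProP

/-- Continuous homomorphisms from the normal subgroup `R` of `G` to `ℤ/p` which are invariant
under conjugation by `G`. -/
def invHom (p : ℕ) {G : Type*} [Group G] [TopologicalSpace G] (R : Subgroup G) [R.Normal] :
    Submodule (ZMod p) (R → ZMod p) where
  carrier := {f | Continuous f ∧ (∀ x y, f (x * y) = f x + f y) ∧
    ∀ (x : G) (r r' : R), (r' : G) = x * r * x⁻¹ → f r' = f r}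
  zero_mem' := ⟨continuous_const, by simp, by simp⟩
  add_mem' := by
    rintro a b ⟨ha, ha', ha''⟩ ⟨hb, hb', hb''⟩
    refine ⟨ha.add hb, fun x y => ?_, fun x r r' h => ?_⟩
    · simp only [Pi.add_apply, ha', hb']
      ring
    · simp only [Pi.add_apply, ha'' x r r' h, hb'' x r r' h]
  smul_mem' := by
    rintro c a ⟨ha, ha', ha''⟩
    refine ⟨ha.const_smul c, fun x y => ?_, fun x r r' h => ?_⟩
    · simp only [Pi.smul_apply, ha', smul_add]
    · simp only [Pi.smul_apply, ha'' x r r' h]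

/-- Otherwise `R` would lie in every term of the lower central series. -/
theorem commutator_ne_self_of_isNilpotent {P : Type*} [Group P] [hP : Group.IsNilpotent P]
    {R : Subgroup P} [R.Normal] (hR : R ≠ ⊥) : ¬ R ≤ ⁅R, (⊤ : Subgroup P)⁆ := by
  intro h
  obtain ⟨n, hn⟩ := Subgroup.nilpotent_iff_lowerCentralSeries.mp hP
  have key : ∀ k, R ≤ Subgroup.lowerCentralSeries (⊤ : Subgroup P) k := by
    intro k
    induction k with
    | zero => simp
    | succ k ih =>
      exact h.trans (Subgroup.commutator_mono ih le_rfl)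
  exact hR (eq_bot_iff.mpr (hn ▸ key n))

open scoped commutatorElement in
-- A Nakayama lemma for relations. In a suitable finite quotient `N` dies while `R` has a
-- non-trivial image `S`. By nilpotency the commutators of `S` with the whole quotient form a proper
-- subgroup of `S`, and a character of `S` that kills them is invariant under conjugation.
theorem IsProP.exists_invHom {p : ℕ} [Fact p.Prime] {G : Type*} [Group G] [TopologicalSpace G]
    (hG : IsProP p G) {R N : Subgroup G} [R.Normal] [N.Normal] (hN : IsClosed (N : Set G))
    (hNR : N ≤ R) (hne : N ≠ R) :
    ∃ χ ∈ invHom p R, χ ≠ 0 ∧ ∀ r : R, (r : G) ∈ N → χ r = 0 := by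
  have := hG.topologicalGroup
  obtain ⟨x, hxR, hx⟩ := SetLike.exists_of_lt (lt_of_le_of_ne hNR hne)
  obtain ⟨U, hn, ho, hU⟩ := hG.exists_openNormal_separating hN hx
  have hxV : x ∉ N ⊔ U := by
    intro h
    obtain ⟨n, hn, u, hu, h⟩ := Subgroup.mem_sup_of_normal_right.mp h
    exact hU n hn (by rw [← h]; simpa using hu)
  set V := N ⊔ U
  have hVo : IsOpen (V : Set G) := Subgroup.isOpen_mono le_sup_right ho
  have hVn : V.Normal := Subgroup.sup_normal N U
  have := hG.finite_quotient hVo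
  have hd : DiscreteTopology (G ⧸ V) := QuotientGroup.discreteTopology hVo
  have hPG := hG.isPGroup_quotient hVo
  have hnil : Group.IsNilpotent (G ⧸ V) := hPG.isNilpotent
  set q := QuotientGroup.mk' V
  set S := R.map q
  have hSn : S.Normal := Subgroup.Normal.map inferInstance q (QuotientGroup.mk'_surjective V)
  have hS : S ≠ ⊥ := by
    intro h
    have : q x ∈ S := ⟨x, hxR, rfl⟩
    rw [h, Subgroup.mem_bot] at this
    exact hxV ((QuotientGroup.eq_one_iff x).mp this)
  have hlt : (⁅S, (⊤ : Subgroup (G ⧸ V))⁆).subgroupOf S ≠ ⊤ := by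
    rw [Ne, Subgroup.subgroupOf_eq_top]
    exact commutator_ne_self_of_isNilpotent hS
  obtain ⟨χ, h1, y, hy⟩ := (hPG.to_subgroup S).exists_hom_of_ne_top hlt
  let qr : R →* S := q.subgroupMap R
  have hqc : Continuous qr :=
    (QuotientGroup.continuous_mk.comp continuous_subtype_val).subtype_mk _
  refine ⟨fun r => (χ (qr r)).toAdd, ⟨?_, fun a b => by simp, ?_⟩, ?_, ?_⟩
  · exact (continuous_of_discreteTopology (f := fun s : S => (χ s).toAdd)).comp hqc
  · intro a r r' h
    have hm : qr r' * (qr r)⁻¹ ∈ (⁅S, (⊤ : Subgroup (G ⧸ V))⁆).subgroupOf S := by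
      rw [Subgroup.mem_subgroupOf, Subgroup.commutator_comm]
      have : ((qr r' * (qr r)⁻¹ : S) : G ⧸ V) = ⁅q a, q r⁆ := by
        have h1 : ((qr r' : S) : G ⧸ V) = q (a * r * a⁻¹) := congrArg q h
        have h2 : ((qr r : S) : G ⧸ V) = q r := rfl
        rw [Subgroup.coe_mul, Subgroup.coe_inv, h1, h2, commutatorElement_def, map_mul, map_mul,
          map_inv]
      rw [this]
      exact Subgroup.commutator_mem_commutator trivial ⟨r, r.2, rfl⟩
    have := h1 _ hm
    rw [map_mul, map_inv, mul_inv_eq_one] at this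
    simp only [this]
  · intro h
    obtain ⟨r, rfl⟩ := q.subgroupMap_surjective R y
    exact hy (toAdd_eq_zero.mp (congrFun h r))
  · intro r hr
    have : qr r = 1 := Subtype.ext ((QuotientGroup.eq_one_iff (r : G)).mpr
      ((le_sup_left : N ≤ N ⊔ U) hr))
    simp only [this, map_one, toAdd_one]

/-! ### The Frattini subgroup and `ℤ/p`-valued homomorphisms -/

section Frattini

variable {p : ℕ} [hp : Fact p.Prime] {G : Type*} [Group G]

/-- A class in `H¹(G, ℤ/m)` as a homomorphism to the multiplicative copy of `ℤ/m`. -/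
def contHomOfAdditive {m : ℕ} (f : G → ZMod m) (hf : ∀ x y, f (x * y) = f x + f y) :
    G →* Multiplicative (ZMod m) :=
  MonoidHom.mk' (fun x => Multiplicative.ofAdd (f x)) fun x y => by rw [hf, ofAdd_add]

/-- The kernel of an additive function. -/
def additiveKer {m : ℕ} (f : G → ZMod m) (hf : ∀ x y, f (x * y) = f x + f y) : Subgroup G :=
  (contHomOfAdditive f hf).ker

theorem mem_additiveKer {m : ℕ} {f : G → ZMod m} {hf : ∀ x y, f (x * y) = f x + f y} {x : G} :
    x ∈ additiveKer f hf ↔ f x = 0 := Iff.rfl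

instance {m : ℕ} (f : G → ZMod m) (hf : ∀ x y, f (x * y) = f x + f y) :
    (additiveKer f hf).Normal := inferInstanceAs (MonoidHom.ker _).Normal

theorem additive_one {m : ℕ} {f : G → ZMod m} (hf : ∀ x y, f (x * y) = f x + f y) : f 1 = 0 := by
  simpa using hf 1 1

theorem additive_inv {m : ℕ} {f : G → ZMod m} (hf : ∀ x y, f (x * y) = f x + f y) (x : G) :
    f x⁻¹ = -f x := by
  have := hf x⁻¹ x
  rw [inv_mul_cancel, additive_one hf] at this
  exact eq_neg_of_add_eq_zero_left this.symm

theorem additive_pow {m : ℕ} {f : G → ZMod m} (hf : ∀ x y, f (x * y) = f x + f y) (x : G)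
    (n : ℕ) : f (x ^ n) = n * f x := by
  induction n with
  | zero => simp [additive_one hf]
  | succ n ih =>
    rw [pow_succ, hf, ih]
    push_cast
    ring

variable [TopologicalSpace G]

theorem isClosed_additiveKer {m : ℕ} {f : G → ZMod m} (hf : ∀ x y, f (x * y) = f x + f y)
    (hc : Continuous f) : IsClosed (additiveKer f hf : Set G) :=
  (isClosed_discrete ({0} : Set (ZMod m))).preimage hc

theorem additive_commutatorClosure [IsTopologicalGroup G] {m : ℕ} {f : G → ZMod m}
    (hf : ∀ x y, f (x * y) = f x + f y) (hc : Continuous f) {x : G}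
    (hx : x ∈ (commutator G).topologicalClosure) : f x = 0 := by
  have : (commutator G).topologicalClosure ≤ additiveKer f hf :=
    Subgroup.topologicalClosure_minimal _
      (Abelianization.commutator_subset_ker (contHomOfAdditive f hf)) (isClosed_additiveKer hf hc)
  exact this hx

theorem commutatorClosure_le_frattiniProP [IsTopologicalGroup G] :
    (commutator G).topologicalClosure ≤ frattiniProP p G :=
  closure_mono (SetLike.coe_subset_coe.mpr le_sup_left)

instance [IsTopologicalGroup G] : (frattiniProP p G).Normal := by
  refine ⟨fun n hn x => ?_⟩
  have h : x * n * x⁻¹ * n⁻¹ ∈ frattiniProP p G :=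
    commutatorClosure_le_frattiniProP (Subgroup.le_topologicalClosure _
      (Subgroup.commutator_mem_commutator trivial trivial))
  simpa using mul_mem h hn

theorem pow_mem_frattiniProP [IsTopologicalGroup G] (x : G) : x ^ p ∈ frattiniProP p G :=
  Subgroup.le_topologicalClosure _
    ((le_sup_right : _ ≤ commutator G ⊔ _) (Subgroup.subset_closure ⟨x, rfl⟩))

theorem isClosed_frattiniProP [IsTopologicalGroup G] :
    IsClosed (frattiniProP p G : Set G) :=
  Subgroup.isClosed_topologicalClosure _

theorem eq_zero_of_mem_frattiniProP [IsTopologicalGroup G] {x : G} (hx : x ∈ frattiniProP p G)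
    {χ : G → ZMod p} (hχ : χ ∈ contH1 p G) : χ x = 0 := by
  have : frattiniProP p G ≤ additiveKer χ hχ.2 := by
    refine Subgroup.topologicalClosure_minimal _ (sup_le
      (Abelianization.commutator_subset_ker (contHomOfAdditive χ hχ.2)) ?_)
      (isClosed_additiveKer hχ.2 hχ.1)
    rw [Subgroup.closure_le]
    rintro _ ⟨y, rfl⟩
    exact mem_additiveKer.mpr (by rw [additive_pow hχ.2]; simp)
  exact this hx

theorem exists_addMonoidHom_ne_zero {p : ℕ} [Fact p.Prime] {A : Type*} [AddCommGroup A]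
    [Module (ZMod p) A] {x : A} (hx : x ≠ 0) : ∃ φ : A →+ ZMod p, φ x ≠ 0 := by
  by_contra! h
  exact hx ((Module.forall_dual_apply_eq_zero_iff (ZMod p) x).mp fun φ => h φ.toAddMonoidHom)

theorem exists_additive_ne_zero {p : ℕ} [Fact p.Prime] {P : Type*} [Group P]
    (hcomm : ∀ a b : P, a * b = b * a) (hpow : ∀ a : P, a ^ p = 1) {x : P} (hx : x ≠ 1) :
    ∃ φ : P → ZMod p, (∀ a b, φ (a * b) = φ a + φ b) ∧ φ x ≠ 0 := by
  let _ : CommGroup P := { (inferInstance : Group P) with mul_comm := hcomm }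
  let _ : Module (ZMod p) (Additive P) := AddCommGroup.zmodModule fun a => hpow a.toMul
  obtain ⟨φ, hφ⟩ := exists_addMonoidHom_ne_zero (p := p) (x := Additive.ofMul x)
    (fun h => hx (ofMul_eq_zero.mp h))
  exact ⟨fun y => φ (Additive.ofMul y), fun a b => map_add φ _ _, hφ⟩

/-- The quotient by `Φ(G)U`, for `U` open normal, is an `𝔽_p`-vector space, so linear functionals
separate its points. -/
theorem IsProP.mem_frattiniProP_iff (hG : IsProP p G) [IsTopologicalGroup G] {x : G} :
    x ∈ frattiniProP p G ↔ ∀ χ ∈ contH1 p G, χ x = 0 := by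
  refine ⟨fun hx χ hχ => eq_zero_of_mem_frattiniProP hx hχ, fun h => ?_⟩
  refine hG.mem_of_forall_openNormal isClosed_frattiniProP fun U hn ho => ?_
  set V := frattiniProP p G ⊔ U
  have hVo : IsOpen (V : Set G) := Subgroup.isOpen_mono le_sup_right ho
  suffices hx : x ∈ V by
    obtain ⟨n, hn, u, hu, rfl⟩ := Subgroup.mem_sup_of_normal_right.mp hx
    exact ⟨n, hn, by simpa using hu⟩
  have hd : DiscreteTopology (G ⧸ V) := QuotientGroup.discreteTopology hVo
  have hcomm : ∀ a b : G ⧸ V, a * b = b * a := by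
    rintro ⟨a⟩ ⟨b⟩
    refine QuotientGroup.eq.mpr ((le_sup_left : frattiniProP p G ≤ V)
      (commutatorClosure_le_frattiniProP (Subgroup.le_topologicalClosure _ ?_)))
    have : (a * b)⁻¹ * (b * a) = b⁻¹ * a⁻¹ * b⁻¹⁻¹ * a⁻¹⁻¹ := by group
    rw [this]
    exact Subgroup.commutator_mem_commutator trivial trivial
  have hpow : ∀ a : G ⧸ V, a ^ p = 1 := by
    rintro ⟨a⟩
    exact (QuotientGroup.eq_one_iff (a ^ p)).mpr
      ((le_sup_left : frattiniProP p G ≤ V) (pow_mem_frattiniProP a))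
  by_contra hx
  obtain ⟨φ, hφ, hφx⟩ := exists_additive_ne_zero (p := p) hcomm hpow
    (x := QuotientGroup.mk x) fun h => hx ((QuotientGroup.eq_one_iff x).mp h)
  exact hφx (h (fun y => φ (QuotientGroup.mk y)) ⟨(continuous_of_discreteTopology (f := φ)).comp
    QuotientGroup.continuous_mk, fun a b => hφ a b⟩)

end Frattini

/-! ### Topologically generated groups -/

theorem eq_of_eqOn_topGenerators {G H : Type*} [Group G] [TopologicalSpace G] [Group H]
    [TopologicalSpace H] [T2Space H] {S : Set G} (hS : Dense (Subgroup.closure S : Set G))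
    {φ ψ : G →* H} (hφ : Continuous φ) (hψ : Continuous ψ) (h : ∀ s ∈ S, φ s = ψ s) : φ = ψ := by
  have h1 : Subgroup.closure S ≤ φ.eqLocus ψ := (Subgroup.closure_le _).mpr h
  refine MonoidHom.ext fun x => ?_
  have : closure (Subgroup.closure S : Set G) ⊆ {x | φ x = ψ x} :=
    closure_minimal h1 (isClosed_eq hφ hψ)
  exact this (hS x)

/-! ### The free pro-`p` group -/

namespace FreeProP

variable {p g : ℕ}

theorem denseRange_ofFree : DenseRange (ofFree p g) := by
  intro x
  refine (closure_subtype (p := (· ∈ freeProPSubgroup p g))).mpr (closure_mono ?_ x.2)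
  rintro _ ⟨w, rfl⟩
  exact ⟨ofFree p g w, ⟨w, rfl⟩, rfl⟩

theorem dense_closure_gen :
    Dense (Subgroup.closure (Set.range (gen p g)) : Set (FreeProP p g)) := by
  have : Subgroup.closure (Set.range (gen p g)) = (ofFree p g).range := by
    rw [MonoidHom.range_eq_map, ← FreeGroup.closure_range_of, MonoidHom.map_closure,
      ← Set.range_comp]
    rfl
  rw [this]
  exact denseRange_ofFree

variable [hp : Fact p.Prime]

theorem isPGroup_quot (N : PIndex p g) : IsPGroup p N.Quot := by
  obtain ⟨n, hn⟩ := N.index_eq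
  exact IsPGroup.of_card (n := n) hn

theorem isProP : IsProP p (FreeProP p g) := by
  refine IsProP.of_isPGroup inferInstance inferInstance
    (inferInstanceAs (TotallyDisconnectedSpace (freeProPSubgroup p g))) fun U _ ho x => ?_
  obtain ⟨W, hW, hWU⟩ := isOpen_induced_iff.mp ho
  have h1 : (1 : (N : PIndex p g) → N.Quot) ∈ W := by
    exact hWU.ge (one_mem U)
  obtain ⟨I, u, hu, hI⟩ := isOpen_pi_iff.mp hW _ h1
  have hpow : ∀ N : PIndex p g, ∃ n : ℕ, (x.1 N) ^ p ^ n = 1 := fun N => isPGroup_quot N _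
  choose n hn using hpow
  refine ⟨∑ N ∈ I, n N, ?_⟩
  have : (x ^ p ^ (∑ N ∈ I, n N) : FreeProP p g).1 ∈ W := by
    refine hI fun N hN => ?_
    have h : ((x ^ p ^ (∑ N ∈ I, n N) : FreeProP p g).1 N) = 1 := by
      change (x.1 N) ^ p ^ (∑ N ∈ I, n N) = 1
      obtain ⟨k, hk⟩ := Nat.exists_eq_add_of_le
        (Finset.single_le_sum (f := n) (fun _ _ => Nat.zero_le _) hN)
      rw [hk, pow_add, pow_mul, hn, one_pow]
    rw [h]
    exact (hu N hN).2
  exact hWU.le this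

instance : T2Space (FreeProP p g) := isProP.t2Space

theorem hom_ext {H : Type*} [Group H] [TopologicalSpace H] [T2Space H]
    {φ ψ : FreeProP p g →* H} (hφ : Continuous φ) (hψ : Continuous ψ)
    (h : ∀ i, φ (gen p g i) = ψ (gen p g i)) : φ = ψ :=
  eq_of_eqOn_topGenerators dense_closure_gen hφ hψ (by rintro _ ⟨i, rfl⟩; exact h i)

section Lift

variable {P : Type*} [Group P] [TopologicalSpace P]

/-- The lift has as its graph the closure `Γ` of the graph of the abstract homomorphism. It projects
onto the free pro-`p` group by compactness, and injectively because every finite `p`-quotient of `P`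
restricts to one of the coordinates `N` that define the free pro-`p` group. -/
theorem exists_lift (hP : IsProP p P) (y : Fin g → P) :
    ∃ φ : FreeProP p g →* P, Continuous φ ∧ ∀ i, φ (gen p g i) = y i := by
  have := hP.topologicalGroup
  have := hP.compact
  have := hP.t2Space
  let ℓ : FreeGroup (Fin g) →* P := FreeGroup.lift y
  let Γ : Subgroup (FreeProP p g × P) := ((ofFree p g).prod ℓ).range.topologicalClosure
  have hΓ : IsClosed (Γ : Set (FreeProP p g × P)) := Subgroup.isClosed_topologicalClosure _
  have : CompactSpace Γ := isCompact_iff_compactSpace.mp hΓ.isCompact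
  let f : Γ →* FreeProP p g := (MonoidHom.fst _ _).comp Γ.subtype
  have hfc : Continuous f := continuous_fst.comp continuous_subtype_val
  have hmem : ∀ w, (ofFree p g w, ℓ w) ∈ Γ := fun w =>
    Subgroup.le_topologicalClosure _ ⟨w, rfl⟩
  have hsurj : Function.Surjective f := by
    have hcl : IsClosed (Set.range f) := (isCompact_range hfc).isClosed
    intro x
    have : closure (Set.range (ofFree p g)) ⊆ Set.range f :=
      closure_minimal (by rintro _ ⟨w, rfl⟩; exact ⟨⟨_, hmem w⟩, rfl⟩) hcl
    exact this (denseRange_ofFree x)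
  have hinj : Function.Injective f := by
    rw [injective_iff_map_eq_one]
    rintro ⟨⟨x, z⟩, hxz⟩ (rfl : x = 1)
    suffices z = 1 by subst this; rfl
    refine (hP.eq_of_forall_openNormal fun V hn ho => ?_).symm
    let q : FreeGroup (Fin g) →* P ⧸ V := (QuotientGroup.mk' V).comp ℓ
    have hidx : ∃ n, q.ker.index = p ^ n := by
      have := hP.finite_quotient ho
      rw [Subgroup.index_ker]
      exact IsPGroup.iff_card.mp ((hP.isPGroup_quotient ho).to_subgroup q.range)
    let N : PIndex p g := ⟨q.ker, inferInstance, hidx⟩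
    have hopen : IsOpen {a : FreeProP p g × P | a.1.1 N = 1 ∧ z⁻¹ * a.2 ∈ V} := by
      refine IsOpen.inter ?_ (ho.preimage (by fun_prop))
      have hc : Continuous fun a : FreeProP p g × P => a.1.1 N :=
        (continuous_apply N).comp (continuous_subtype_val.comp continuous_fst)
      exact (isOpen_discrete ({1} : Set N.Quot)).preimage hc
    obtain ⟨_, ⟨h1, h2⟩, w, rfl⟩ := mem_closure_iff.mp hxz _ hopen
      ⟨rfl, by simp⟩
    have hw : ℓ w ∈ V := by
      have : w ∈ q.ker := (QuotientGroup.eq_one_iff (N := N.N) w).mp h1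
      exact (QuotientGroup.eq_one_iff (ℓ w)).mp this
    simp only [MonoidHom.prod_apply] at h2
    have := mul_mem h2 (inv_mem hw)
    rw [mul_inv_cancel_right] at this
    simpa using this
  let e : Γ ≃* FreeProP p g := MulEquiv.ofBijective f ⟨hinj, hsurj⟩
  have he : Continuous e.symm :=
    (Continuous.homeoOfEquivCompactToT2 (f := e.toEquiv) hfc).symm.continuous
  refine ⟨((MonoidHom.snd _ _).comp Γ.subtype).comp e.symm.toMonoidHom,
    (continuous_snd.comp continuous_subtype_val).comp he, fun i => ?_⟩
  have : e.symm (gen p g i) = ⟨_, hmem (FreeGroup.of i)⟩ := by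
    rw [MulEquiv.symm_apply_eq]
    rfl
  simp [this, ℓ]

/-- The homomorphism from the free pro-`p` group to a pro-`p` group with prescribed values at the
generators. -/
noncomputable def lift (hP : IsProP p P) (y : Fin g → P) : FreeProP p g →* P :=
  (exists_lift hP y).choose

theorem continuous_lift (hP : IsProP p P) (y : Fin g → P) : Continuous (lift hP y) :=
  (exists_lift hP y).choose_spec.1

@[simp]
theorem lift_gen (hP : IsProP p P) (y : Fin g → P) (i : Fin g) : lift hP y (gen p g i) = y i :=
  (exists_lift hP y).choose_spec.2 i

theorem eq_lift (hP : IsProP p P) {φ : FreeProP p g →* P} (hφ : Continuous φ) :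
    φ = lift hP fun i => φ (gen p g i) :=
  have := hP.t2Space
  hom_ext hφ (continuous_lift _ _) fun i => by rw [lift_gen]

end Lift

/-! ### The involution of the free pro-`p` group -/

/-- The involution of the free pro-`p` group as a homomorphism. -/
noncomputable def sig (p g : ℕ) : FreeProP p g →* FreeProP p g :=
  MonoidHom.mk' (fun x => sigma p g x) (map_mul (sigma p g))

theorem continuous_sig : Continuous (sig p g) := (sigma p g).continuous_toFun

@[simp]
theorem sig_sig (x : FreeProP p g) : sig p g (sig p g x) = x := (sigma p g).left_inv x

@[simp]
theorem sig_gen (i : Fin g) : sig p g (gen p g i) = (gen p g i)⁻¹ := sigma_gen p g i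

theorem map_sig {H : Type*} [Group H] [TopologicalSpace H] [T2Space H]
    {φ : FreeProP p g →* H} (hφ : Continuous φ) {σ : H →* H} (hσ : Continuous σ)
    (h : ∀ i, σ (φ (gen p g i)) = (φ (gen p g i))⁻¹) (x : FreeProP p g) :
    φ (sig p g x) = σ (φ x) := by
  have : φ.comp (sig p g) = σ.comp φ :=
    hom_ext (hφ.comp continuous_sig) (hσ.comp hφ) fun i => by simp [h i]
  exact DFunLike.congr_fun this x

/-! ### Homomorphisms to finite cyclic `p`-groups -/

section Lin

variable {m : ℕ}

theorem isProP_zmod (hm : ∃ n, m = p ^ n) : IsProP p (Multiplicative (ZMod m)) := by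
  obtain ⟨n, rfl⟩ := hm
  have : NeZero (p ^ n) := ⟨pow_ne_zero n hp.out.ne_zero⟩
  refine IsProP.of_discrete (IsPGroup.of_card (n := n) ?_)
  simp

/-- The homomorphism from the free pro-`p` group to `ℤ/m` with prescribed values at the
generators. -/
noncomputable def lin (hm : ∃ n, m = p ^ n) (u : Fin g → ZMod m) (x : FreeProP p g) : ZMod m :=
  (lift (isProP_zmod hm) (fun i => Multiplicative.ofAdd (u i)) x).toAdd

variable (hm : ∃ n, m = p ^ n)

theorem continuous_lin (u : Fin g → ZMod m) : Continuous (lin (p := p) hm u) :=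
  continuous_toAdd.comp (continuous_lift _ _)

theorem lin_mul (u : Fin g → ZMod m) (x y : FreeProP p g) :
    lin hm u (x * y) = lin hm u x + lin hm u y := by
  simp [lin]

@[simp]
theorem lin_gen (u : Fin g → ZMod m) (i : Fin g) : lin hm u (gen p g i) = u i := by
  simp [lin]

theorem additive_ext {f f' : FreeProP p g → ZMod m} (hf : ∀ x y, f (x * y) = f x + f y)
    (hf' : ∀ x y, f' (x * y) = f' x + f' y) (hc : Continuous f) (hc' : Continuous f')
    (h : ∀ i, f (gen p g i) = f' (gen p g i)) : f = f' := by
  have := hom_ext (φ := contHomOfAdditive f hf) (ψ := contHomOfAdditive f' hf')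
    (continuous_ofAdd.comp hc) (continuous_ofAdd.comp hc')
    fun i => congrArg Multiplicative.ofAdd (h i)
  funext x
  exact Multiplicative.ofAdd.injective (DFunLike.congr_fun this x)

theorem eq_lin {f : FreeProP p g → ZMod m} (hf : ∀ x y, f (x * y) = f x + f y)
    (hc : Continuous f) : f = lin hm fun i => f (gen p g i) :=
  additive_ext hf (lin_mul hm _) hc (continuous_lin hm _) fun i => by rw [lin_gen]

theorem additive_sig {f : FreeProP p g → ZMod m} (hf : ∀ x y, f (x * y) = f x + f y)
    (hc : Continuous f) (x : FreeProP p g) : f (sig p g x) = -f x := by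
  refine congrFun (additive_ext (f := fun x => f (sig p g x)) (f' := fun x => -f x)
    (fun x y => by simp [hf]) (fun x y => by simp only [hf]; ring)
    (hc.comp continuous_sig) hc.neg fun i => ?_) x
  rw [sig_gen, additive_inv hf]

theorem lin_sum (u : Fin g → ZMod m) (x : FreeProP p g) :
    lin hm u x = ∑ i, u i * lin hm (Pi.single i 1) x := by
  refine congrFun (additive_ext (f' := fun x => ∑ i, u i * lin hm (Pi.single i 1) x)
    (lin_mul hm u) (fun x y => ?_) (continuous_lin hm u) ?_ fun j => ?_) x
  · simp only [lin_mul, mul_add, Finset.sum_add_distrib]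
  · exact continuous_finsetSum _ fun i _ => continuous_const.mul (continuous_lin hm _)
  · simp [Pi.single_apply]

end Lin

theorem pow_one_eq : ∃ n, p = p ^ n := ⟨1, (pow_one p).symm⟩

theorem lin_mem_contH1 (u : Fin g → ZMod p) : lin pow_one_eq u ∈ contH1 p (FreeProP p g) :=
  ⟨continuous_lin _ u, lin_mul _ u⟩

/-- A class in `H¹(F, ℤ/p)` is determined by its values at the generators. -/
noncomputable def contH1Equiv (p g : ℕ) [Fact p.Prime] :
    contH1 p (FreeProP p g) ≃ₗ[ZMod p] (Fin g → ZMod p) where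
  toFun χ i := χ.1 (gen p g i)
  map_add' _ _ := rfl
  map_smul' _ _ := rfl
  invFun u := ⟨_, lin_mem_contH1 u⟩
  left_inv χ := Subtype.ext (eq_lin pow_one_eq χ.2.2 χ.2.1).symm
  right_inv u := funext fun i => lin_gen pow_one_eq u i

theorem genRank_eq : genRank p (FreeProP p g) = g := by
  rw [genRank, (contH1Equiv p g).finrank_eq, Module.finrank_fin_fun]

/-! ### The relators `t⁻¹ σ(t)` -/

theorem sig_mem_frattini {x : FreeProP p g} (hx : x ∈ frattiniProP p (FreeProP p g)) :
    sig p g x ∈ frattiniProP p (FreeProP p g) := by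
  rw [isProP.mem_frattiniProP_iff] at hx ⊢
  intro χ hχ
  rw [additive_sig hχ.2 hχ.1, hx χ hχ, neg_zero]

/-- For an inverted `s`, the root `y` of `s⁻¹` is inverted too, so `y⁻¹ σ(y) = y⁻² = s`. -/
theorem mem_schurRelators_iff (h2 : p ≠ 2) {s : FreeProP p g} :
    s ∈ schurRelators p g ↔ s ∈ frattiniProP p (FreeProP p g) ∧ sig p g s = s⁻¹ := by
  constructor
  · rintro ⟨t, ht, rfl⟩
    refine ⟨mul_mem (inv_mem ht) (sig_mem_frattini ht), ?_⟩
    change sig p g (t⁻¹ * sig p g t) = (t⁻¹ * sig p g t)⁻¹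
    simp
  · rintro ⟨hs, hσ⟩
    obtain ⟨y, hy, hH⟩ := isProP.exists_sqrt h2 s⁻¹
    refine ⟨y, hH _ isClosed_frattiniProP (inv_mem hs), ?_⟩
    have : sig p g y = y⁻¹ := isProP.sq_injective h2 (by
      rw [← map_mul, hy, map_inv, hσ, ← mul_inv_rev, hy])
    change s = y⁻¹ * sig p g y
    rw [this, ← mul_inv_rev, hy, inv_inv]

theorem sig_relator {s : FreeProP p g} (hs : s ∈ schurRelators p g) : sig p g s = s⁻¹ := by
  obtain ⟨t, ht, rfl⟩ := hs
  change sig p g (t⁻¹ * sig p g t) = (t⁻¹ * sig p g t)⁻¹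
  simp

theorem relator_mem_frattini {s : FreeProP p g} (hs : s ∈ schurRelators p g) :
    s ∈ frattiniProP p (FreeProP p g) := by
  obtain ⟨t, ht, rfl⟩ := hs
  exact mul_mem (inv_mem ht) (sig_mem_frattini ht)

end FreeProP

/-! ### Continuous surjections of pro-`p` groups -/

theorem exists_continuous_descent {F G Y : Type*} [Group F] [TopologicalSpace F] [CompactSpace F]
    [Group G] [TopologicalSpace G] [T2Space G] [TopologicalSpace Y] {π : F →* G}
    (hc : Continuous π) (hs : Function.Surjective π) {f : F → Y} (hf : Continuous f)
    (h : ∀ x, ∀ r ∈ π.ker, f (x * r) = f x) : ∃ k : G → Y, Continuous k ∧ ∀ x, k (π x) = f x := by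
  have hq : Topology.IsQuotientMap π := hc.isClosedMap.isQuotientMap hc hs
  have key : ∀ x y, π x = π y → f x = f y := by
    intro x y hxy
    have := h x (x⁻¹ * y) (by rw [MonoidHom.mem_ker]; simp [hxy])
    rw [← this, mul_inv_cancel_left]
  refine ⟨fun y => f (Function.surjInv hs y), ?_, fun x => key _ _ (Function.surjInv_eq hs _)⟩
  rw [hq.continuous_iff]
  convert hf using 1
  funext x
  exact key _ _ (Function.surjInv_eq hs _)

section Descent

variable {p : ℕ} [hp : Fact p.Prime] {F G : Type*} [Group F] [TopologicalSpace F]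
  [CompactSpace F] [Group G] [TopologicalSpace G] [T2Space G] {π : F →* G}

/-- Inflation of `H¹` along a continuous homomorphism. -/
def contH1Infl (p : ℕ) {F G : Type*} [Group F] [TopologicalSpace F] [Group G] [TopologicalSpace G]
    (π : F →* G) (hc : Continuous π) : contH1 p G →ₗ[ZMod p] contH1 p F where
  toFun χ := ⟨fun x => χ.1 (π x), χ.2.1.comp hc, fun x y =>
    (congrArg χ.1 (map_mul π x y)).trans (χ.2.2 _ _)⟩
  map_add' _ _ := rfl
  map_smul' _ _ := rfl

theorem contH1Infl_injective (hc : Continuous π) (hs : Function.Surjective π) :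
    Function.Injective (contH1Infl p π hc) := by
  intro χ ψ h
  refine Subtype.ext (funext fun y => ?_)
  obtain ⟨x, rfl⟩ := hs y
  exact congrFun (congrArg Subtype.val h) x

theorem exists_contH1_descent (hc : Continuous π) (hs : Function.Surjective π) {χ : F → ZMod p}
    (hχ : χ ∈ contH1 p F) (h : ∀ r ∈ π.ker, χ r = 0) :
    ∃ ψ : G → ZMod p, ψ ∈ contH1 p G ∧ ∀ x, ψ (π x) = χ x := by
  obtain ⟨k, hk, hkπ⟩ := exists_continuous_descent hc hs hχ.1 (fun x r hr => by
    rw [hχ.2, h r hr, add_zero])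
  refine ⟨k, ⟨hk, fun a b => ?_⟩, hkπ⟩
  obtain ⟨x, rfl⟩ := hs a
  obtain ⟨y, rfl⟩ := hs b
  rw [← map_mul, hkπ, hkπ, hkπ, hχ.2]

end Descent

/-! ### Generator ranks of quotients of the free pro-`p` group -/

namespace FreeProP

variable {p g : ℕ} [hp : Fact p.Prime] {G : Type*} [Group G] [TopologicalSpace G] [T2Space G]
  {π : FreeProP p g →* G}

theorem genRank_of_ker_le (hc : Continuous π) (hs : Function.Surjective π)
    (hker : π.ker ≤ frattiniProP p (FreeProP p g)) : genRank p G = g := by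
  have hbij : Function.Bijective (contH1Infl p π hc) := by
    refine ⟨contH1Infl_injective hc hs, fun χ => ?_⟩
    obtain ⟨ψ, hψ, h⟩ := exists_contH1_descent hc hs χ.2 fun r hr =>
      eq_zero_of_mem_frattiniProP (hker hr) χ.2
    exact ⟨⟨ψ, hψ⟩, Subtype.ext (funext h)⟩
  rw [genRank, (LinearEquiv.ofBijective _ hbij).finrank_eq]
  exact genRank_eq

theorem contH1Infl_surjective (hc : Continuous π) (hs : Function.Surjective π)
    (hG : genRank p G = g) : Function.Surjective (contH1Infl p π hc) := by
  have hfin : Module.Finite (ZMod p) (contH1 p (FreeProP p g)) :=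
    Module.Finite.equiv (contH1Equiv p g).symm
  have hinj := contH1Infl_injective (p := p) hc hs
  have : Module.Finite (ZMod p) (contH1 p G) := Module.Finite.of_injective _ hinj
  exact (LinearMap.injective_iff_surjective_of_finrank_eq_finrank
    (show genRank p G = genRank p (FreeProP p g) by rw [hG, genRank_eq])).mp hinj

theorem ker_le_frattini (hc : Continuous π) (hs : Function.Surjective π)
    (hG : genRank p G = g) : π.ker ≤ frattiniProP p (FreeProP p g) := by
  intro r hr
  rw [isProP.mem_frattiniProP_iff]
  intro χ hχ
  obtain ⟨ψ, hψ⟩ := contH1Infl_surjective hc hs hG ⟨χ, hχ⟩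
  have h1 : χ r = ψ.1 (π r) := (congrFun (congrArg Subtype.val hψ) r).symm
  rw [h1, MonoidHom.mem_ker.mp hr, additive_one ψ.2.2]

end FreeProP

/-! ### The group extension defined by a 2-cocycle -/

section CocycleExt

variable {p : ℕ} {G : Type*} [Group G] [TopologicalSpace G]

theorem contZ2_right_one (c : contZ2 p G) (x : G) : c.1 (x, 1) = c.1 (1, 1) := by
  have := c.2.2 x 1 1
  simp only [mul_one] at this
  linear_combination -this

theorem contZ2_left_one (c : contZ2 p G) (x : G) : c.1 (1, x) = c.1 (1, 1) := by
  have := c.2.2 1 1 x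
  simp only [one_mul] at this
  linear_combination this

theorem contZ2_inv_comm (c : contZ2 p G) (x : G) : c.1 (x⁻¹, x) = c.1 (x, x⁻¹) := by
  have := c.2.2 x x⁻¹ x
  simp only [mul_inv_cancel, inv_mul_cancel, contZ2_left_one c x, contZ2_right_one c x] at this
  linear_combination this

/-- The central extension of `G` by `ℤ/p` defined by a 2-cocycle. -/
@[ext]
structure CocycleExt (c : contZ2 p G) where
  /-- The coordinate in `ℤ/p`. -/
  fib : ZMod p
  /-- The coordinate in `G`. -/
  base : G

namespace CocycleExt

variable (c : contZ2 p G)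

/-- The underlying space of the extension is the product `ℤ/p × G`. -/
def equivProd : CocycleExt c ≃ ZMod p × G where
  toFun a := (a.fib, a.base)
  invFun q := ⟨q.1, q.2⟩

instance : TopologicalSpace (CocycleExt c) := .induced (equivProd c) inferInstance

/-- The underlying space of the extension is homeomorphic to the product `ℤ/p × G`. -/
def homeoProd : CocycleExt c ≃ₜ ZMod p × G := (equivProd c).toHomeomorphOfIsInducing ⟨rfl⟩

theorem continuous_fib : Continuous (fib : CocycleExt c → ZMod p) :=
  continuous_fst.comp (homeoProd c).continuous

theorem continuous_base : Continuous (base : CocycleExt c → G) :=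
  continuous_snd.comp (homeoProd c).continuous

theorem continuous_mk {Y : Type*} [TopologicalSpace Y] {f : Y → ZMod p} {h : Y → G}
    (hf : Continuous f) (hh : Continuous h) : Continuous fun y => (⟨f y, h y⟩ : CocycleExt c) :=
  (homeoProd c).symm.continuous.comp (hf.prodMk hh)

instance : Mul (CocycleExt c) := ⟨fun a b => ⟨a.fib + b.fib + c.1 (a.base, b.base), a.base * b.base⟩⟩

/-- Cocycles are not assumed normalized, hence the shift by `c (1, 1)` in the unit and in the
inverse. -/
instance : One (CocycleExt c) := ⟨⟨-c.1 (1, 1), 1⟩⟩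

instance : Inv (CocycleExt c) :=
  ⟨fun a => ⟨-a.fib - c.1 (a.base, a.base⁻¹) - c.1 (1, 1), a.base⁻¹⟩⟩

theorem mul_def (a b : CocycleExt c) :
    a * b = ⟨a.fib + b.fib + c.1 (a.base, b.base), a.base * b.base⟩ := rfl

theorem one_def : (1 : CocycleExt c) = ⟨-c.1 (1, 1), 1⟩ := rfl

theorem inv_def (a : CocycleExt c) :
    a⁻¹ = ⟨-a.fib - c.1 (a.base, a.base⁻¹) - c.1 (1, 1), a.base⁻¹⟩ := rfl

instance : Group (CocycleExt c) := Group.ofLeftAxioms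
  (fun a b d => by
    simp only [mul_def]
    refine CocycleExt.ext ?_ (mul_assoc _ _ _)
    linear_combination -(c.2.2 a.base b.base d.base))
  (fun a => by
    simp only [mul_def, one_def]
    refine CocycleExt.ext ?_ (one_mul _)
    rw [contZ2_left_one c a.base]
    ring)
  (fun a => by
    simp only [mul_def, one_def, inv_def]
    refine CocycleExt.ext ?_ (inv_mul_cancel _)
    rw [contZ2_inv_comm]
    ring)

/-- The projection of the extension to `G`. -/
def proj : CocycleExt c →* G := MonoidHom.mk' base fun _ _ => rfl

theorem proj_apply (a : CocycleExt c) : proj c a = a.base := rfl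

theorem pow_eq {a : CocycleExt c} (ha : proj c a = 1) (n : ℕ) :
    a ^ n = ⟨n * (a.fib + c.1 (1, 1)) - c.1 (1, 1), 1⟩ := by
  induction n with
  | zero => ext <;> simp [one_def]
  | succ n ih =>
    rw [pow_succ, ih, mul_def]
    rw [proj_apply] at ha
    refine CocycleExt.ext ?_ ?_
    · simp only [ha]
      push_cast
      ring
    · simp [ha]

instance [IsTopologicalGroup G] : IsTopologicalGroup (CocycleExt c) where
  continuous_mul := by
    have h1 := (continuous_base c).comp (continuous_fst (X := CocycleExt c) (Y := CocycleExt c))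
    have h2 := (continuous_base c).comp (continuous_snd (X := CocycleExt c) (Y := CocycleExt c))
    exact continuous_mk c ((((continuous_fib c).comp continuous_fst).add
      ((continuous_fib c).comp continuous_snd)).add (c.2.1.comp (h1.prodMk h2))) (h1.mul h2)
  continuous_inv := by
    have h := continuous_base c
    exact continuous_mk c (((continuous_fib c).neg.sub (c.2.1.comp (h.prodMk h.inv))).sub
      continuous_const) h.inv

/-- A `p`-power of `x` lies in `U` times the kernel of the projection. That kernel is central of
exponent `p`, so one further `p`-th power lies in `U`. -/
theorem isProP [hp : Fact p.Prime] (hG : IsProP p G) : IsProP p (CocycleExt c) := by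
  have := hG.topologicalGroup
  have := hG.compact
  have := hG.totallyDisconnected
  refine IsProP.of_isPGroup inferInstance (homeoProd c).symm.compactSpace
    (homeoProd c).symm.totallyDisconnectedSpace fun U hn ho x => ?_
  have hs : Function.Surjective (proj c) := fun y => ⟨⟨0, y⟩, rfl⟩
  have hopen : IsOpen (U.map (proj c) : Set G) :=
    (isOpenMap_snd.comp (homeoProd c).isOpenMap) _ ho
  obtain ⟨n, hpow⟩ := hG.pow_mem_openNormal (hn.map _ hs) hopen
  obtain ⟨u, hu, hux⟩ := hpow (proj c x)
  refine ⟨n + 1, ?_⟩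
  have hk : proj c (u⁻¹ * x ^ p ^ n) = 1 := by
    rw [map_mul, map_inv, map_pow, hux, inv_mul_cancel]
  have hkp : (u⁻¹ * x ^ p ^ n) ^ p = 1 := by
    rw [pow_eq c hk, one_def]
    simp
  rw [← QuotientGroup.eq_one_iff, pow_succ, pow_mul]
  have hq : ((x ^ p ^ n : CocycleExt c) : CocycleExt c ⧸ U) = ((u⁻¹ * x ^ p ^ n :) : CocycleExt c ⧸ U) := by
    rw [QuotientGroup.mk_mul, (QuotientGroup.eq_one_iff u⁻¹).mpr (inv_mem hu), one_mul]
  rw [QuotientGroup.mk_pow, hq, ← QuotientGroup.mk_pow, hkp, QuotientGroup.mk_one]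

end CocycleExt

end CocycleExt

/-! ### Transgression: `H²` of a quotient and invariant homomorphisms on its relations -/

namespace FreeProP

variable {p g : ℕ} [hp : Fact p.Prime] {G : Type*} [Group G] [TopologicalSpace G]
  {π : FreeProP p g →* G}

/-- The inflation of a 2-cocycle to the free pro-`p` group is a coboundary. -/
theorem exists_coboundary_eq_infl (hG : IsProP p G) (hc : Continuous π) (c : contZ2 p G) :
    ∃ f : FreeProP p g → ZMod p, Continuous f ∧
      ∀ x y, f y - f (x * y) + f x = c.1 (π x, π y) := by
  have := hG.t2Space
  have hE := CocycleExt.isProP c hG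
  let y : Fin g → CocycleExt c := fun i => ⟨0, π (gen p g i)⟩
  let θ := lift hE y
  have hθ : ∀ x, (θ x).base = π x := by
    have : (CocycleExt.proj c).comp θ = π :=
      hom_ext ((CocycleExt.continuous_base c).comp (continuous_lift hE y)) hc fun i => by
        simp [θ, CocycleExt.proj_apply, y]
    exact DFunLike.congr_fun this
  have hθc : Continuous fun x => (θ x).fib :=
    (CocycleExt.continuous_fib c).comp (continuous_lift hE y)
  -- By the multiplication law of the extension, the fibre coordinate of the lift has the negative
  -- of the inflated cocycle as its coboundary.
  refine ⟨fun x => -(θ x).fib, hθc.neg, fun x y => ?_⟩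
  have : (θ (x * y)).fib = (θ x).fib + (θ y).fib + c.1 ((θ x).base, (θ y).base) := by
    rw [map_mul]
    rfl
  simp only [this, hθ]
  ring

/-- Pairs of a continuous function `f` on the free pro-`p` group and a 2-cocycle of `G` whose
inflation is the coboundary of `f`. -/
def trivializations (p : ℕ) {g : ℕ} {G : Type*} [Group G] [TopologicalSpace G]
    (π : FreeProP p g →* G) :
    Submodule (ZMod p) ((FreeProP p g → ZMod p) × contZ2 p G) where
  carrier := {q | Continuous q.1 ∧ ∀ x y, q.1 y - q.1 (x * y) + q.1 x = q.2.1 (π x, π y)}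
  zero_mem' := ⟨continuous_const, by simp⟩
  add_mem' := by
    rintro a b ⟨ha, ha'⟩ ⟨hb, hb'⟩
    refine ⟨ha.add hb, fun x y => ?_⟩
    simp only [Prod.fst_add, Prod.snd_add, Pi.add_apply, Submodule.coe_add, ← ha', ← hb']
    ring
  smul_mem' := by
    rintro c a ⟨ha, ha'⟩
    refine ⟨ha.const_smul c, fun x y => ?_⟩
    simp only [Prod.smul_fst, Prod.smul_snd, Pi.smul_apply, SetLike.val_smul, ← ha', smul_eq_mul]
    ring

section Trivializations

variable {q : (FreeProP p g → ZMod p) × contZ2 p G} (hq : q ∈ trivializations p π)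

include hq

theorem trivialization_one : q.1 1 = q.2.1 (1, 1) := by
  have := hq.2 1 1
  simp only [mul_one, map_one] at this
  linear_combination this

theorem trivialization_mul_ker (x : FreeProP p g) {r : FreeProP p g} (hr : r ∈ π.ker) :
    q.1 (x * r) = q.1 x + (q.1 r - q.1 1) := by
  have := hq.2 x r
  rw [MonoidHom.mem_ker.mp hr, contZ2_right_one, ← trivialization_one hq] at this
  linear_combination -this

theorem trivialization_ker_mul (x : FreeProP p g) {r : FreeProP p g} (hr : r ∈ π.ker) :
    q.1 (r * x) = q.1 x + (q.1 r - q.1 1) := by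
  have := hq.2 r x
  rw [MonoidHom.mem_ker.mp hr, contZ2_left_one, ← trivialization_one hq] at this
  linear_combination -this

end Trivializations

/-- The class of the cocycle of a trivialization. -/
def trivializationsToH2 (π : FreeProP p g →* G) : trivializations p π →ₗ[ZMod p] contH2 p G :=
  ((contB2 p G).submoduleOf (contZ2 p G)).mkQ ∘ₗ LinearMap.snd _ _ _ ∘ₗ Submodule.subtype _

/-- The transgression: the restriction of a trivialization to the kernel. -/
def trivializationsToInvHom (π : FreeProP p g →* G) :
    trivializations p π →ₗ[ZMod p] invHom p π.ker where
  toFun q := ⟨fun r => q.1.1 r - q.1.1 1, (q.2.1.comp continuous_subtype_val).sub continuous_const,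
    fun x y => by
      have := trivialization_mul_ker q.2 x y.2
      simp only [Subgroup.coe_mul]
      linear_combination this,
    fun x r r' h => by
      have h1 := trivialization_mul_ker q.2 x r.2
      have h2 := trivialization_ker_mul q.2 x r'.2
      have : (r' : FreeProP p g) * x = x * r := by rw [h, inv_mul_cancel_right]
      rw [this] at h2
      linear_combination h1 - h2⟩
  map_add' a b := by
    refine Subtype.ext (funext fun r => ?_)
    simp only [Submodule.coe_add, Prod.fst_add, Pi.add_apply]
    ring
  map_smul' c a := by
    refine Subtype.ext (funext fun r => ?_)
    simp only [SetLike.val_smul, Prod.smul_fst, Pi.smul_apply, smul_eq_mul, RingHom.id_apply]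
    ring

theorem trivializationsToH2_surjective (hG : IsProP p G) (hc : Continuous π) :
    Function.Surjective (trivializationsToH2 π) := by
  intro y
  obtain ⟨c, rfl⟩ := Submodule.mkQ_surjective _ y
  obtain ⟨f, hf, h⟩ := exists_coboundary_eq_infl hG hc c
  exact ⟨⟨(f, c), hf, h⟩, rfl⟩

theorem continuous_of_mul_openSubgroup {F Y : Type*} [Group F] [TopologicalSpace F]
    [IsTopologicalGroup F] [TopologicalSpace Y] {U : Subgroup F} (ho : IsOpen (U : Set F))
    {f : F → Y} (h : ∀ x, ∀ u ∈ U, f (x * u) = f x) : Continuous f := by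
  refine IsLocallyConstant.continuous ((IsLocallyConstant.iff_exists_open f).mpr fun x =>
    ⟨(fun y => x⁻¹ * y) ⁻¹' U, ho.preimage (by fun_prop), by simp, fun y hy => ?_⟩)
  have := h x _ hy
  rwa [mul_inv_cancel_left] at this

/-- Every invariant homomorphism on a normal subgroup extends to a continuous function which is
equivariant under translations. -/
theorem exists_equivariant_extension {R : Subgroup (FreeProP p g)} [R.Normal] {χ : R → ZMod p}
    (hχ : χ ∈ invHom p R) : ∃ f : FreeProP p g → ZMod p, Continuous f ∧
      ∀ x (r : R), f (x * r) = f x + χ r := by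
  have h0 : IsOpen (χ ⁻¹' {0}) := (isOpen_discrete _).preimage hχ.1
  obtain ⟨W, hW, hWχ⟩ := isOpen_induced_iff.mp h0
  have h1 : (1 : FreeProP p g) ∈ W := by
    have : (1 : R) ∈ (Subtype.val : R → FreeProP p g) ⁻¹' W := by
      rw [hWχ]
      exact additive_one hχ.2.1
    exact this
  obtain ⟨U, hn, ho, hU⟩ := isProP.exists_openNormal hW h1
  have hker : ∀ r r' : R, (r : FreeProP p g)⁻¹ * r' ∈ U → χ r' = χ r := by
    intro r r' h
    have : r⁻¹ * r' ∈ (Subtype.val : R → FreeProP p g) ⁻¹' W := hU h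
    rw [hWχ] at this
    have h0 : χ (r⁻¹ * r') = 0 := this
    rw [hχ.2.1, additive_inv hχ.2.1] at h0
    linear_combination h0
  -- Write `x = s(x) r u` with a representative `s(x)` of the coset of `R ⊔ U`, `r ∈ R` and `u ∈ U`.
  -- As `χ` is trivial on `R ∩ U`, the value `χ r` depends on `x` alone; this is the required
  -- extension.
  let s : FreeProP p g → FreeProP p g := fun x => (QuotientGroup.mk x : FreeProP p g ⧸ (R ⊔ U)).out
  have hs : ∀ x, ∃ r : R, (r : FreeProP p g)⁻¹ * ((s x)⁻¹ * x) ∈ U := by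
    intro x
    have : (s x)⁻¹ * x ∈ R ⊔ U := QuotientGroup.eq.mp (Quotient.out_eq _)
    obtain ⟨r, hr, u, hu, h⟩ := Subgroup.mem_sup_of_normal_right.mp this
    exact ⟨⟨r, hr⟩, by rw [← h]; simpa using hu⟩
  choose ρ hρ using hs
  have hval : ∀ x (r : R), (r : FreeProP p g)⁻¹ * ((s x)⁻¹ * x) ∈ U → χ (ρ x) = χ r := by
    intro x r hr
    refine hker _ _ ?_
    have := mul_mem hr (inv_mem (hρ x))
    convert this using 1
    group
  have hsm : ∀ x y, y ∈ R ⊔ U → s (x * y) = s x := by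
    intro x y hy
    have : (QuotientGroup.mk (x * y) : FreeProP p g ⧸ (R ⊔ U)) = QuotientGroup.mk x :=
      (QuotientGroup.eq.mpr (by simpa using hy)).symm
    simp only [s, this]
  refine ⟨fun x => χ (ρ x), continuous_of_mul_openSubgroup ho fun x u hu => ?_, fun x r => ?_⟩
  · refine hval _ _ ?_
    rw [hsm x u (Subgroup.mem_sup_right hu)]
    have := mul_mem (hρ x) hu
    convert this using 1
    group
  · rw [← hχ.2.1]
    refine hval _ _ ?_
    rw [hsm x r (Subgroup.mem_sup_left r.2)]
    have := hn.conj_mem _ (hρ x) (r : FreeProP p g)⁻¹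
    convert this using 1
    simp only [Subgroup.coe_mul]
    group

theorem trivializationsToInvHom_surjective (hG : IsProP p G) (hc : Continuous π)
    (hs : Function.Surjective π) : Function.Surjective (trivializationsToInvHom π) := by
  have := hG.t2Space
  rintro ⟨χ, hχ⟩
  obtain ⟨f, hf, hfr⟩ := exists_equivariant_extension hχ
  have hfl : ∀ x (r : π.ker), f (r * x) = f x + χ r := by
    intro x r
    have hm : x⁻¹ * r * x ∈ π.ker := by
      simpa using (inferInstance : π.ker.Normal).conj_mem _ r.2 x⁻¹
    have h1 := hfr x ⟨_, hm⟩
    have h2 : χ ⟨x⁻¹ * r * x, hm⟩ = χ r := hχ.2.2 x⁻¹ r ⟨_, hm⟩ (by simp)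
    rw [h2] at h1
    rw [← h1]
    congr 1
    group
  -- As `f` is equivariant on both sides under the kernel, its coboundary is unchanged by the kernel
  -- in either variable and descends to a cocycle of `G`.
  obtain ⟨c, hcc, hcπ⟩ := exists_continuous_descent (π := π.prodMap π) (hc.prodMap hc)
    (hs.prodMap hs) (f := fun q => f q.2 - f (q.1 * q.2) + f q.1) (by fun_prop) (by
      rintro ⟨x, y⟩ ⟨r, r'⟩ hr
      have hr1 : r ∈ π.ker := congrArg Prod.fst hr
      have hr2 : r' ∈ π.ker := congrArg Prod.snd hr
      have h1 := hfr x ⟨r, hr1⟩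
      have h2 := hfr y ⟨r', hr2⟩
      have hm : y⁻¹ * r * y ∈ π.ker := by
        simpa using (inferInstance : π.ker.Normal).conj_mem _ hr1 y⁻¹
      have h3 := hfr (x * y) (⟨y⁻¹ * r * y, hm⟩ * ⟨r', hr2⟩)
      have h4 : χ ⟨y⁻¹ * r * y, hm⟩ = χ ⟨r, hr1⟩ := hχ.2.2 y⁻¹ ⟨r, hr1⟩ ⟨_, hm⟩ (by simp)
      rw [hχ.2.1, h4] at h3
      have h5 : x * y * ((⟨y⁻¹ * r * y, hm⟩ * ⟨r', hr2⟩ : π.ker) : FreeProP p g) =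
          x * r * (y * r') := by
        simp only [Subgroup.coe_mul]
        group
      rw [h5] at h3
      simp only [Prod.mk_mul_mk]
      linear_combination h1 + h2 - h3)
  have hcoc : c ∈ contZ2 p G := by
    refine ⟨hcc, fun a b d => ?_⟩
    obtain ⟨x, rfl⟩ := hs a
    obtain ⟨y, rfl⟩ := hs b
    obtain ⟨z, rfl⟩ := hs d
    have e : ∀ x y, c (π x, π y) = f y - f (x * y) + f x := fun x y => hcπ (x, y)
    rw [← map_mul, ← map_mul, e, e, e, e, mul_assoc]
    ring
  refine ⟨⟨(f, ⟨c, hcoc⟩), hf, fun x y => (hcπ (x, y)).symm⟩, Subtype.ext (funext fun r => ?_)⟩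
  have := hfr 1 r
  rw [one_mul] at this
  change f r - f 1 = χ r
  rw [this]
  ring

/-- If the cocycle is the coboundary of `k`, then `f - k ∘ π` is a homomorphism. It vanishes on the
kernel of `π` because that lies in the Frattini subgroup, so `f` is constant there. Conversely, if
`f` is constant on the kernel, it descends to a cochain whose coboundary is the cocycle. -/
theorem trivializations_ker_eq (hG : IsProP p G) (hc : Continuous π)
    (hs : Function.Surjective π) (hker : π.ker ≤ frattiniProP p (FreeProP p g)) :
    LinearMap.ker (trivializationsToH2 π) = LinearMap.ker (trivializationsToInvHom π) := by
  have := hG.t2Space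
  ext ⟨⟨f, c⟩, hfc⟩
  rw [LinearMap.mem_ker, LinearMap.mem_ker]
  constructor
  · intro h
    have hB : c.1 ∈ contB2 p G := (Submodule.Quotient.mk_eq_zero
      ((contB2 p G).submoduleOf (contZ2 p G)) (x := c)).mp h
    obtain ⟨k, hk, hkc⟩ := hB
    have hadd : (fun x => f x - k (π x)) ∈ contH1 p (FreeProP p g) := by
      refine ⟨hfc.1.sub (Continuous.comp hk hc), fun x y => ?_⟩
      have h1 := hfc.2 x y
      have h2 : k (π y) - k (π x * π y) + k (π x) = c.1 (π x, π y) := congrFun hkc (π x, π y)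
      simp only [map_mul]
      simp only at h1
      linear_combination h2 - h1
    refine Subtype.ext (funext fun r => ?_)
    have h1 := eq_zero_of_mem_frattiniProP (hker r.2) hadd
    have h2 := additive_one (f := fun x => f x - k (π x)) hadd.2
    simp only [MonoidHom.mem_ker.mp r.2, map_one] at h1 h2
    change f r - f 1 = 0
    linear_combination h1 - h2
  · intro h
    have hr : ∀ r ∈ π.ker, f r - f 1 = 0 := fun r hr =>
      congrFun (congrArg Subtype.val h) ⟨r, hr⟩
    obtain ⟨k, hk, hkπ⟩ := exists_continuous_descent hc hs hfc.1 fun x r hrk => by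
      rw [trivialization_mul_ker hfc x hrk, hr r hrk, add_zero]
    refine (Submodule.Quotient.mk_eq_zero _).mpr ⟨k, hk, ?_⟩
    funext ⟨a, b⟩
    obtain ⟨x, rfl⟩ := hs a
    obtain ⟨y, rfl⟩ := hs b
    change k (π y) - k (π x * π y) + k (π x) = c.1 (π x, π y)
    rw [← map_mul, hkπ, hkπ, hkπ]
    exact hfc.2 x y

/-- `H²(G, ℤ/p)` for a quotient `G` of a free pro-`p` group by a subgroup of its Frattini
subgroup. -/
theorem relRank_eq_finrank_invHom (hG : IsProP p G) (hc : Continuous π)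
    (hs : Function.Surjective π) (hker : π.ker ≤ frattiniProP p (FreeProP p g)) :
    relRank p G = Module.finrank (ZMod p) (invHom p π.ker) := by
  refine LinearEquiv.finrank_eq ?_
  exact ((trivializationsToH2 π).quotKerEquivOfSurjective
    (trivializationsToH2_surjective hG hc)).symm ≪≫ₗ
    Submodule.quotEquivOfEq _ _ (trivializations_ker_eq hG hc hs hker) ≪≫ₗ
    (trivializationsToInvHom π).quotKerEquivOfSurjective
      (trivializationsToInvHom_surjective hG hc hs)

end FreeProP

/-! ### Spaces of functions and separating points -/

section Separation

variable {k : Type*} [Field k] {S : Type*}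

theorem exists_separating_points [Nonempty S] (n : ℕ) (W : Submodule k (S → k))
    [Module.Finite k W] (hW : Module.finrank k W ≤ n) :
    ∃ s : Fin n → S, ∀ χ ∈ W, (∀ i, χ (s i) = 0) → χ = 0 := by
  induction n generalizing W with
  | zero =>
    have : W = ⊥ := Submodule.finrank_eq_zero.mp (Nat.le_zero.mp hW)
    exact ⟨Fin.elim0, fun χ hχ _ => by simpa [this] using hχ⟩
  | succ n ih =>
    by_cases h0 : W = ⊥
    · exact ⟨fun _ => Classical.arbitrary S, fun χ hχ _ => by simpa [h0] using hχ⟩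
    · obtain ⟨χ₀, hχ₀, hne⟩ := Submodule.exists_mem_ne_zero_of_ne_bot h0
      obtain ⟨s₀, hs₀⟩ := Function.ne_iff.mp hne
      let W' : Submodule k (S → k) := W ⊓ LinearMap.ker (LinearMap.proj s₀)
      have hlt : W' < W := lt_of_le_of_ne inf_le_left fun h => hs₀ (by
        have : χ₀ ∈ W' := h ▸ hχ₀
        exact this.2)
      have hlt' := Submodule.finrank_lt_finrank_of_lt hlt
      have : Module.Finite k W' := Submodule.finiteDimensional_of_le hlt.le
      obtain ⟨s, hs⟩ := ih W' (by omega)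
      refine ⟨Fin.cons s₀ s, fun χ hχ h => hs χ ⟨hχ, ?_⟩ fun i => ?_⟩
      · simpa using h 0
      · simpa using h i.succ

theorem separating_iff_det_ne_zero {n : ℕ} {W : Submodule k (S → k)}
    (b : Module.Basis (Fin n) k W) (s : Fin n → S) :
    (∀ χ ∈ W, (∀ i, χ (s i) = 0) → χ = 0) ↔
      (Matrix.of fun i j => (b j).1 (s i)).det ≠ 0 := by
  rw [Ne, ← Matrix.exists_mulVec_eq_zero_iff, not_exists]
  have key : ∀ (c : Fin n → k) (i : Fin n), (∑ j, c j • b j : W).1 (s i) =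
      ((Matrix.of fun i j => (b j).1 (s i)).mulVec c) i := by
    intro c i
    simp only [Submodule.coe_sum, Finset.sum_apply, SetLike.val_smul, Pi.smul_apply, smul_eq_mul,
      Matrix.mulVec, dotProduct, Matrix.of_apply]
    exact Finset.sum_congr rfl fun j _ => mul_comm _ _
  constructor
  · rintro h c ⟨hc, h0⟩
    refine hc (funext fun j => ?_)
    have h1 : (∑ j, c j • b j : W) = 0 := Subtype.ext (h _ (∑ j, c j • b j : W).2 fun i => by
      rw [key, h0]
      rfl)
    exact linearIndependent_iff'.mp b.linearIndependent Finset.univ c h1 j (Finset.mem_univ j)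
  · intro h χ hχ h0
    by_contra hne
    refine h (fun j => b.repr ⟨χ, hχ⟩ j) ⟨fun hc => hne ?_, funext fun i => ?_⟩
    · have : b.repr ⟨χ, hχ⟩ = 0 := Finsupp.ext fun j => congrFun hc j
      exact congrArg Subtype.val (b.repr.map_eq_zero_iff.mp this)
    · rw [← key, b.sum_repr]
      exact h0 i

/-- The joint values form a subgroup of `(ℤ/p)ⁿ`, hence a subspace. A non-zero functional killing it
would be a linear relation among the `f j`. -/
theorem exists_joint_value {p n : ℕ} [Fact p.Prime] {R : Type*} [Group R] {f : Fin n → R → ZMod p}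
    (hf : ∀ j x y, f j (x * y) = f j x + f j y) (hli : LinearIndependent (ZMod p) f)
    (a : Fin n → ZMod p) : ∃ r, ∀ j, f j r = a j := by
  let A : AddSubgroup (Fin n → ZMod p) :=
    { carrier := Set.range fun r j => f j r
      zero_mem' := ⟨1, funext fun j => additive_one (hf j)⟩
      add_mem' := by
        rintro _ _ ⟨x, rfl⟩ ⟨y, rfl⟩
        exact ⟨x * y, funext fun j => hf j x y⟩
      neg_mem' := by
        rintro _ ⟨x, rfl⟩
        exact ⟨x⁻¹, funext fun j => additive_inv (hf j) x⟩ }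
  let W : Submodule (ZMod p) (Fin n → ZMod p) := AddSubgroup.toZModSubmodule p A
  have hW : W = ⊤ := by
    by_contra hne
    obtain ⟨φ, hφ, hle⟩ := Submodule.exists_le_ker_of_lt_top W (lt_top_iff_ne_top.mpr hne)
    refine hφ (LinearMap.pi_ext' fun j => LinearMap.ext_ring ?_)
    refine linearIndependent_iff'.mp hli Finset.univ (fun j => φ (Pi.single j 1)) ?_ j
      (Finset.mem_univ j)
    funext r
    have h0 : φ (fun j => f j r) = 0 := hle (show (fun j => f j r) ∈ A from ⟨r, rfl⟩)
    rw [LinearMap.pi_apply_eq_sum_univ φ] at h0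
    simp only [Finset.sum_apply, Pi.smul_apply, smul_eq_mul, Pi.zero_apply]
    rw [← h0]
    refine Finset.sum_congr rfl fun j _ => ?_
    rw [smul_eq_mul, mul_comm]
    congr 2
    funext i
    simp [Pi.single_apply, eq_comm]
  have : a ∈ W := hW ▸ Submodule.mem_top
  obtain ⟨r, hr⟩ := show a ∈ A from this
  exact ⟨r, congrFun hr⟩

end Separation

/-! ### Normal generation and invariant homomorphisms -/

section NormalGeneration

variable {p : ℕ} [hp : Fact p.Prime] {G : Type*} [Group G] [TopologicalSpace G]
  [IsTopologicalGroup G]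

theorem closedNormalClosure_eq (hG : IsProP p G) {R : Subgroup G} [R.Normal]
    (hR : IsClosed (R : Set G)) {S : Set G} (hS : S ⊆ R)
    (h : ∀ χ ∈ invHom p R, (∀ r : R, (r : G) ∈ S → χ r = 0) → χ = 0) :
    (Subgroup.normalClosure S).topologicalClosure = R := by
  have hn : ((Subgroup.normalClosure S).topologicalClosure).Normal :=
    Subgroup.is_normal_topologicalClosure _
  by_contra hne
  obtain ⟨χ, hχ, h0, hv⟩ := hG.exists_invHom (R := R)
    (Subgroup.isClosed_topologicalClosure (Subgroup.normalClosure S))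
    (Subgroup.topologicalClosure_minimal _ (Subgroup.normalClosure_le_normal hS) hR) hne
  exact h0 (h χ hχ fun r hr => hv r (Subgroup.le_topologicalClosure _
    (Subgroup.subset_normalClosure hr)))

/-- By invariance the kernel of `χ` is normal in the whole group; it is also closed. -/
theorem invHom_eq_zero_of_mem_closedNormalClosure {R : Subgroup G} [R.Normal]
    (hR : IsClosed (R : Set G)) {S : Set G} (hS : S ⊆ R) {χ : R → ZMod p} (hχ : χ ∈ invHom p R)
    (h : ∀ r : R, (r : G) ∈ S → χ r = 0) {r : R}
    (hr : (r : G) ∈ (Subgroup.normalClosure S).topologicalClosure) : χ r = 0 := by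
  let K : Subgroup G := (additiveKer χ hχ.2.1).map R.subtype
  have hmem : ∀ r : R, (r : G) ∈ K ↔ χ r = 0 := fun r => by
    simp only [K, Subgroup.mem_map, Subgroup.subtype_apply, Subtype.exists]
    exact ⟨fun ⟨a, ha, h, e⟩ => by
      have : r = ⟨a, ha⟩ := Subtype.ext e.symm
      rw [this]
      exact h, fun h => ⟨r, r.2, h, rfl⟩⟩
  have hKn : K.Normal := ⟨by
    rintro _ ⟨a, ha, rfl⟩ x
    have hx : x * a * x⁻¹ ∈ R := Subgroup.Normal.conj_mem inferInstance _ a.2 x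
    exact (hmem ⟨_, hx⟩).mpr ((hχ.2.2 x a ⟨_, hx⟩ rfl).trans ha)⟩
  have hKc : IsClosed (K : Set G) := by
    have := (isClosed_additiveKer hχ.2.1 hχ.1)
    exact hR.isClosedEmbedding_subtypeVal.isClosedMap _ this
  refine (hmem r).mp (Subgroup.topologicalClosure_minimal _
    (Subgroup.normalClosure_le_normal fun s hs => ?_) hKc hr)
  exact (hmem ⟨s, hS hs⟩).mpr (h _ hs)

/-- The Burnside basis theorem for relations: `v` normally generates `R` when no non-zero invariant
homomorphism vanishes on it. For as many relators as dimensions, this turns the generation problem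
into the invertibility of a matrix. -/
theorem closedNormalClosure_eq_iff (hG : IsProP p G) {R : Subgroup G} [R.Normal]
    (hR : IsClosed (R : Set G)) {n : ℕ} (b : Module.Basis (Fin n) (ZMod p) (invHom p R))
    (v : Fin n → R) :
    (Subgroup.normalClosure (Set.range fun i => (v i : G))).topologicalClosure = R ↔
      (Matrix.of fun i j => (b j).1 (v i)).det ≠ 0 := by
  have hS : Set.range (fun i => (v i : G)) ⊆ R := by
    rintro _ ⟨i, rfl⟩
    exact (v i).2
  rw [← separating_iff_det_ne_zero]
  constructor
  · intro h χ hχ h0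
    funext r
    refine invHom_eq_zero_of_mem_closedNormalClosure hR hS hχ ?_ (h.ge r.2)
    rintro r ⟨i, hi⟩
    rw [← h0 i]
    exact congrArg χ (Subtype.ext hi.symm)
  · exact fun h => closedNormalClosure_eq hG hR hS fun χ hχ h0 =>
      h χ hχ fun i => h0 _ ⟨i, rfl⟩

theorem dense_closure_iff_separating (hG : IsProP p G) {n : ℕ}
    (b : Module.Basis (Fin n) (ZMod p) (contH1 p G)) (y : Fin n → G) :
    Dense (Subgroup.closure (Set.range y) : Set G) ↔
      (Matrix.of fun i j => (b j).1 (y i)).det ≠ 0 := by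
  rw [← separating_iff_det_ne_zero]
  constructor
  · intro h χ hχ h0
    have : contHomOfAdditive χ hχ.2 = 1 := by
      refine eq_of_eqOn_topGenerators h (H := Multiplicative (ZMod p))
        (continuous_ofAdd.comp hχ.1) continuous_const ?_
      rintro _ ⟨i, rfl⟩
      exact congrArg Multiplicative.ofAdd (h0 i)
    funext x
    exact Multiplicative.ofAdd.injective (DFunLike.congr_fun this x)
  · intro h
    by_contra hd
    have hne : (Subgroup.closure (Set.range y)).topologicalClosure ≠ ⊤ := fun h => by
      refine hd fun x => ?_
      have : x ∈ (Subgroup.closure (Set.range y)).topologicalClosure := h ▸ trivial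
      exact this
    obtain ⟨χ, hχ, h0, hv⟩ := hG.exists_contH1 (Subgroup.isClosed_topologicalClosure _) hne
    exact h0 (h χ hχ fun i => hv _ (Subgroup.le_topologicalClosure _
      (Subgroup.subset_closure ⟨i, rfl⟩)))

end NormalGeneration

/-! ### Quotients of the free pro-`p` group with finite abelianization -/

namespace FreeProP

variable {p g : ℕ} [hp : Fact p.Prime] {G : Type*} [Group G] [TopologicalSpace G]
  [IsTopologicalGroup G] [T2Space G] {π : FreeProP p g →* G}

theorem isClosed_ker (hc : Continuous π) : IsClosed (π.ker : Set (FreeProP p g)) :=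
  isClosed_singleton.preimage hc

theorem card_nsmul_eq_zero_of_lin (hc : Continuous π) (hs : Function.Surjective π)
    {m : ℕ} (hm : ∃ n, m = p ^ n) {u : Fin g → ZMod m} (h : ∀ x ∈ π.ker, lin hm u x = 0)
    (i : Fin g) : (Nat.card (TopologicalAbelianization G)) • u i = 0 := by
  obtain ⟨ψ, hψ, hψπ⟩ := exists_continuous_descent hc hs (continuous_lin hm u)
    (fun x r hr => by rw [lin_mul, h r hr, add_zero])
  have hadd : ∀ a b, ψ (a * b) = ψ a + ψ b := by
    intro a b
    obtain ⟨x, rfl⟩ := hs a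
    obtain ⟨y, rfl⟩ := hs b
    rw [← map_mul, hψπ, hψπ, hψπ, lin_mul]
  have hmem : π (gen p g i) ^ Nat.card (TopologicalAbelianization G) ∈
      (commutator G).topologicalClosure :=
    (QuotientGroup.eq_one_iff _).mp (pow_card_eq_one'
      (x := (QuotientGroup.mk (π (gen p g i)) : TopologicalAbelianization G)))
  have := additive_commutatorClosure hadd hψ hmem
  rw [additive_pow hadd, hψπ, lin_gen] at this
  rw [nsmul_eq_mul, this]

/-- A quotient of the free pro-`p` group on `g` generators with finite abelianization has at least
`g` relations. -/
theorem exists_lin_ne_zero [Finite (TopologicalAbelianization G)] (hc : Continuous π)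
    (hs : Function.Surjective π) {k : ℕ} (hk : k < g) (r : Fin k → FreeProP p g) :
    ∃ n, ∃ u : Fin g → ZMod (p ^ n), (∀ i, lin ⟨n, rfl⟩ u (r i) = 0) ∧
      ∃ x ∈ π.ker, lin ⟨n, rfl⟩ u x ≠ 0 := by
  classical
  by_contra! hcon
  set M := Nat.card (TopologicalAbelianization G) with hM
  have hMpos : 0 < M := Nat.card_pos
  -- With `q = p ^ n > M ^ g`, some fibre of the `k < g` linear equations `T` on `(ℤ/q)^g` has more
  -- than `M ^ g` points. Differences of its points vanish on all `r i`, hence by `hcon` on the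
  -- kernel, so they come from `Gᵃᵇ` and have coordinates killed by `M`. There are at most `M ^ g`
  -- such vectors.
  obtain ⟨n, hn⟩ : ∃ n, M ^ g < p ^ n := ⟨_, Nat.lt_pow_self hp.out.one_lt⟩
  set q := p ^ n with hq
  have hqpos : 0 < q := pow_pos hp.out.pos n
  have : NeZero q := ⟨hqpos.ne'⟩
  let hm : ∃ n, q = p ^ n := ⟨n, rfl⟩
  let T : (Fin g → ZMod q) → (Fin k → ZMod q) := fun u i => lin hm u (r i)
  have hlt : Fintype.card (Fin k → ZMod q) * M ^ g < Fintype.card (Fin g → ZMod q) := by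
    simp only [Fintype.card_fun, ZMod.card, Fintype.card_fin]
    calc q ^ k * M ^ g < q ^ k * q := by gcongr
      _ = q ^ (k + 1) := (pow_succ _ _).symm
      _ ≤ q ^ g := Nat.pow_le_pow_right hqpos hk
  obtain ⟨a, ha⟩ := Fintype.exists_lt_card_fiber_of_mul_lt_card T hlt
  obtain ⟨u₀, hu₀⟩ := Finset.card_pos.mp (lt_of_le_of_lt (Nat.zero_le _) ha)
  let A : Finset (ZMod q) := Finset.univ.filter fun a => M • a = 0
  have hA : A.card ≤ M := IsAddCyclic.card_nsmul_eq_zero_le hMpos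
  have hsub : ((Finset.univ.filter fun u => T u = a).image fun u => u - u₀) ⊆
      Fintype.piFinset fun _ : Fin g => A := by
    intro w hw
    obtain ⟨u, hu, rfl⟩ := Finset.mem_image.mp hw
    rw [Fintype.mem_piFinset]
    intro i
    refine Finset.mem_filter.mpr ⟨Finset.mem_univ _, ?_⟩
    refine card_nsmul_eq_zero_of_lin hc hs hm (u := u - u₀) (hcon n (u - u₀) fun j => ?_) i
    have h1 : T u = T u₀ := by
      rw [(Finset.mem_filter.mp hu).2, (Finset.mem_filter.mp hu₀).2]
    have h2 : lin hm u (r j) = lin hm u₀ (r j) := congrFun h1 j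
    rw [lin_sum] at h2 ⊢
    rw [lin_sum hm u₀] at h2
    simp only [Pi.sub_apply, sub_mul, Finset.sum_sub_distrib]
    rw [h2, sub_self]
  have hle := Finset.card_le_card hsub
  rw [Finset.card_image_of_injective _ (sub_left_injective), Fintype.card_piFinset] at hle
  simp only [Finset.prod_const, Finset.card_univ, Fintype.card_fin] at hle
  exact absurd (hle.trans (Nat.pow_le_pow_left hA g)) (not_le.mpr ha)

/-- Elements of the kernel which are killed by all homomorphisms to cyclic groups cannot detect
all but fewer than `g` dimensions of the invariant homomorphisms on the kernel. -/
theorem le_finrank_of_detecting [Finite (TopologicalAbelianization G)] (hc : Continuous π)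
    (hs : Function.Surjective π) {W : Submodule (ZMod p) (π.ker → ZMod p)}
    [Module.Finite (ZMod p) W] {S : Set (FreeProP p g)} (hS : S ⊆ π.ker)
    (hlin : ∀ s ∈ S, ∀ (n : ℕ) (u : Fin g → ZMod (p ^ n)), lin ⟨n, rfl⟩ u s = 0)
    (hdet : ∀ χ ∈ invHom p π.ker, (∀ r : π.ker, (r : FreeProP p g) ∈ S → χ r = 0) → χ ∈ W) :
    g ≤ Module.finrank (ZMod p) W := by
  by_contra! hlt
  -- If `W` has dimension less than `g`, fewer than `g` elements of the kernel separate it. Together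
  -- with `S` they normally generate the kernel, and since no linear functional sees `S`, these few
  -- elements contradict `exists_lin_ne_zero`.
  obtain ⟨r, hr⟩ := exists_separating_points _ W le_rfl
  obtain ⟨n, u, hu, x, hx, hne⟩ := exists_lin_ne_zero hc hs hlt fun i => (r i : FreeProP p g)
  have hS' : S ∪ Set.range (fun i => (r i : FreeProP p g)) ⊆ π.ker := by
    refine Set.union_subset hS ?_
    rintro _ ⟨i, rfl⟩
    exact (r i).2
  have hcl := closedNormalClosure_eq isProP (isClosed_ker hc) hS' fun χ hχ h0 =>
    hr χ (hdet χ hχ fun r hr => h0 r (Or.inl hr)) fun i => h0 _ (Or.inr ⟨i, rfl⟩)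
  have hle : (Subgroup.normalClosure
      (S ∪ Set.range (fun i => (r i : FreeProP p g)))).topologicalClosure ≤
      additiveKer (lin ⟨n, rfl⟩ u) (lin_mul ⟨n, rfl⟩ u) := by
    refine Subgroup.topologicalClosure_minimal _ (Subgroup.normalClosure_le_normal ?_)
      (isClosed_additiveKer _ (continuous_lin _ u))
    rintro s (hs | ⟨i, rfl⟩)
    · exact mem_additiveKer.mpr (hlin s hs n u)
    · exact mem_additiveKer.mpr (hu i)
  exact hne (hle (hcl.ge hx))

/-- The involution acts as inversion on the relations of a quotient of the free pro-`p` group with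
finite abelianization and as many relations as generators. -/
theorem invHom_sig [Finite (TopologicalAbelianization G)] (hc : Continuous π)
    (hs : Function.Surjective π) (hσ : ∀ x ∈ π.ker, sig p g x ∈ π.ker)
    [Module.Finite (ZMod p) (invHom p π.ker)]
    (hdim : Module.finrank (ZMod p) (invHom p π.ker) = g) {χ : π.ker → ZMod p}
    (hχ : χ ∈ invHom p π.ker) (r : π.ker) : χ ⟨sig p g r, hσ r r.2⟩ = -χ r := by
  let W : Submodule (ZMod p) (π.ker → ZMod p) :=
    { carrier := {χ | χ ∈ invHom p π.ker ∧ ∀ r : π.ker, χ ⟨sig p g r, hσ r r.2⟩ = -χ r}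
      zero_mem' := ⟨zero_mem _, by simp⟩
      add_mem' := fun ha hb => ⟨add_mem ha.1 hb.1, fun r => by
        simp only [Pi.add_apply, ha.2, hb.2]
        ring⟩
      smul_mem' := fun c a ha => ⟨Submodule.smul_mem _ c ha.1, fun r => by
        simp only [Pi.smul_apply, ha.2, smul_neg]⟩ }
  have hle : W ≤ invHom p π.ker := fun χ hχ => hχ.1
  have : Module.Finite (ZMod p) W := Submodule.finiteDimensional_of_le hle
  -- `W` is the `-1`-eigenspace, equivalently the invariant homomorphisms that vanish on all `r
  -- σ(r)`. Functionals on `F` kill `r σ(r)`, because `σ` negates them, so `W` has full dimension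
  -- `g`.
  have hg := le_finrank_of_detecting hc hs (W := W)
    (S := {x | ∃ r ∈ π.ker, x = r * sig p g r})
    (by rintro _ ⟨r, hr, rfl⟩; exact mul_mem hr (hσ r hr))
    (by
      rintro _ ⟨r, -, rfl⟩ n u
      rw [lin_mul, additive_sig (lin_mul _ u) (continuous_lin _ u), add_neg_cancel])
    (fun χ hχ h0 => ⟨hχ, fun r => by
      have := h0 (r * ⟨sig p g r, hσ r r.2⟩) ⟨r, r.2, rfl⟩
      rw [hχ.2.1] at this
      exact eq_neg_of_add_eq_zero_right this⟩)
  have : W = invHom p π.ker := Submodule.eq_of_le_of_finrank_le hle (by rw [hdim]; exact hg)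
  exact (this ▸ hχ : χ ∈ W).2 r

end FreeProP

/-! ### The groups presented by relators -/

section Presented

variable {p g : ℕ} [hp : Fact p.Prime]

theorem relator_mem_relationSubgroup (v : Fin g → schurRelators p g) (i : Fin g) :
    (v i : FreeProP p g) ∈ relationSubgroup v :=
  Subgroup.le_topologicalClosure _ (Subgroup.subset_normalClosure ⟨i, rfl⟩)

theorem isClosed_relationSubgroup (v : Fin g → schurRelators p g) :
    IsClosed (relationSubgroup v : Set (FreeProP p g)) :=
  Subgroup.isClosed_topologicalClosure _

theorem relationSubgroup_le {v : Fin g → schurRelators p g} {N : Subgroup (FreeProP p g)}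
    [N.Normal] (hN : IsClosed (N : Set (FreeProP p g))) (h : ∀ i, (v i : FreeProP p g) ∈ N) :
    relationSubgroup v ≤ N :=
  Subgroup.topologicalClosure_minimal _ (Subgroup.normalClosure_le_normal (by
    rintro _ ⟨i, rfl⟩; exact h i)) hN

theorem relationSubgroup_le_frattini (v : Fin g → schurRelators p g) :
    relationSubgroup v ≤ frattiniProP p (FreeProP p g) :=
  relationSubgroup_le isClosed_frattiniProP fun i => FreeProP.relator_mem_frattini (v i).2

theorem sig_mem_relationSubgroup (v : Fin g → schurRelators p g) {x : FreeProP p g}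
    (hx : x ∈ relationSubgroup v) : FreeProP.sig p g x ∈ relationSubgroup v := by
  refine relationSubgroup_le (v := v) (N := (relationSubgroup v).comap (FreeProP.sig p g))
    ((isClosed_relationSubgroup v).preimage FreeProP.continuous_sig) (fun i => ?_) hx
  rw [Subgroup.mem_comap, FreeProP.sig_relator (v i).2]
  exact inv_mem (relator_mem_relationSubgroup v i)

theorem isProP_presented (v : Fin g → schurRelators p g) : IsProP p (PresentedGroupProP v) :=
  FreeProP.isProP.quotient _ (isClosed_relationSubgroup v)

instance (v : Fin g → schurRelators p g) : T2Space (PresentedGroupProP v) :=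
  (isProP_presented v).t2Space

/-- The projection to the presented group. -/
abbrev presentedMk (v : Fin g → schurRelators p g) : FreeProP p g →* PresentedGroupProP v :=
  QuotientGroup.mk' (relationSubgroup v)

theorem ker_presentedMk (v : Fin g → schurRelators p g) :
    (presentedMk v).ker = relationSubgroup v := QuotientGroup.ker_mk' _

theorem continuous_presentedMk (v : Fin g → schurRelators p g) : Continuous (presentedMk v) :=
  QuotientGroup.continuous_mk

theorem presentedMk_surjective (v : Fin g → schurRelators p g) :
    Function.Surjective (presentedMk v) := QuotientGroup.mk'_surjective _

/-- Evaluation at the `g` relators is injective on invariant homomorphisms. -/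
theorem finite_invHom_presented (v : Fin g → schurRelators p g) :
    Module.Finite (ZMod p) (invHom p (presentedMk v).ker) ∧
      Module.finrank (ZMod p) (invHom p (presentedMk v).ker) ≤ g := by
  have hmem : ∀ i, (v i : FreeProP p g) ∈ (presentedMk v).ker := fun i => by
    rw [ker_presentedMk]
    exact relator_mem_relationSubgroup v i
  let ev : invHom p (presentedMk v).ker →ₗ[ZMod p] (Fin g → ZMod p) :=
    { toFun := fun χ i => χ.1 ⟨v i, hmem i⟩
      map_add' := fun _ _ => rfl
      map_smul' := fun _ _ => rfl }
  have hinj : Function.Injective ev := by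
    rw [← LinearMap.ker_eq_bot, LinearMap.ker_eq_bot']
    rintro ⟨χ, hχ⟩ h
    refine Subtype.ext (funext fun r => ?_)
    refine invHom_eq_zero_of_mem_closedNormalClosure
      (FreeProP.isClosed_ker (continuous_presentedMk v))
      (S := Set.range fun i => (v i : FreeProP p g)) ?_ hχ ?_ ?_
    · rintro _ ⟨i, rfl⟩
      exact hmem i
    · rintro r ⟨i, hi⟩
      rw [show r = ⟨v i, hmem i⟩ from Subtype.ext hi.symm]
      exact congrFun h i
    · exact (ker_presentedMk v).le r.2
  refine ⟨Module.Finite.of_injective ev hinj, ?_⟩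
  simpa using LinearMap.finrank_le_finrank_of_injective hinj

theorem exists_contAut_descent {F G : Type*} [Group F] [TopologicalSpace F] [CompactSpace F]
    [Group G] [TopologicalSpace G] [T2Space G] {π : F →* G} (hc : Continuous π)
    (hs : Function.Surjective π) {σ : F →* F} (hσ : Continuous σ) (h2 : ∀ x, σ (σ x) = x)
    (hker : ∀ x ∈ π.ker, σ x ∈ π.ker) : ∃ τ : contAut G, ∀ x, τ.1 (π x) = π (σ x) := by
  obtain ⟨τ, hτ, hτπ⟩ := exists_continuous_descent hc hs (hc.comp hσ) fun x r hr => by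
    simp only [Function.comp_apply, map_mul, MonoidHom.mem_ker.mp (hker r hr), mul_one]
  have hττ : ∀ y, τ (τ y) = y := by
    intro y
    obtain ⟨x, rfl⟩ := hs y
    rw [hτπ, Function.comp_apply, hτπ, Function.comp_apply, h2]
  let e : MulAut G :=
    { toFun := τ
      invFun := τ
      left_inv := hττ
      right_inv := hττ
      map_mul' := by
        intro a b
        obtain ⟨x, rfl⟩ := hs a
        obtain ⟨y, rfl⟩ := hs b
        rw [← map_mul, hτπ, hτπ, hτπ]
        simp }
  exact ⟨⟨e, hτ, hτ⟩, hτπ⟩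

/-- An automorphism which is covered by the involution of the free pro-`p` group is a Schur
involution. -/
theorem isSchurInvolution_of_covered (h2 : p ≠ 2) (hg : 1 ≤ g) {G : Type*} [Group G]
    [TopologicalSpace G] [IsTopologicalGroup G] [T2Space G] {π : FreeProP p g →* G}
    (hc : Continuous π) (hs : Function.Surjective π)
    (hker : π.ker ≤ frattiniProP p (FreeProP p g)) {τ : contAut G}
    (hτ : ∀ x, τ.1 (π x) = π (FreeProP.sig p g x)) : IsSchurInvolution τ := by
  refine ⟨orderOf_eq_prime ?_ ?_, fun y => ?_⟩
  · refine Subtype.ext (MulEquiv.ext fun y => ?_)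
    obtain ⟨x, rfl⟩ := hs y
    change (τ ^ 2).1 (π x) = π x
    rw [pow_two, Subgroup.coe_mul, MulAut.mul_apply, hτ, hτ, FreeProP.sig_sig]
  · intro h1
    -- If the involution were trivial, the square of a generator would lie in the kernel, hence in
    -- the Frattini subgroup; but a coordinate functional takes the value `2 ≠ 0` on it.
    let i : Fin g := ⟨0, hg⟩
    have hm : FreeProP.gen p g i * FreeProP.gen p g i ∈ π.ker := by
      have := hτ (FreeProP.gen p g i)
      rw [h1, FreeProP.sig_gen, map_inv] at this
      have h' : π (FreeProP.gen p g i) = (π (FreeProP.gen p g i))⁻¹ := this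
      rw [MonoidHom.mem_ker, map_mul]
      nth_rewrite 1 [h']
      exact inv_mul_cancel _
    have := eq_zero_of_mem_frattiniProP (hker hm)
      (FreeProP.lin_mem_contH1 (p := p) (Pi.single i 1 : Fin g → ZMod p))
    rw [FreeProP.lin_mul, FreeProP.lin_gen, Pi.single_eq_same] at this
    have h3 : ((2 : ℕ) : ZMod p) = 0 := by
      rw [← this]
      norm_num
    rw [ZMod.natCast_eq_zero_iff] at h3
    exact h2 ((Nat.prime_dvd_prime_iff_eq hp.out Nat.prime_two).mp h3)
  · obtain ⟨x, rfl⟩ := hs y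
    rw [hτ]
    have : T2Space (TopologicalAbelianization G) := by
      have : IsClosed ((commutator G).topologicalClosure : Set G) :=
        Subgroup.isClosed_topologicalClosure _
      exact inferInstanceAs (T2Space (G ⧸ (commutator G).topologicalClosure))
    let φ : FreeProP p g →* TopologicalAbelianization G :=
      (QuotientGroup.mk' (commutator G).topologicalClosure).comp π
    have hφ : Continuous φ := QuotientGroup.continuous_mk.comp hc
    have := FreeProP.map_sig hφ (σ := invMonoidHom) continuous_inv (fun i => rfl) x
    exact this

/-- A tuple of relators presents a Schur `σ`-group as soon as the abelianization is finite. -/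
theorem isSchurSigma_presented (h2 : p ≠ 2) (hg : 1 ≤ g) (v : Fin g → schurRelators p g)
    [hfin : Finite (TopologicalAbelianization (PresentedGroupProP v))] :
    IsSchurSigma p g (PresentedGroupProP v) := by
  have hc := continuous_presentedMk v
  have hs := presentedMk_surjective v
  have hker : (presentedMk v).ker ≤ frattiniProP p (FreeProP p g) := by
    rw [ker_presentedMk]
    exact relationSubgroup_le_frattini v
  refine ⟨isProP_presented v, ?_, FreeProP.genRank_of_ker_le hc hs hker, ?_, hfin, ?_⟩
  · classical
    refine ⟨Finset.univ.image fun i => presentedMk v (FreeProP.gen p g i), ?_⟩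
    have := hs.denseRange.dense_image hc FreeProP.dense_closure_gen
    rw [← Subgroup.coe_map, MonoidHom.map_closure, ← Set.range_comp] at this
    simpa [Function.comp_def] using this
  · obtain ⟨hfi, hle⟩ := finite_invHom_presented v
    rw [FreeProP.relRank_eq_finrank_invHom (isProP_presented v) hc hs hker]
    -- The lower bound: all invariant homomorphisms form a detecting space for the empty set.
    refine le_antisymm hle (FreeProP.le_finrank_of_detecting hc hs (S := ∅) (by simp) (by simp)
      fun χ hχ _ => hχ)
  · obtain ⟨τ, hτ⟩ := exists_contAut_descent hc hs FreeProP.continuous_sig FreeProP.sig_sig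
      (by
        rw [ker_presentedMk]
        exact fun x hx => sig_mem_relationSubgroup v hx)
    exact ⟨τ, isSchurInvolution_of_covered h2 hg hc hs hker hτ⟩

end Presented

/-! ### Cyclic quotients of pro-`p` groups with infinite abelianization -/

section CyclicQuotients

theorem finite_of_dense_closure_of_torsion {A : Type*} [CommGroup A] [TopologicalSpace A] [T2Space A]
    {S : Set A} (hS : S.Finite) (hd : Dense (Subgroup.closure S : Set A)) {m : ℕ} (hm : 0 < m)
    (h : ∀ a : A, a ^ m = 1) : Finite A := by
  have hfg : Group.FG (Subgroup.closure S) :=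
    (Group.fg_iff_subgroup_fg _).mpr ((Subgroup.fg_iff _).mpr ⟨S, rfl, hS⟩)
  have hfin : Finite (Subgroup.closure S) :=
    CommGroup.finite_of_fg_isMulTorsion (Subgroup.closure S) fun a =>
      isOfFinOrder_iff_pow_eq_one.mpr ⟨m, hm, Subtype.ext (h a)⟩
  have hcl : IsClosed (Subgroup.closure S : Set A) := (Set.toFinite _).isClosed
  have huniv : (Subgroup.closure S : Set A) = Set.univ := by
    rw [← hcl.closure_eq]
    exact hd.closure_eq
  exact Set.finite_univ_iff.mp (huniv ▸ Set.toFinite _)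

/-- In a decomposition into cyclic groups, some factor is not killed by `p ^ n`; its order is then
divisible by `p ^ (n + 1)`. -/
theorem IsPGroup.exists_surjective_zmod {p : ℕ} [hp : Fact p.Prime] {P : Type*} [CommGroup P] [Finite P]
    (hP : IsPGroup p P) {n : ℕ} {x : P} (hx : x ^ p ^ n ≠ 1) :
    ∃ ψ : P →* Multiplicative (ZMod (p ^ (n + 1))), Function.Surjective ψ := by
  obtain ⟨ι, _, m, -, ⟨e⟩⟩ := CommGroup.equiv_prod_multiplicative_zmod_of_finite P
  obtain ⟨i, hi⟩ : ∃ i, (e x i) ^ p ^ n ≠ 1 := by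
    by_contra! h
    refine hx (e.injective ?_)
    rw [map_pow, map_one]
    exact funext h
  let pr : P →* Multiplicative (ZMod (m i)) := (Pi.evalMonoidHom _ i).comp e.toMonoidHom
  have hpr : Function.Surjective pr := (Function.surjective_eval i).comp e.surjective
  have hfin : Finite (Multiplicative (ZMod (m i))) := Finite.of_surjective _ hpr
  obtain ⟨k, hk⟩ := IsPGroup.iff_card.mp (hP.of_surjective pr hpr)
  have hk' : m i = p ^ k := by
    rw [← hk, Nat.card_congr Multiplicative.toAdd, Nat.card_zmod]
  have hlt : n + 1 ≤ k := by
    by_contra! hkn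
    refine hi (pow_eq_one_iff_modEq.mpr ?_ : (e x i) ^ p ^ n = 1)
    refine (Nat.modEq_zero_iff_dvd).mpr ((orderOf_dvd_natCard _).trans ?_)
    rw [hk]
    exact pow_dvd_pow p (by omega)
  have hdvd : p ^ (n + 1) ∣ m i := hk' ▸ pow_dvd_pow p hlt
  refine ⟨(AddMonoidHom.toMultiplicative
    (ZMod.castHom hdvd (ZMod (p ^ (n + 1)))).toAddMonoidHom).comp pr, ?_⟩
  rw [MonoidHom.coe_comp]
  exact Function.Surjective.comp (ZMod.castHom_surjective hdvd) hpr

/-- A topologically finitely generated pro-`p` group with infinite abelianization has all finite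
cyclic `p`-groups as quotients. -/
theorem IsProP.exists_additive_eq_one {p : ℕ} [hp : Fact p.Prime] {G : Type*} [Group G]
    [TopologicalSpace G] [IsTopologicalGroup G] (hG : IsProP p G) (hfg : IsTopFG G)
    (hinf : ¬ Finite (TopologicalAbelianization G)) (n : ℕ) :
    ∃ ψ : G → ZMod (p ^ (n + 1)), Continuous ψ ∧ (∀ x y, ψ (x * y) = ψ x + ψ y) ∧
      ∃ x, ψ x = 1 := by
  set C := (commutator G).topologicalClosure with hC
  have hCc : IsClosed (C : Set G) := Subgroup.isClosed_topologicalClosure _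
  -- Otherwise the abelianization would be topologically finitely generated of finite exponent,
  -- hence finite.
  obtain ⟨x, hx⟩ : ∃ x : G, x ^ p ^ n ∉ C := by
    by_contra! h
    refine hinf ?_
    have : T2Space (TopologicalAbelianization G) := by
      have : IsClosed ((commutator G).topologicalClosure : Set G) := hCc
      exact inferInstanceAs (T2Space (G ⧸ (commutator G).topologicalClosure))
    obtain ⟨S, hS⟩ := hfg
    let q : G →* TopologicalAbelianization G := QuotientGroup.mk' C
    have hd := (QuotientGroup.mk'_surjective C).denseRange.dense_image
      QuotientGroup.continuous_mk hS
    refine finite_of_dense_closure_of_torsion (A := TopologicalAbelianization G)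
      (S := q '' (S : Set G)) (S.finite_toSet.image _) ?_ (pow_pos hp.out.pos n) ?_
    · rw [← MonoidHom.map_closure]
      exact hd
    · intro a
      obtain ⟨y, rfl⟩ := QuotientGroup.mk'_surjective C a
      exact (QuotientGroup.eq_one_iff (y ^ p ^ n)).mpr (h y)
  obtain ⟨U, hn, ho, hU⟩ := hG.exists_openNormal_separating hCc hx
  have hxV : x ^ p ^ n ∉ C ⊔ U := by
    intro h
    obtain ⟨c, hc, u, hu, h⟩ := Subgroup.mem_sup_of_normal_right.mp h
    exact hU c hc (by rw [← h]; simpa using hu)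
  set V := C ⊔ U
  have hVo : IsOpen (V : Set G) := Subgroup.isOpen_mono le_sup_right ho
  have hVn : V.Normal := Subgroup.sup_normal C U
  have := hG.finite_quotient hVo
  have hd : DiscreteTopology (G ⧸ V) := QuotientGroup.discreteTopology hVo
  let _ : CommGroup (G ⧸ V) := { (inferInstance : Group (G ⧸ V)) with
    mul_comm := by
      rintro ⟨a⟩ ⟨b⟩
      refine QuotientGroup.eq.mpr ((le_sup_left : C ≤ V) (Subgroup.le_topologicalClosure _ ?_))
      have : (a * b)⁻¹ * (b * a) = b⁻¹ * a⁻¹ * b⁻¹⁻¹ * a⁻¹⁻¹ := by group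
      rw [this]
      exact Subgroup.commutator_mem_commutator trivial trivial }
  obtain ⟨ψ, hψ⟩ := (hG.isPGroup_quotient hVo).exists_surjective_zmod
    (x := QuotientGroup.mk x) (n := n) fun h => hxV ((QuotientGroup.eq_one_iff (x ^ p ^ n)).mp h)
  refine ⟨fun y => (ψ (QuotientGroup.mk y)).toAdd,
    (continuous_of_discreteTopology (f := fun q : G ⧸ V => (ψ q).toAdd)).comp
      QuotientGroup.continuous_mk, fun a b => ?_, ?_⟩
  · exact congrArg Multiplicative.toAdd (map_mul ψ (QuotientGroup.mk a) (QuotientGroup.mk b))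
  · obtain ⟨y, hy⟩ := hψ (Multiplicative.ofAdd 1)
    obtain ⟨x, rfl⟩ := QuotientGroup.mk_surjective y
    exact ⟨x, congrArg Multiplicative.toAdd hy⟩

end CyclicQuotients

/-! ### Counting with measures -/

section Counting

theorem sum_indicator_one_eq_card {α ι : Type*} (s : Finset ι) (E : ι → Set α) (v : α)
    [DecidablePred fun i => v ∈ E i] :
    ∑ i ∈ s, (E i).indicator (1 : α → ℝ≥0∞) v = (s.filter fun i => v ∈ E i).card := by
  classical
  rw [Finset.card_filter, Nat.cast_sum]
  refine Finset.sum_congr rfl fun i _ => ?_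
  by_cases h : v ∈ E i <;> simp [h]

theorem lintegral_sum_indicator {α ι : Type*} [MeasurableSpace α] (μ : Measure α) (s : Finset ι)
    {E : ι → Set α} (hE : ∀ i ∈ s, MeasurableSet (E i)) :
    ∫⁻ v, ∑ i ∈ s, (E i).indicator (1 : α → ℝ≥0∞) v ∂μ = ∑ i ∈ s, μ (E i) := by
  rw [lintegral_finsetSum' _ fun i hi => (measurable_one.indicator (hE i hi)).aemeasurable]
  exact Finset.sum_congr rfl fun i hi => lintegral_indicator_one (hE i hi)

open Classical in
-- Markov's inequality for the number of `E i` containing a point. `B` need not be measurable, since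
-- it is enlarged to a superlevel set of this number.
theorem mul_measure_le_sum {α ι : Type*} [MeasurableSpace α] (μ : Measure α) (s : Finset ι)
    {E : ι → Set α} (hE : ∀ i ∈ s, MeasurableSet (E i)) {B : Set α} {c : ℕ}
    (h : ∀ v ∈ B, c ≤ (s.filter fun i => v ∈ E i).card) : c * μ B ≤ ∑ i ∈ s, μ (E i) := by
  rw [← lintegral_sum_indicator μ s hE]
  refine le_trans (mul_le_mul_right (measure_mono (t := {v | (c : ℝ≥0∞) ≤
    ∑ i ∈ s, (E i).indicator (1 : α → ℝ≥0∞) v}) fun v hv => ?_) _)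
    (mul_meas_ge_le_lintegral (Finset.measurable_fun_sum s fun i hi =>
      measurable_one.indicator (hE i hi)) _)
  rw [Set.mem_ofPred_eq, sum_indicator_one_eq_card]
  exact_mod_cast h v hv

open Classical in
theorem mul_measure_eq_sum {α ι : Type*} [MeasurableSpace α] (μ : Measure α) (s : Finset ι)
    {E : ι → Set α} (hE : ∀ i ∈ s, MeasurableSet (E i)) {B : Set α} (hB : MeasurableSet B) {c : ℕ}
    (h : ∀ v ∈ B, (s.filter fun i => v ∈ E i).card = c) (h' : ∀ i ∈ s, E i ⊆ B) :
    c * μ B = ∑ i ∈ s, μ (E i) := by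
  rw [← lintegral_sum_indicator μ s hE, ← lintegral_indicator_const hB]
  refine lintegral_congr fun v => ?_
  rw [sum_indicator_one_eq_card]
  by_cases hv : v ∈ B
  · rw [Set.indicator_of_mem hv, h v hv]
  · rw [Set.indicator_of_notMem hv, Finset.filter_false_of_mem fun i hi hvi => hv (h' i hi hvi)]
    simp

end Counting

/-! ### The measure on relators -/

section RelatorMeasure

variable {p g : ℕ} [hp : Fact p.Prime]

theorem continuous_toRelator : Continuous (toRelator p g) :=
  (continuous_subtype_val.inv.mul
    (FreeProP.continuous_sig.comp continuous_subtype_val)).subtype_mk _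

theorem measurable_toRelator : Measurable (toRelator p g) := continuous_toRelator.measurable

instance : IsProbabilityMeasure (relatorMeasure p g) := by
  refine ⟨?_⟩
  rw [relatorMeasure, Measure.map_apply measurable_toRelator MeasurableSet.univ,
    Set.preimage_univ]
  exact Measure.haarMeasure_self (K₀ := ⊤)

instance : IsProbabilityMeasure (relatorTupleMeasure p g) := by
  rw [relatorTupleMeasure]
  infer_instance

theorem relatorTupleMeasure_forall (A : Fin g → Set (schurRelators p g)) :
    relatorTupleMeasure p g {v | ∀ i, v i ∈ A i} = ∏ i, relatorMeasure p g (A i) := by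
  rw [relatorTupleMeasure, ← Measure.pi_pi]
  congr 1
  ext v
  simp

/-- Compact groups are unimodular: a right translate is again left invariant, hence a multiple of
`μ`, and the total masses agree. -/
theorem map_mul_right_of_compactSpace {G : Type*} [Group G] [TopologicalSpace G]
    [IsTopologicalGroup G] [CompactSpace G] [MeasurableSpace G] [BorelSpace G] (μ : Measure G)
    [μ.IsHaarMeasure] (t : G) : μ.map (· * t) = μ := by
  have h := Measure.isMulInvariant_eq_smul_of_compactSpace (μ.map (· * t)) μ
  have h1 := congrArg (fun ν : Measure G => ν Set.univ) h
  simp only [Measure.smul_apply] at h1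
  rw [Measure.map_apply (measurable_mul_const t) MeasurableSet.univ, Set.preimage_univ,
    ENNReal.smul_def, smul_eq_mul] at h1
  have h0 : μ Set.univ ≠ 0 := (Measure.measure_univ_ne_zero).mpr (NeZero.ne μ)
  have h2 : (Measure.haarScalarFactor (μ.map (· * t)) μ : ℝ≥0∞) = 1 := by
    have := (ENNReal.mul_left_inj h0 (measure_ne_top μ _)).mp ((one_mul _).trans h1)
    exact this.symm
  rw [h, ENNReal.coe_eq_one.mp h2, one_smul]

theorem relatorMeasure_eq_of_translate {A B : Set (schurRelators p g)} (hA : MeasurableSet A)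
    (hB : MeasurableSet B) (t₀ : frattiniProP p (FreeProP p g))
    (h : ∀ t, toRelator p g t ∈ A ↔ toRelator p g (t * t₀) ∈ B) :
    relatorMeasure p g A = relatorMeasure p g B := by
  rw [relatorMeasure, Measure.map_apply measurable_toRelator hA,
    Measure.map_apply measurable_toRelator hB]
  conv_rhs => rw [← map_mul_right_of_compactSpace (Measure.haarMeasure _) t₀]
  rw [Measure.map_apply (measurable_mul_const t₀) (measurable_toRelator hB)]
  congr 1
  ext t
  exact h t

theorem coe_toRelator (t : frattiniProP p (FreeProP p g)) :
    (toRelator p g t : FreeProP p g) = (t : FreeProP p g)⁻¹ * FreeProP.sig p g t := rfl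

/-- Translating the parameter conjugates a relator and multiplies it by that of `t₀`. This is how
invariance of Haar measure reaches `X`, which need not be a group. -/
theorem coe_toRelator_mul (t t₀ : frattiniProP p (FreeProP p g)) :
    (toRelator p g (t * t₀) : FreeProP p g) =
      (t₀ : FreeProP p g)⁻¹ * toRelator p g t * (t₀ : FreeProP p g) * toRelator p g t₀ := by
  simp only [coe_toRelator, Subgroup.coe_mul, map_mul, mul_inv_rev]
  group

theorem toRelator_surjective : Function.Surjective (toRelator p g) := by
  rintro ⟨s, t, ht, rfl⟩
  exact ⟨⟨t, ht⟩, rfl⟩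

/-- The image of the random relator in a finite quotient is uniformly distributed. -/
theorem relatorMeasure_fiber {D : Type*} [Group D] [TopologicalSpace D] [DiscreteTopology D]
    [Finite D] {π : FreeProP p g →* D} (hc : Continuous π) {d : D}
    (hd : d ∈ π '' schurRelators p g) :
    relatorMeasure p g {x | π x = d} = ((π '' schurRelators p g).ncard : ℝ≥0∞)⁻¹ := by
  classical
  have hm : ∀ d, MeasurableSet {x : schurRelators p g | π x = d} := fun d =>
    ((isOpen_discrete {d}).preimage (hc.comp continuous_subtype_val)).measurableSet
  have heq : ∀ d ∈ π '' schurRelators p g, relatorMeasure p g {x | π x = d} =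
      relatorMeasure p g {x | π x = 1} := by
    rintro _ ⟨s, hs, rfl⟩
    obtain ⟨t₀, ht₀⟩ := toRelator_surjective ⟨s, hs⟩
    -- After translation by `t₀`, with relator `s`, the image is a conjugate of the old one times `π
    -- s`; it equals `π s` exactly when the old image is `1`. So all fibres have the mass of the
    -- fibre over `1`.
    refine (relatorMeasure_eq_of_translate (hm _) (hm _) t₀ fun t => ?_).symm
    simp only [Set.mem_ofPred_eq, coe_toRelator_mul, map_mul, ht₀]
    rw [mul_eq_right, map_inv, mul_assoc, inv_mul_eq_one, right_eq_mul]
  set s := (π '' schurRelators p g).toFinite.toFinset with hs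
  have hsum := sum_measure_preimage_singleton (μ := relatorMeasure p g) s
    (f := fun x : schurRelators p g => π x) fun d _ => hm d
  have huniv : (fun x : schurRelators p g => π x) ⁻¹' s = Set.univ := by
    ext x
    simpa [hs] using ⟨x.1, x.2, rfl⟩
  rw [huniv, measure_univ] at hsum
  have hsum' : ∑ d ∈ s, relatorMeasure p g {x | π x = d} =
      ∑ d ∈ s, relatorMeasure p g {x | π x = 1} :=
    Finset.sum_congr rfl fun d hd => heq d (by simpa [hs] using hd)
  have hsum2 : (s.card : ℝ≥0∞) * relatorMeasure p g {x | π x = 1} = 1 := by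
    rw [← nsmul_eq_mul, ← Finset.sum_const, ← hsum', ← hsum]
    rfl
  rw [heq d hd, Set.ncard_eq_toFinset_card _ (π '' schurRelators p g).toFinite, ← hs]
  exact ENNReal.eq_inv_of_mul_eq_one_left (by rw [mul_comm]; exact hsum2)

end RelatorMeasure

/-! ### Random relators present groups with finite abelianization -/

section FiniteAbelianization

variable {p g : ℕ} [hp : Fact p.Prime]

/-- For `t = x_i ^ (p j)` in `Φ(F)` the relator takes the value `-2 p j u_i`. For `0 ≤ j < p ^ n`
these are distinct, as `2` and `u_i` are units modulo `p ^ (n + 1)`. -/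
theorem le_ncard_lin_relators (h2 : p ≠ 2) (n : ℕ) {u : Fin g → ZMod (p ^ (n + 1))} {i : Fin g}
    (hu : IsUnit (u i)) :
    p ^ n ≤ (FreeProP.lin (p := p) ⟨n + 1, rfl⟩ u '' schurRelators p g).ncard := by
  have : NeZero (p ^ (n + 1)) := ⟨pow_ne_zero _ hp.out.ne_zero⟩
  have hlin := FreeProP.lin_mul (p := p) ⟨n + 1, rfl⟩ u
  have hval : ∀ j : ℕ, -(2 * (p * j : ℕ) * u i : ZMod (p ^ (n + 1))) ∈
      FreeProP.lin (p := p) ⟨n + 1, rfl⟩ u '' schurRelators p g := by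
    intro j
    let t : FreeProP p g := (FreeProP.gen p g i ^ j) ^ p
    refine ⟨t⁻¹ * FreeProP.sig p g t, ⟨t, pow_mem_frattiniProP _, rfl⟩, ?_⟩
    rw [hlin, additive_inv hlin, FreeProP.additive_sig hlin (FreeProP.continuous_lin _ u)]
    simp only [t, additive_pow hlin, FreeProP.lin_gen]
    push_cast
    ring
  have hinj : Set.InjOn (fun j : ℕ => -(2 * (p * j : ℕ) * u i : ZMod (p ^ (n + 1))))
      (Finset.range (p ^ n) : Set ℕ) := by
    intro a ha b hb hab
    have h2u : IsUnit (2 : ZMod (p ^ (n + 1))) := by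
      have := (ZMod.isUnit_iff_coprime 2 (p ^ (n + 1))).mpr
        (((Nat.coprime_primes Nat.prime_two hp.out).mpr h2.symm).pow_right _)
      exact_mod_cast this
    have h1 := h2u.mul_left_cancel (hu.mul_right_cancel (neg_injective hab))
    rw [ZMod.natCast_eq_natCast_iff, pow_succ'] at h1
    have h3 := Nat.ModEq.mul_left_cancel' hp.out.ne_zero h1
    exact Nat.ModEq.eq_of_lt_of_lt h3 (by simpa using ha) (by simpa using hb)
  calc p ^ n = (Finset.range (p ^ n) : Set ℕ).ncard := by simp
    _ = ((fun j : ℕ => -(2 * (p * j : ℕ) * u i : ZMod (p ^ (n + 1)))) ''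
        (Finset.range (p ^ n) : Set ℕ)).ncard := hinj.ncard_image.symm
    _ ≤ _ := Set.ncard_le_ncard (by rintro _ ⟨j, -, rfl⟩; exact hval j) (Set.toFinite _)

theorem relatorMeasure_lin_le (h2 : p ≠ 2) (n : ℕ) {u : Fin g → ZMod (p ^ (n + 1))} {i : Fin g}
    (hu : IsUnit (u i)) :
    relatorMeasure p g {x | FreeProP.lin ⟨n + 1, rfl⟩ u (x : FreeProP p g) = 0} ≤
      ((p ^ n : ℕ) : ℝ≥0∞)⁻¹ := by
  have : NeZero (p ^ (n + 1)) := ⟨pow_ne_zero _ hp.out.ne_zero⟩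
  have : Finite (Multiplicative (ZMod (p ^ (n + 1)))) := inferInstance
  have hlin := FreeProP.lin_mul (p := p) ⟨n + 1, rfl⟩ u
  have := relatorMeasure_fiber (π := contHomOfAdditive (FreeProP.lin (p := p) ⟨n + 1, rfl⟩ u) hlin)
    (continuous_ofAdd.comp (FreeProP.continuous_lin _ u)) (d := 1)
    ⟨1, ⟨1, one_mem _, by simp⟩, map_one _⟩
  refine this.trans_le (ENNReal.inv_le_inv.mpr ?_)
  exact_mod_cast le_ncard_lin_relators h2 n hu

theorem exists_isUnit_of_lin_eq_one {n : ℕ} {u : Fin g → ZMod (p ^ (n + 1))} {x : FreeProP p g}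
    (hx : FreeProP.lin ⟨n + 1, rfl⟩ u x = 1) : ∃ i, IsUnit (u i) := by
  have : NeZero (p ^ (n + 1)) := ⟨pow_ne_zero _ hp.out.ne_zero⟩
  by_contra! h
  let c : ZMod (p ^ (n + 1)) →+* ZMod p := ZMod.castHom (dvd_pow_self p n.succ_ne_zero) _
  have hc : ∀ a : ZMod (p ^ (n + 1)), ¬ IsUnit a → c a = 0 := by
    intro a ha
    obtain ⟨k, rfl⟩ := ZMod.natCast_zmod_surjective a
    rw [map_natCast, ZMod.natCast_eq_zero_iff]
    by_contra hk
    exact ha ((ZMod.isUnit_iff_coprime k _).mpr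
      (((Nat.Prime.coprime_iff_not_dvd hp.out).mpr hk).symm.pow_right _))
  have h1 : c (FreeProP.lin ⟨n + 1, rfl⟩ u x) = 0 := by
    rw [FreeProP.lin_sum, map_sum]
    exact Finset.sum_eq_zero fun i _ => by rw [map_mul, hc _ (h i), zero_mul]
  rw [hx, map_one] at h1
  exact one_ne_zero h1

/-- A first moment estimate. An infinite abelianization maps onto `ℤ/pⁿ⁺¹`, and the unit multiples
of this map give as many functionals with a unit coordinate that vanish on all relators. There are
at most `p ^ ((n + 1) g)` such functionals, each vanishing on a random tuple with probability at
most `p ^ (-n g)`, so at most `p ^ g` are expected. -/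
theorem totient_mul_measure_le (h2 : p ≠ 2) (n : ℕ) :
    ((p ^ (n + 1)).totient : ℕ) * relatorTupleMeasure p g
      {v | ¬ Finite (TopologicalAbelianization (PresentedGroupProP v))} ≤ (p ^ g : ℕ) := by
  classical
  set q := p ^ (n + 1) with hq
  have : NeZero q := ⟨pow_ne_zero _ hp.out.ne_zero⟩
  let hm : ∃ k, q = p ^ k := ⟨n + 1, rfl⟩
  let s : Finset (Fin g → ZMod q) := Finset.univ.filter fun u => ∃ i, IsUnit (u i)
  let A : (Fin g → ZMod q) → Set (schurRelators p g) := fun u =>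
    {x | FreeProP.lin hm u (x : FreeProP p g) = 0}
  have hA : ∀ u, MeasurableSet (A u) := fun u =>
    ((isOpen_discrete {0}).preimage
      ((FreeProP.continuous_lin hm u).comp continuous_subtype_val)).measurableSet
  let E : (Fin g → ZMod q) → Set (Fin g → schurRelators p g) := fun u => {v | ∀ i, v i ∈ A u}
  have hE : ∀ u ∈ s, MeasurableSet (E u) := fun u _ => by
    have : E u = ⋂ i, (fun v => v i) ⁻¹' A u := by
      ext v
      simp [E]
    rw [this]
    exact MeasurableSet.iInter fun i => measurable_pi_apply i (hA u)
  refine (mul_measure_le_sum (relatorTupleMeasure p g) s hE (c := q.totient) ?_).trans ?_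
  · intro v hv
    have hfg : IsTopFG (PresentedGroupProP v) := by
      refine ⟨Finset.univ.image fun i => presentedMk v (FreeProP.gen p g i), ?_⟩
      have := (presentedMk_surjective v).denseRange.dense_image (continuous_presentedMk v)
        FreeProP.dense_closure_gen
      rw [← Subgroup.coe_map, MonoidHom.map_closure, ← Set.range_comp] at this
      simpa [Function.comp_def] using this
    obtain ⟨ψ, hψ, hadd, y, hy⟩ := (isProP_presented v).exists_additive_eq_one hfg hv n
    have hlin : (fun x => ψ (presentedMk v x)) =
        FreeProP.lin hm fun i => ψ (presentedMk v (FreeProP.gen p g i)) :=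
      FreeProP.eq_lin hm (fun a b => by rw [map_mul, hadd])
        (hψ.comp (continuous_presentedMk v))
    set u := fun i => ψ (presentedMk v (FreeProP.gen p g i)) with hu
    obtain ⟨x, hx⟩ := presentedMk_surjective v y
    obtain ⟨i, hi⟩ := exists_isUnit_of_lin_eq_one (u := u) (x := x)
      (by rw [← hy, ← hx]; exact (congrFun hlin x).symm)
    have hker : ∀ j, FreeProP.lin hm u (v j : FreeProP p g) = 0 := by
      intro j
      rw [← congrFun hlin (v j : FreeProP p g)]
      have : presentedMk v (v j : FreeProP p g) = 1 :=
        (QuotientGroup.eq_one_iff _).mpr (relator_mem_relationSubgroup v j)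
      rw [this, additive_one hadd]
    have hsmul : ∀ (a : ZMod q) x, FreeProP.lin hm (a • u) x = a * FreeProP.lin hm u x := by
      intro a x
      rw [FreeProP.lin_sum hm (a • u), FreeProP.lin_sum hm u, Finset.mul_sum]
      exact Finset.sum_congr rfl fun i _ => by rw [Pi.smul_apply, smul_eq_mul, mul_assoc]
    rw [← ZMod.card_units_eq_totient, ← Finset.card_univ]
    refine Finset.card_le_card_of_injOn (fun a : (ZMod q)ˣ => (a : ZMod q) • u) ?_ ?_
    · intro a _
      simp only [s, E, A, Finset.coe_filter, Finset.mem_filter, Finset.mem_univ, true_and,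
        Set.mem_ofPred_eq]
      refine ⟨⟨i, a.isUnit.mul hi⟩, fun j => ?_⟩
      rw [hsmul, hker, mul_zero]
    · intro a _ b _ hab
      exact Units.ext (hi.mul_right_cancel (congrFun hab i))
  · have hle : ∀ u ∈ s, relatorTupleMeasure p g (E u) ≤ (((p ^ n : ℕ) : ℝ≥0∞)⁻¹) ^ g := by
      intro u hu
      obtain ⟨i, hi⟩ := (Finset.mem_filter.mp hu).2
      rw [relatorTupleMeasure_forall, Finset.prod_const, Finset.card_univ, Fintype.card_fin]
      exact pow_le_pow_left' (relatorMeasure_lin_le h2 n hi) g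
    refine (Finset.sum_le_card_nsmul _ _ _ hle).trans ?_
    have hcard : s.card ≤ (p ^ n) ^ g * p ^ g := by
      refine (Finset.card_le_univ s).trans (le_of_eq ?_)
      rw [Fintype.card_fun, ZMod.card, Fintype.card_fin, hq, pow_succ, mul_pow]
    rw [nsmul_eq_mul]
    calc (s.card : ℝ≥0∞) * (((p ^ n : ℕ) : ℝ≥0∞)⁻¹) ^ g
        ≤ (((p ^ n) ^ g * p ^ g : ℕ) : ℝ≥0∞) * (((p ^ n : ℕ) : ℝ≥0∞)⁻¹) ^ g := by gcongr
      _ = (p ^ g : ℕ) * ((((p ^ n : ℕ) : ℝ≥0∞) * ((p ^ n : ℕ) : ℝ≥0∞)⁻¹) ^ g) := by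
        push_cast
        rw [mul_pow]
        ring
      _ = (p ^ g : ℕ) := by
        rw [ENNReal.mul_inv_cancel (by exact_mod_cast pow_ne_zero n hp.out.ne_zero)
          (ENNReal.natCast_ne_top _), one_pow, mul_one]

/-- Almost all tuples of relators present groups with finite abelianization. -/
theorem measure_infinite_abelianization (h2 : p ≠ 2) :
    relatorTupleMeasure p g
      {v | ¬ Finite (TopologicalAbelianization (PresentedGroupProP v))} = 0 := by
  by_contra h0
  set m := relatorTupleMeasure p g
    {v | ¬ Finite (TopologicalAbelianization (PresentedGroupProP v))}
  obtain ⟨N, hN⟩ := ENNReal.exists_nat_mul_gt h0 (b := ((p ^ g : ℕ) : ℝ≥0∞))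
    (ENNReal.natCast_ne_top _)
  have h1 := totient_mul_measure_le (g := g) h2 N
  have h3 : N ≤ (p ^ (N + 1)).totient := by
    rw [Nat.totient_prime_pow_succ hp.out]
    calc N ≤ p ^ N := (Nat.lt_pow_self hp.out.one_lt).le
      _ ≤ p ^ N * (p - 1) := Nat.le_mul_of_pos_right _ (Nat.sub_pos_of_lt hp.out.one_lt)
  have h4 : (N : ℝ≥0∞) * m ≤ ((p ^ (N + 1)).totient : ℕ) * m := by gcongr
  exact absurd (h4.trans h1) (not_le.mpr hN)

theorem measure_compl_schurTuples (h2 : p ≠ 2) (hg : 1 ≤ g) :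
    relatorTupleMeasure p g (schurTuples p g)ᶜ = 0 :=
  measure_mono_null (t := {v | ¬ Finite (TopologicalAbelianization (PresentedGroupProP v))})
    (fun v hv hfin => hv (have : Finite (TopologicalAbelianization (PresentedGroupProP v)) := hfin
      isSchurSigma_presented h2 hg v))
    (measure_infinite_abelianization h2)

/-- Null measurability follows from conullity and suffices for pulling the measure back to this set.
-/
theorem nullMeasurableSet_schurTuples (h2 : p ≠ 2) (hg : 1 ≤ g) :
    NullMeasurableSet (schurTuples p g) (relatorTupleMeasure p g) :=
  NullMeasurableSet.compl_iff.mp (NullMeasurableSet.of_null (measure_compl_schurTuples h2 hg))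

end FiniteAbelianization

/-! ### Characteristic open subgroups -/

section FinKer

variable {G H : Type*} [Group G] [TopologicalSpace G] [Group H] [TopologicalSpace H]

/-- The intersection of the kernels of all homomorphisms with open kernel to the symmetric group
on `n` letters. -/
def finKer (n : ℕ) (G : Type*) [Group G] [TopologicalSpace G] : Subgroup G :=
  ⨅ h : {h : G →* Equiv.Perm (Fin n) // IsOpen (h.ker : Set G)}, h.1.ker

theorem mem_finKer {n : ℕ} {x : G} :
    x ∈ finKer n G ↔ ∀ h : G →* Equiv.Perm (Fin n), IsOpen (h.ker : Set G) → h x = 1 := by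
  simp [finKer, Subgroup.mem_iInf, MonoidHom.mem_ker]

instance (n : ℕ) : (finKer n G).Normal :=
  ⟨fun x hx y => mem_finKer.2 fun h ho => by simp [mem_finKer.1 hx h ho]⟩

theorem map_mem_finKer {f : G →* H} (hf : Continuous f) {n : ℕ} {x : G} (hx : x ∈ finKer n G) :
    f x ∈ finKer n H :=
  mem_finKer.2 fun h ho => mem_finKer.1 hx (h.comp f) (ho.preimage hf)

theorem map_mem_finKer_iff (e : contAut G) {n : ℕ} {x : G} :
    e.1 x ∈ finKer n G ↔ x ∈ finKer n G :=
  ⟨fun h => by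
    have := map_mem_finKer (f := (e.1.symm : G ≃* G).toMonoidHom) e.2.2 h
    simpa using this, fun h => map_mem_finKer (f := (e.1 : G ≃* G).toMonoidHom) e.2.1 h⟩

theorem hom_eq_of_isOpen_ker [IsTopologicalGroup G] {S : Set G}
    (hS : Dense (Subgroup.closure S : Set G)) {P : Type*} [Group P] {h h' : G →* P}
    (ho : IsOpen (h.ker : Set G)) (ho' : IsOpen (h'.ker : Set G)) (he : ∀ s ∈ S, h s = h' s) :
    h = h' := by
  have h1 : h.ker ⊓ h'.ker ≤ h.eqLocus h' := fun x hx => by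
    have h2 : h x = 1 := hx.1
    have h3 : h' x = 1 := hx.2
    exact h2.trans h3.symm
  have hcl : IsClosed (h.eqLocus h' : Set G) :=
    Subgroup.isClosed_of_isOpen _ (Subgroup.isOpen_mono h1 (ho.inter ho'))
  have h4 : (Subgroup.closure S : Set G) ⊆ h.eqLocus h' :=
    (Subgroup.closure_le _).2 he
  ext x
  have := closure_minimal h4 hcl (hS x)
  exact this

theorem finite_hom_isOpen_ker [IsTopologicalGroup G] (hG : IsTopFG G) (P : Type*) [Group P]
    [Finite P] : Finite {h : G →* P // IsOpen (h.ker : Set G)} := by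
  obtain ⟨S, hS⟩ := hG
  refine Finite.of_injective (fun h (s : S) => h.1 s) fun h h' he => Subtype.ext ?_
  exact hom_eq_of_isOpen_ker hS h.2 h'.2 fun s hs => congrFun he ⟨s, hs⟩

/-- A continuous homomorphism to a finite group is determined by its values on a finite generating
set, so the intersection is finite. These subgroups give a countable base at `1` that all
automorphisms preserve. -/
theorem isOpen_finKer [IsTopologicalGroup G] (hG : IsTopFG G) (n : ℕ) :
    IsOpen (finKer n G : Set G) := by
  have := finite_hom_isOpen_ker hG (Equiv.Perm (Fin n))
  rw [finKer, Subgroup.coe_iInf]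
  exact isOpen_iInter_of_finite fun h => h.2

theorem exists_hom_perm_ker_eq {U : Subgroup G} [U.Normal] [Finite (G ⧸ U)] :
    ∃ h : G →* Equiv.Perm (Fin (Nat.card (G ⧸ U))), h.ker = U := by
  refine ⟨((Finite.equivFin (G ⧸ U)).permCongrHom.toMonoidHom).comp
    (MulAction.toPermHom G (G ⧸ U)), ?_⟩
  have h : (MulAction.toPermHom G (G ⧸ U)).ker = U := by
    rw [← Subgroup.normalCore_eq_ker, Subgroup.normalCore_eq_self]
  refine Eq.trans ?_ h
  ext x
  simp [MonoidHom.mem_ker]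

theorem exists_finKer_le [IsTopologicalGroup G] [CompactSpace G] {U : Subgroup G} [U.Normal]
    (ho : IsOpen (U : Set G)) : ∃ n, finKer n G ≤ U := by
  have : Finite (G ⧸ U) := U.quotient_finite_of_isOpen ho
  obtain ⟨h, hh⟩ := exists_hom_perm_ker_eq (U := U)
  refine ⟨Nat.card (G ⧸ U), fun x hx => ?_⟩
  have := mem_finKer.1 hx h (by rw [hh]; exact ho)
  rw [← hh]
  exact this

theorem IsProP.eq_of_forall_finKer {p : ℕ} (hG : IsProP p G) {x y : G}
    (h : ∀ n, x⁻¹ * y ∈ finKer n G) : x = y := by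
  have := hG.topologicalGroup
  have := hG.compact
  refine hG.eq_of_forall_openNormal fun U hn ho => ?_
  obtain ⟨n, hle⟩ := exists_finKer_le ho
  exact hle (h n)

end FinKer

/-! ### Automorphisms of odd order -/

section OddOrder

variable {p : ℕ} [hp : Fact p.Prime]

/-- If the fixed subgroup were proper, some character `χ` would kill it but not `z`. For the root
`y` of `z β(z)⁻¹`, invariance gives `χ(y)² = 1`, so `χ(y) = 1`. Since `y⁻¹ z` is fixed by `β`, also
`χ(z) = 1`. -/
theorem IsPGroup.eq_of_involution {P : Type*} [Group P] [Finite P] (hP : IsPGroup p P)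
    (h2 : p ≠ 2) {β : P →* P} (hβ : ∀ x, β (β x) = x)
    (hχ : ∀ (χ : P →* Multiplicative (ZMod p)) (x : P), χ (β x) = χ x) (x : P) : β x = x := by
  let _ : TopologicalSpace P := ⊥
  have : DiscreteTopology P := ⟨rfl⟩
  have hpro : IsProP p P := .of_discrete hP
  by_contra hx
  have hne : β.eqLocus (MonoidHom.id P) ≠ ⊤ := fun h => hx (by
    have : x ∈ β.eqLocus (MonoidHom.id P) := h ▸ Subgroup.mem_top x
    exact this)
  obtain ⟨χ, h1, z, hz⟩ := hP.exists_hom_of_ne_top hne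
  obtain ⟨y, hy, hy', -⟩ := hpro.exists_inverted h2 hβ z
  have h3 : χ y * χ y = 1 := by rw [← map_mul, hy, map_mul, map_inv, hχ, mul_inv_cancel]
  have h4 : χ y = 1 := by
    have : IsProP p (Multiplicative (ZMod p)) := FreeProP.isProP_zmod ⟨1, (pow_one p).symm⟩
    exact this.sq_injective h2 (by rw [h3, one_mul])
  have h5 : χ (y⁻¹ * z) = 1 := by
    refine h1 _ ?_
    change β (y⁻¹ * z) = y⁻¹ * z
    rw [map_mul, map_inv, hy', inv_inv, eq_inv_mul_iff_mul_eq, ← mul_assoc, hy,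
      inv_mul_cancel_right]
  rw [map_mul, map_inv, h4, inv_one, one_mul] at h5
  exact hz h5

/-- If the order were `2k`, the power `β ^ k` would be an involution preserving all characters,
hence trivial. -/
theorem IsPGroup.odd_orderOf_of_trivial {P : Type*} [Group P] [Finite P] (hP : IsPGroup p P)
    (h2 : p ≠ 2) (β : MulAut P)
    (hχ : ∀ (χ : P →* Multiplicative (ZMod p)) (x : P), χ (β x) = χ x) : Odd (orderOf β) := by
  have : Finite (MulAut P) := Finite.of_injective (fun e : MulAut P => (e : P → P))
    DFunLike.coe_injective
  rw [← Nat.not_even_iff_odd]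
  rintro ⟨k, hk⟩
  have h0 : 0 < orderOf β := orderOf_pos β
  have hpow : ∀ n (χ : P →* Multiplicative (ZMod p)) (x : P), χ ((β ^ n) x) = χ x := by
    intro n χ
    induction n with
    | zero => intro x; simp
    | succ n ih => intro x; rw [pow_succ, MulAut.mul_apply, ih, hχ]
  have h1 : β ^ k = 1 := by
    ext x
    refine hP.eq_of_involution h2 (β := (β ^ k).toMonoidHom) (fun x => ?_) (hpow k) x
    change (β ^ k) ((β ^ k) x) = x
    rw [← MulAut.mul_apply, ← pow_add, ← hk, pow_orderOf_eq_one, MulAut.one_apply]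
  have := orderOf_dvd_of_pow_eq_one h1
  have := Nat.le_of_dvd (by omega) this
  omega

end OddOrder

/-! ### Conjugacy of Schur involutions -/

section Conjugacy

variable {p : ℕ} [hp : Fact p.Prime] {G : Type*} [Group G] [TopologicalSpace G]
  [IsTopologicalGroup G]

theorem IsSchurInvolution.mul_self {σ : contAut G} (hσ : IsSchurInvolution σ) : σ * σ = 1 := by
  have := pow_orderOf_eq_one σ
  rwa [hσ.1, pow_two] at this

theorem IsSchurInvolution.apply_apply {σ : contAut G} (hσ : IsSchurInvolution σ) (x : G) :
    σ.1 (σ.1 x) = x :=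
  congrArg (fun τ : contAut G => τ.1 x) hσ.mul_self

theorem IsSchurInvolution.mul_mem_commutatorClosure {σ : contAut G} (hσ : IsSchurInvolution σ)
    (x : G) : x * σ.1 x ∈ (commutator G).topologicalClosure := by
  have h := hσ.2 x
  rw [eq_inv_iff_mul_eq_one] at h
  have h' : ((σ.1 x * x : G) : TopologicalAbelianization G) = 1 := h
  have h3 : σ.1 x * x ∈ (commutator G).topologicalClosure := (QuotientGroup.eq_one_iff _).1 h'
  exact ((inferInstance : (commutator G).topologicalClosure.Normal).mem_comm_iff).1 h3

theorem IsSchurInvolution.additive {σ : contAut G} (hσ : IsSchurInvolution σ) {χ : G → ZMod p}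
    (hχ : χ ∈ contH1 p G) (x : G) : χ (σ.1 x) = -χ x := by
  have := additive_commutatorClosure hχ.2 hχ.1 (hσ.mul_mem_commutatorClosure x)
  rw [hχ.2] at this
  exact eq_neg_of_add_eq_zero_right this

theorem IsProP.exists_odd_pow_mem (hG : IsProP p G) (h2 : p ≠ 2) (t : contAut G)
    (ht : ∀ χ ∈ contH1 p G, ∀ x, χ (t.1 x) = χ x) {N : Subgroup G} [N.Normal]
    (ho : IsOpen (N : Set G)) (hN : N.map (t.1 : G →* G) = N) :
    ∃ m, Odd m ∧ ∀ x, x⁻¹ * (t.1 ^ m) x ∈ N := by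
  have := hG.finite_quotient ho
  have hP := hG.isPGroup_quotient ho
  let β : MulAut (G ⧸ N) := QuotientGroup.congr N N t.1 hN
  have hβ : ∀ x : G, β (x : G ⧸ N) = (t.1 x : G ⧸ N) := fun x => rfl
  refine ⟨orderOf β, hP.odd_orderOf_of_trivial h2 β fun χ x => ?_, fun x => ?_⟩
  · obtain ⟨x, rfl⟩ := QuotientGroup.mk_surjective x
    rw [hβ]
    have : DiscreteTopology (G ⧸ N) := QuotientGroup.discreteTopology ho
    refine Multiplicative.toAdd.injective
      (ht (fun y => Multiplicative.toAdd (χ (y : G ⧸ N))) ⟨?_, fun x y => ?_⟩ x)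
    · exact (continuous_of_discreteTopology (f := fun y : G ⧸ N => Multiplicative.toAdd (χ y))).comp
        continuous_quot_mk
    · change Multiplicative.toAdd (χ ((x : G ⧸ N) * (y : G ⧸ N))) = _
      rw [map_mul, toAdd_mul]
  · have hpow : ∀ n, (β ^ n) (x : G ⧸ N) = ((t.1 ^ n) x : G ⧸ N) := by
      intro n
      induction n with
      | zero => rfl
      | succ n ih => rw [pow_succ', pow_succ', MulAut.mul_apply, ih, hβ, MulAut.mul_apply]
    rw [← QuotientGroup.eq, ← hpow, pow_orderOf_eq_one]
    rfl

theorem mulAut_pow_congr {N : Subgroup G} [N.Normal] {t : MulAut G} {m : ℕ}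
    (hm : ∀ x, x⁻¹ * (t ^ m) x ∈ N) (a b : ℕ) (x : G) :
    (((t ^ a) x : G) : G ⧸ N) = ((t ^ (a + m * b)) x : G) := by
  induction b with
  | zero => rfl
  | succ b ih =>
    rw [ih, show a + m * (b + 1) = m + (a + m * b) by ring, pow_add t m, MulAut.mul_apply,
      QuotientGroup.eq]
    exact hm _

/-- An automorphism acting trivially on the Frattini quotient has a square root. -/
theorem IsProP.exists_sqrt_aut (hG : IsProP p G) (hfg : IsTopFG G) (h2 : p ≠ 2) (t : contAut G)
    (ht : ∀ χ ∈ contH1 p G, ∀ x, χ (t.1 x) = χ x) :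
    ∃ ρ : G →* G, Continuous ρ ∧
      ∀ n, ∃ a : ℕ, (∀ x, (ρ x : G ⧸ finKer n G) = ((t.1 ^ a) x : G)) ∧
        ∀ x, (((t.1 ^ (a + a)) x : G) : G ⧸ finKer n G) = (t.1 x : G) := by
  have hN : ∀ n, (finKer n G).map (t.1 : G →* G) = finKer n G := by
    intro n
    ext x
    refine ⟨?_, fun hx => ⟨t.1.symm x, ?_, by simp⟩⟩
    · rintro ⟨y, hy, rfl⟩
      exact (map_mem_finKer_iff t).2 hy
    · refine (map_mem_finKer_iff t).1 ?_
      simpa using hx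
  choose m hodd hm using fun n => hG.exists_odd_pow_mem h2 t ht (isOpen_finKer hfg n) (hN n)
  -- `P j` is odd and `t ^ P j` is trivial modulo `finKer n` for all `n ≤ j`. With `P j = 2 k j +
  -- 1`, the power `t ^ (k j + 1)` is a square root of `t` at these levels.
  let P : ℕ → ℕ := fun j => ∏ i ∈ Finset.range (j + 1), m i
  have hP : ∀ j, Odd (P j) := fun j =>
    Finset.prod_induction _ Odd (fun _ _ => Odd.mul) odd_one fun i _ => hodd i
  choose k hk using hP
  let r : ℕ → G → G := fun j x => (t.1 ^ (k j + 1)) x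
  have hcpt := hG.compact
  have ht2 := hG.t2Space
  -- Modulo `finKer n` the powers are constant from index `n` on, so any limit along an ultrafilter
  -- finer than the cofinite filter has the right values at all levels.
  let F : G → Ultrafilter G := fun x => (Filter.hyperfilter ℕ).map fun j => r j x
  let ρ : G → G := fun x => @Ultrafilter.lim _ _ (F x)
  have hlim : ∀ x, Filter.Tendsto (fun j => r j x) (Filter.hyperfilter ℕ) (nhds (ρ x)) :=
    fun x => Ultrafilter.le_nhds_lim (F x)
  have hstep : ∀ n j, n ≤ j → ∀ x, ((r j x : G) : G ⧸ finKer n G) = (r n x : G) := by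
    intro n j hnj x
    obtain ⟨c, hc⟩ : P n ∣ P j :=
      Finset.prod_dvd_prod_of_subset _ _ _ (Finset.range_mono (by omega))
    obtain ⟨d, hd⟩ : m n ∣ P n := Finset.dvd_prod_of_mem _ (Finset.mem_range.2 (by omega))
    have hco : Odd c := by
      have h : Odd (P j) := ⟨k j, hk j⟩
      rw [hc] at h
      exact (Nat.odd_mul.1 h).2
    obtain ⟨e, he⟩ := hco
    have : k j + 1 = (k n + 1) + m n * (d * e) := by
      have h1 := hk j
      rw [hc, he, hk n] at h1
      have h3 : m n * (d * e) = (2 * k n + 1) * e := by rw [← mul_assoc, ← hd, hk n]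
      rw [h3]
      nlinarith
    change (((t.1 ^ (k j + 1)) x : G) : G ⧸ finKer n G) = ((t.1 ^ (k n + 1)) x : G)
    rw [this, ← mulAut_pow_congr (hm n)]
  have hρ : ∀ n x, (ρ x : G ⧸ finKer n G) = (r n x : G) := by
    intro n x
    have hd : DiscreteTopology (G ⧸ finKer n G) :=
      QuotientGroup.discreteTopology (isOpen_finKer hfg n)
    have hcl : IsClosed {y : G | (y : G ⧸ finKer n G) = (r n x : G)} :=
      (isClosed_discrete ({(r n x : G ⧸ finKer n G)} : Set (G ⧸ finKer n G))).preimage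
        continuous_quot_mk
    refine hcl.mem_of_tendsto (hlim x) ?_
    have h1 : ∀ᶠ j in Filter.atTop, ((r j x : G) : G ⧸ finKer n G) = (r n x : G) :=
      Filter.eventually_atTop.2 ⟨n, fun j hj => hstep n j hj x⟩
    exact Filter.Eventually.filter_mono (by
      rw [← Nat.cofinite_eq_atTop]; exact Filter.hyperfilter_le_cofinite) h1
  have hmul : ∀ x y, ρ (x * y) = ρ x * ρ y := by
    intro x y
    refine hG.eq_of_forall_finKer fun n => ?_
    rw [← QuotientGroup.eq, QuotientGroup.mk_mul, hρ, hρ, hρ, ← QuotientGroup.mk_mul]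
    change (((t.1 ^ (k n + 1)) (x * y) : G) : G ⧸ finKer n G) = _
    rw [map_mul]
  refine ⟨MonoidHom.mk' ρ hmul, ?_, fun n => ⟨k n + 1, fun x => hρ n x, fun x => ?_⟩⟩
  · refine continuous_of_continuousAt_one _ ?_
    intro W hW
    rw [map_one] at hW
    obtain ⟨O, hOW, hO, h1⟩ := mem_nhds_iff.1 hW
    obtain ⟨U, hU, hUo, hUO⟩ := hG.exists_openNormal hO h1
    obtain ⟨n, hn⟩ := exists_finKer_le hUo
    refine Filter.mem_map.2 (Filter.mem_of_superset
      ((isOpen_finKer hfg n).mem_nhds (one_mem _)) fun x hx => ?_)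
    refine hOW (hUO (hn ?_))
    have h3 : ((r n x : G) : G ⧸ finKer n G) = 1 :=
      (QuotientGroup.eq_one_iff _).2 ((map_mem_finKer_iff (t ^ (k n + 1))).2 hx)
    rw [← hρ] at h3
    exact (QuotientGroup.eq_one_iff _).1 h3
  · obtain ⟨d, hd⟩ : m n ∣ P n := Finset.dvd_prod_of_mem _ (Finset.mem_range.2 (by omega))
    have : k n + 1 + (k n + 1) = 1 + m n * d := by rw [← hd, hk n]; ring
    rw [this, ← mulAut_pow_congr (hm n), pow_one]

/-- Any two Schur involutions of a finitely generated pro-`p` group, `p` odd, are conjugate. -/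
theorem IsProP.exists_conj_involution (hG : IsProP p G) (hfg : IsTopFG G) (h2 : p ≠ 2)
    {σ σ' : contAut G} (hσ : IsSchurInvolution σ) (hσ' : IsSchurInvolution σ') :
    ∃ ρ : contAut G, ρ * σ' = σ * ρ := by
  obtain ⟨ρ, hρc, hρ⟩ := hG.exists_sqrt_aut hfg h2 (σ * σ') fun χ hχ x => by
    change χ (σ.1 (σ'.1 x)) = _
    rw [hσ.additive hχ, hσ'.additive hχ, neg_neg]
  choose a ha ha' using hρ
  have hσi : σ⁻¹ = σ := inv_eq_of_mul_eq_one_left hσ.mul_self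
  have hσi' : σ'⁻¹ = σ' := inv_eq_of_mul_eq_one_left hσ'.mul_self
  -- `σ` inverts `t = σσ'` by conjugation, hence also the powers of `t`, and so the limit `ρ`.
  have hinv : ∀ n : ℕ, σ * (σ * σ') ^ n * σ = ((σ * σ') ^ n)⁻¹ := by
    intro n
    have h : σ * (σ * σ') * σ⁻¹ = (σ * σ')⁻¹ := by
      rw [mul_inv_rev, ← mul_assoc, hσ.mul_self, one_mul, hσi, hσi']
    calc σ * (σ * σ') ^ n * σ = σ * (σ * σ') ^ n * σ⁻¹ := by rw [hσi]
      _ = _ := by rw [← conj_pow, h, inv_pow]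
  have hcongr : ∀ (e : contAut G) {n : ℕ} {x y : G}, (x : G ⧸ finKer n G) = y →
      ((e.1 x : G) : G ⧸ finKer n G) = (e.1 y : G) := by
    intro e n x y h
    rw [QuotientGroup.eq] at h ⊢
    rw [← map_inv, ← map_mul]
    exact (map_mem_finKer_iff e).2 h
  have hsq : ∀ x, ρ (ρ x) = σ.1 (σ'.1 x) := by
    intro x
    refine hG.eq_of_forall_finKer fun n => ?_
    rw [← QuotientGroup.eq, ha n]
    refine (hcongr ((σ * σ') ^ a n) (ha n x)).trans (Eq.trans ?_ (ha' n x))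
    rw [pow_add]
    rfl
  have hid : ∀ x, σ.1 (ρ (σ.1 (ρ x))) = x := by
    intro x
    refine hG.eq_of_forall_finKer fun n => ?_
    rw [← QuotientGroup.eq]
    refine (hcongr σ (ha n _)).trans ((hcongr (σ * (σ * σ') ^ a n * σ) (ha n x)).trans ?_)
    rw [hinv]
    change ((((((σ * σ') ^ a n)⁻¹ * (σ * σ') ^ a n : contAut G)).1 x : G) : G ⧸ finKer n G) = x
    rw [inv_mul_cancel]
    rfl
  have hid' : ∀ x, ρ (σ.1 (ρ (σ.1 x))) = x := by
    intro x
    have h := congrArg σ.1 (hid (σ.1 x))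
    rwa [hσ.apply_apply, hσ.apply_apply] at h
  let e : MulAut G :=
    { toFun := ρ
      invFun := fun x => σ.1 (ρ (σ.1 x))
      left_inv := hid
      right_inv := hid'
      map_mul' := map_mul ρ }
  refine ⟨⟨e, hρc, σ.2.1.comp (hρc.comp σ.2.1)⟩, Subtype.ext (MulEquiv.ext fun x => ?_)⟩
  change ρ (σ'.1 x) = σ.1 (ρ x)
  have h3 := hsq (σ'.1 x)
  rw [hσ'.apply_apply] at h3
  -- From `ρ² = σσ'` and `σρσρ = 1`: applying the injective map `σρ` to `ρσ'` and to `σρ` gives the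
  -- identity in both cases.
  have hinj : Function.Injective fun z => σ.1 (ρ z) := σ.1.injective.comp e.injective
  refine hinj ?_
  change σ.1 (ρ (ρ (σ'.1 x))) = σ.1 (ρ (σ.1 (ρ x)))
  rw [h3, hid, hσ.apply_apply]

end Conjugacy

/-! ### Groups with center of finite index -/

section FiniteIndexCenter

open scoped commutatorElement in
-- A commutator depends only on the cosets of its entries modulo the centre.
theorem finite_commutatorSet_of_finiteIndex_center {H : Type*} [Group H]
    [(Subgroup.center H).FiniteIndex] : Finite (commutatorSet H) := by
  have hfin : Finite (H ⧸ Subgroup.center H) := Subgroup.finite_quotient_of_finiteIndex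
  let f : (H ⧸ Subgroup.center H) × (H ⧸ Subgroup.center H) → H := fun q => ⁅q.1.out, q.2.out⁆
  refine (Set.finite_range f).subset ?_
  rintro _ ⟨a, b, rfl⟩
  refine ⟨((a : H ⧸ Subgroup.center H), (b : H ⧸ Subgroup.center H)), ?_⟩
  obtain ⟨z, hz⟩ := QuotientGroup.mk_out_eq_mul (Subgroup.center H) a
  obtain ⟨w, hw⟩ := QuotientGroup.mk_out_eq_mul (Subgroup.center H) b
  have h1 := Subgroup.mem_center_iff.1 z.2
  have h3 := Subgroup.mem_center_iff.1 w.2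
  change ⁅(a : H ⧸ Subgroup.center H).out, (b : H ⧸ Subgroup.center H).out⁆ = ⁅a, b⁆
  rw [hz, hw, commutatorElement_def, commutatorElement_def]
  calc a * z * (b * w) * (a * z)⁻¹ * (b * w)⁻¹
      = a * z * b * (w * (↑z)⁻¹) * a⁻¹ * (b * w)⁻¹ := by group
    _ = a * (z * b) * (↑z)⁻¹ * (w * a⁻¹) * (b * w)⁻¹ := by rw [← h3]; group
    _ = a * b * a⁻¹ * b⁻¹ := by rw [← h1, ← h3]; group

/-- By Schur's theorem the derived subgroup of `H` is finite, hence closed, so the abelianization of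
`H` is a quotient of that of `G`. -/
theorem finite_of_finiteIndex_center {G H : Type*} [Group G] [TopologicalSpace G]
    [IsTopologicalGroup G] [Finite (TopologicalAbelianization G)] [Group H] [TopologicalSpace H]
    [T1Space H] [(Subgroup.center H).FiniteIndex] {π : G →* H} (hc : Continuous π)
    (hs : Function.Surjective π) : Finite H := by
  have := finite_commutatorSet_of_finiteIndex_center (H := H)
  have hfin : Finite (commutator H) := inferInstance
  have hcl : IsClosed ((commutator H).comap π : Set G) :=
    (Set.toFinite (commutator H : Set H)).isClosed.preimage hc
  have hle : (commutator G).topologicalClosure ≤ (commutator H).comap π := by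
    refine Subgroup.topologicalClosure_minimal _ ?_ hcl
    rw [← Subgroup.map_le_iff_le_comap]
    exact (Subgroup.map_commutator _ _ _).trans_le (Subgroup.commutator_mono le_top le_top)
  have hsurj : Function.Surjective
      (QuotientGroup.map (commutator G).topologicalClosure (commutator H) π hle) := by
    intro q
    obtain ⟨y, rfl⟩ := QuotientGroup.mk_surjective q
    obtain ⟨x, rfl⟩ := hs y
    exact ⟨(x : G ⧸ _), rfl⟩
  have hq : Finite (H ⧸ commutator H) :=
    @Finite.of_surjective (TopologicalAbelianization G) _ inferInstance _ hsurj
  exact Finite.of_equiv _ (Subgroup.groupEquivQuotientProdSubgroup (s := commutator H)).symm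

end FiniteIndexCenter

/-! ### Finite centralizers of Schur involutions -/

section InfiniteGroups

variable {p : ℕ} [hp : Fact p.Prime] {G : Type*} [Group G] [TopologicalSpace G]
  [IsTopologicalGroup G]

/-- Conjugation by `x`, as an automorphism of the topological group. -/
def innerAut (x : G) : contAut G :=
  ⟨MulAut.conj x, by
    change Continuous fun y => x * y * x⁻¹
    fun_prop, by
    change Continuous fun y => x⁻¹ * y * x
    fun_prop⟩

theorem innerAut_mem_autSigma {σ : contAut G} {x : G} (hx : σ.1 x = x) :
    innerAut x ∈ autSigma σ := by
  rw [autSigma, Subgroup.mem_centralizer_singleton_iff]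
  refine Subtype.ext (MulEquiv.ext fun y => ?_)
  change x * σ.1 y * x⁻¹ = σ.1 (x * y * x⁻¹)
  rw [map_mul, map_mul, map_inv, hx]

theorem innerAut_eq_one_iff {x : G} : innerAut x = 1 ↔ x ∈ Subgroup.center G := by
  rw [Subgroup.mem_center_iff]
  constructor
  · intro h y
    have h1 : x * y * x⁻¹ = y := congrArg (fun τ : contAut G => τ.1 y) h
    exact (mul_inv_eq_iff_eq_mul.1 h1).symm
  · intro h
    refine Subtype.ext (MulEquiv.ext fun y => ?_)
    change x * y * x⁻¹ = y
    rw [← h, mul_inv_cancel_right]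

/-- Conjugation by a fixed point commutes with `σ`. So the set is a finite union, over the
non-trivial `a` in `Aut_σ(G)`, of the closed sets of fixed points inducing `a`; in particular `1`
can be separated from it. -/
theorem isClosed_fixed_not_central [T2Space G] {σ : contAut G} [Finite (autSigma σ)] :
    IsClosed {x : G | σ.1 x = x ∧ x ∉ Subgroup.center G} := by
  have h : {x : G | σ.1 x = x ∧ x ∉ Subgroup.center G} =
      ⋃ a : {a : autSigma σ // a ≠ 1}, {x : G | σ.1 x = x ∧ ∀ y, x * y * x⁻¹ = a.1.1.1 y} := by
    ext x
    simp only [Set.mem_ofPred_eq, Set.mem_iUnion]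
    constructor
    · rintro ⟨h1, h3⟩
      refine ⟨⟨⟨innerAut x, innerAut_mem_autSigma h1⟩, fun h => h3 ?_⟩, h1, fun y => rfl⟩
      exact innerAut_eq_one_iff.1 (congrArg Subtype.val h)
    · rintro ⟨a, h1, h3⟩
      refine ⟨h1, fun h => a.2 (Subtype.ext (Subtype.ext (MulEquiv.ext fun y => ?_)))⟩
      change a.1.1.1 y = y
      rw [← h3, ← Subgroup.mem_center_iff.1 h, mul_inv_cancel_right]
  rw [h]
  refine isClosed_iUnion_of_finite fun a => ?_
  have h1 : {x : G | ∀ y, x * y * x⁻¹ = a.1.1.1 y} = ⋂ y, {x : G | x * y * x⁻¹ = a.1.1.1 y} := by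
    ext x
    simp
  have h3 : IsClosed {x : G | ∀ y, x * y * x⁻¹ = a.1.1.1 y} := by
    rw [h1]
    exact isClosed_iInter fun y => isClosed_eq (by fun_prop) continuous_const
  exact (isClosed_eq σ.2.1 continuous_id).inter h3

theorem isClosed_center [T2Space G] : IsClosed (Subgroup.center G : Set G) := by
  have : (Subgroup.center G : Set G) = ⋂ y : G, {x | y * x = x * y} := by
    ext x
    simp [Subgroup.mem_center_iff]
  rw [this]
  exact isClosed_iInter fun y => isClosed_eq (by fun_prop) (by fun_prop)

theorem ZMod.two_ne_zero_of_odd_prime (h2 : p ≠ 2) : (2 : ZMod p) ≠ 0 := by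
  intro h
  have h5 : ((2 : ℕ) : ZMod p) = 0 := by exact_mod_cast h
  rw [ZMod.natCast_eq_zero_iff] at h5
  exact h2 ((Nat.prime_dvd_prime_iff_eq hp.out Nat.prime_two).1 h5)

/-- The elements inverted by a Schur involution generate topologically. -/
theorem IsProP.eq_top_of_inverted_mem (hG : IsProP p G) (h2 : p ≠ 2) {σ : contAut G}
    (hσ : IsSchurInvolution σ) {H : Subgroup G} (hH : IsClosed (H : Set G))
    (h : ∀ x, σ.1 x = x⁻¹ → x ∈ H) : H = ⊤ := by
  by_contra hne
  obtain ⟨χ, hχ, hχ0, hχH⟩ := hG.exists_contH1 hH hne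
  refine hχ0 (funext fun a => ?_)
  obtain ⟨y, hy, hy', -⟩ := hG.exists_inverted h2 (σ := (σ.1 : G →* G)) hσ.apply_apply a
  have h1 : χ y = 0 := hχH y (h y hy')
  have h3 : χ (y * y) = χ (a * (σ.1 a)⁻¹) := congrArg χ hy
  rw [hχ.2, hχ.2, additive_inv hχ.2, hσ.additive hχ, neg_neg, h1, add_zero, ← two_mul] at h3
  exact (mul_eq_zero.1 h3.symm).resolve_left (ZMod.two_ne_zero_of_odd_prime h2)

/-- A pro-`p` group with finite abelianization and a Schur involution with finite centralizer is
finite. -/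
theorem IsProP.finite_of_finite_autSigma (hG : IsProP p G) (h2 : p ≠ 2)
    [Finite (TopologicalAbelianization G)] {σ : contAut G} (hσ : IsSchurInvolution σ)
    [Finite (autSigma σ)] : Finite G := by
  have := hG.compact
  have := hG.t2Space
  set Z := Subgroup.center G with hZ
  -- `V` avoids the non-central fixed points of `σ`, and `U` is a `σ`-stable open normal subgroup
  -- inside it.
  obtain ⟨V, hVn, hVo, hV⟩ := hG.exists_openNormal_separating
    (isClosed_fixed_not_central (σ := σ)) (x := 1) fun h => h.2 (one_mem _)
  let s : G →* G := (σ.1 : G →* G)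
  let U : Subgroup G := V ⊓ V.comap s
  have hUo : IsOpen (U : Set G) := hVo.inter (hVo.preimage σ.2.1)
  have hUn : U.Normal := inferInstance
  have hUs : ∀ x ∈ U, σ.1 x ∈ U := by
    rintro x ⟨h1, h3⟩
    refine ⟨h3, ?_⟩
    change σ.1 (σ.1 x) ∈ V
    rwa [hσ.apply_apply]
  have hUcl := Subgroup.isClosed_of_isOpen U hUo
  have hfix : ∀ x ∈ U, σ.1 x = x → x ∈ Z := by
    intro x hx hxs
    by_contra hxZ
    refine hV x ⟨hxs, hxZ⟩ ?_
    rw [mul_one]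
    exact inv_mem hx.1
  -- For the inverted root `y` of `w⁻¹ σ(w)`, the product `w y` is fixed by `σ`, hence central, and
  -- `w σ(w)` is its square. So `σ` inverts `U` modulo the centre.
  have hws : ∀ w ∈ U, w * σ.1 w ∈ Z := by
    intro w hw
    obtain ⟨y, hy, hy', hyH⟩ := hG.exists_inverted h2 (σ := s) hσ.apply_apply w⁻¹
    have hyU : y ∈ U := hyH U hUcl (inv_mem hw) (hUs _ (inv_mem hw))
    have hk : σ.1 (w * y) = w * y := by
      have h1 : σ.1 y = y⁻¹ := hy'
      have h3 : y * y = w⁻¹ * (σ.1 w⁻¹)⁻¹ := hy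
      rw [map_inv, inv_inv] at h3
      rw [map_mul, h1, mul_inv_eq_iff_eq_mul, mul_assoc, h3, mul_inv_cancel_left]
    have hkZ := hfix _ (mul_mem hw hyU) hk
    have h1 : σ.1 y = y⁻¹ := hy'
    have h3 : w * σ.1 w = (w * y) * (w * y) := by
      have h4 := hk
      rw [map_mul, h1, mul_inv_eq_iff_eq_mul] at h4
      have h5 := Subgroup.mem_center_iff.1 hkZ y⁻¹
      calc w * σ.1 w = w * (w * y * y) := by rw [h4]
        _ = (w * y) * (y⁻¹ * (w * y)) * y := by group
        _ = (w * y) * (w * y) := by rw [h5]; group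
    rw [h3]
    exact mul_mem hkZ hkZ
  have hcent : ∀ w ∈ U, ∀ x : G, (w * x * w⁻¹ * x⁻¹) ∈ Z := by
    intro w hw
    let C : Subgroup G := (Subgroup.centralizer {(w : G ⧸ Z)}).comap (QuotientGroup.mk' Z)
    have hC : ∀ x, x ∈ C ↔ w * x * w⁻¹ * x⁻¹ ∈ Z := by
      intro x
      rw [Subgroup.mem_comap, Subgroup.mem_centralizer_singleton_iff, ← QuotientGroup.eq_one_iff]
      change ((x : G ⧸ Z) * w = w * x) ↔ ((w : G ⧸ Z) * x * (w : G ⧸ Z)⁻¹ * (x : G ⧸ Z)⁻¹ = 1)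
      rw [mul_inv_eq_one, mul_inv_eq_iff_eq_mul, eq_comm]
    have hCcl : IsClosed (C : Set G) := by
      have : (C : Set G) = (fun x => w * x * w⁻¹ * x⁻¹) ⁻¹' Z := Set.ext hC
      rw [this]
      exact isClosed_center.preimage (by fun_prop)
    -- It suffices to treat inverted `x`, as they generate topologically. Modulo the centre `σ`
    -- inverts both `w` and `x w x⁻¹`, while it sends the latter to `x⁻¹ σ(w) x`. Hence `w` commutes
    -- with `x²` modulo the centre, and with `x`, the square root of `x²` in the closed subgroup
    -- `C`.
    have htop : C = ⊤ := hG.eq_top_of_inverted_mem h2 hσ hCcl fun x hx => by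
      have h1 := hws _ (hUn.conj_mem w hw x)
      rw [map_mul, map_mul, map_inv, hx, inv_inv] at h1
      have h3 := hws w hw
      have h4 : x * x ∈ C := by
        rw [← inv_mem_iff, hC]
        have h5 := (inferInstance : Z.Normal).conj_mem _ h1 x⁻¹
        have h6 := Subgroup.mem_center_iff.1 (inv_mem h3)
        have h7 : w * (x * x)⁻¹ * w⁻¹ * (x * x)⁻¹⁻¹ =
            (x⁻¹ * (x * w * x⁻¹ * (x⁻¹ * σ.1 w * x)) * x⁻¹⁻¹) * (w * σ.1 w)⁻¹ := by
          rw [h6]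
          have h8 := h6 ((x * x)⁻¹⁻¹)
          calc w * (x * x)⁻¹ * w⁻¹ * (x * x)⁻¹⁻¹
              = (w * (x * x)⁻¹) * σ.1 w * ((w * σ.1 w)⁻¹ * (x * x)⁻¹⁻¹) := by group
            _ = (w * (x * x)⁻¹) * σ.1 w * (x * x)⁻¹⁻¹ * (w * σ.1 w)⁻¹ := by rw [← h8]; group
            _ = (w * σ.1 w)⁻¹ * ((w * (x * x)⁻¹) * σ.1 w * (x * x)⁻¹⁻¹) := h6 _
            _ = _ := by simp only [mul_assoc, mul_inv_rev, inv_inv, inv_mul_cancel_left]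
        rw [h7]
        exact mul_mem h5 (inv_mem h3)
      obtain ⟨y, hy, hyH⟩ := hG.exists_sqrt h2 (x * x)
      rw [← hG.sq_injective h2 hy]
      exact hyH C hCcl h4
    intro x
    rw [← hC, htop]
    exact Subgroup.mem_top x
  have hUfin : U.FiniteIndex :=
    @Subgroup.finiteIndex_of_finite_quotient _ _ _ (hG.finite_quotient hUo)
  have hle : U.map (QuotientGroup.mk' Z) ≤ Subgroup.center (G ⧸ Z) := by
    rintro _ ⟨w, hw, rfl⟩
    rw [Subgroup.mem_center_iff]
    intro q
    obtain ⟨x, rfl⟩ := QuotientGroup.mk_surjective q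
    have h1 := (QuotientGroup.eq_one_iff _).2 (hcent w hw x)
    change ((w : G ⧸ Z) * x * (w : G ⧸ Z)⁻¹ * (x : G ⧸ Z)⁻¹ = 1) at h1
    rw [mul_inv_eq_one, mul_inv_eq_iff_eq_mul] at h1
    exact h1.symm
  have h1 : (Subgroup.center (G ⧸ Z)).FiniteIndex := by
    have : (U.map (QuotientGroup.mk' Z)).FiniteIndex := by
      refine ⟨fun h0 => hUfin.index_ne_zero ?_⟩
      have := Subgroup.index_map_dvd U (f := QuotientGroup.mk' Z) (QuotientGroup.mk'_surjective Z)
      rw [h0] at this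
      exact Nat.eq_zero_of_zero_dvd this
    exact Subgroup.finiteIndex_of_le hle
  have h3 : T2Space (G ⧸ Z) := (hG.quotient Z isClosed_center).t2Space
  -- The finiteness criterion is used twice: for `G ⧸ Z`, whose centre contains the image of `U`,
  -- and then for `G` itself, whose centre now has finite index.
  have h4 : Finite (G ⧸ Z) := finite_of_finiteIndex_center (π := QuotientGroup.mk' Z)
    QuotientGroup.continuous_mk (QuotientGroup.mk'_surjective Z)
  have h5 : (Subgroup.center G).FiniteIndex := Subgroup.finiteIndex_of_finite_quotient
  exact finite_of_finiteIndex_center (π := MonoidHom.id G) continuous_id Function.surjective_id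

end InfiniteGroups

theorem exists_continuousMulEquiv_of_ker_eq {F A B : Type*} [Group F] [TopologicalSpace F]
    [CompactSpace F] [Group A] [TopologicalSpace A] [T2Space A] [Group B] [TopologicalSpace B]
    [T2Space B] {π : F →* A} {π' : F →* B} (hc : Continuous π) (hs : Function.Surjective π)
    (hc' : Continuous π') (hs' : Function.Surjective π') (h : π.ker = π'.ker) :
    ∃ e : A ≃ₜ* B, ∀ x, e (π x) = π' x := by
  obtain ⟨k, hk, hk'⟩ := exists_continuous_descent hc hs hc' fun x r hr => by
    rw [map_mul, (MonoidHom.mem_ker (f := π') (x := r)).1 (h ▸ hr), mul_one]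
  obtain ⟨l, hl, hl'⟩ := exists_continuous_descent hc' hs' hc fun x r hr => by
    rw [map_mul, (MonoidHom.mem_ker (f := π) (x := r)).1 (h ▸ hr), mul_one]
  refine ⟨{ toFun := k, invFun := l, left_inv := fun a => ?_, right_inv := fun b => ?_,
            map_mul' := fun a b => ?_, continuous_toFun := hk, continuous_invFun := hl }, hk'⟩
  · obtain ⟨x, rfl⟩ := hs a
    rw [hk', hl']
  · obtain ⟨x, rfl⟩ := hs' b
    rw [hl', hk']
  · obtain ⟨x, rfl⟩ := hs a
    obtain ⟨y, rfl⟩ := hs b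
    rw [← map_mul, hk', hk', hk', map_mul]

/-! ### Measurability of the set of presenting tuples -/

section PresentingTuples

variable {p g : ℕ} [hp : Fact p.Prime]

theorem FreeProP.isTopFG : IsTopFG (FreeProP p g) := by
  classical
  refine ⟨Finset.univ.image (FreeProP.gen p g), ?_⟩
  rw [Finset.coe_image, Finset.coe_univ, Set.image_univ]
  exact FreeProP.dense_closure_gen

theorem measurableSet_of_saturated {M : Subgroup (FreeProP p g)}
    (hM : IsOpen (M : Set (FreeProP p g))) {A : Set (Fin g → schurRelators p g)}
    (hA : ∀ v ∈ A, ∀ w : Fin g → schurRelators p g,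
      (∀ i, (v i : FreeProP p g)⁻¹ * w i ∈ M) → w ∈ A) : MeasurableSet A := by
  have : Finite (FreeProP p g ⧸ M) := M.quotient_finite_of_isOpen hM
  let f : (Fin g → schurRelators p g) → Fin g → FreeProP p g ⧸ M :=
    fun v i => ((v i : FreeProP p g) : FreeProP p g ⧸ M)
  have h : A = ⋃ c ∈ f '' A, ⋂ i, {v | f v i = c i} := by
    ext w
    simp only [Set.mem_iUnion, Set.mem_iInter, Set.mem_ofPred_eq]
    constructor
    · exact fun hw => ⟨f w, ⟨w, hw, rfl⟩, fun i => rfl⟩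
    · rintro ⟨_, ⟨v, hv, rfl⟩, hw⟩
      exact hA v hv w fun i => QuotientGroup.eq.1 (hw i).symm
  rw [h]
  refine (Set.toFinite (f '' A)).measurableSet_biUnion fun c _ => MeasurableSet.iInter fun i => ?_
  have hd : DiscreteTopology (FreeProP p g ⧸ M) := QuotientGroup.discreteTopology hM
  have h1 : IsOpen {x : FreeProP p g | (x : FreeProP p g ⧸ M) = c i} :=
    (isOpen_discrete {c i}).preimage continuous_quot_mk
  exact (measurable_subtype_coe.comp (measurable_pi_apply i)) h1.measurableSet

/-- In this form membership depends on `v` only through the images of the relators in symmetric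
groups on `m` letters, hence only on `v` modulo `finKer m F`. -/
theorem mem_finKer_presented {v : Fin g → schurRelators p g} {m : ℕ} {x : FreeProP p g} :
    presentedMk v x ∈ finKer m (PresentedGroupProP v) ↔
      ∀ h : FreeProP p g →* Equiv.Perm (Fin m), IsOpen (h.ker : Set (FreeProP p g)) →
        (∀ i, h (v i) = 1) → h x = 1 := by
  rw [mem_finKer]
  constructor
  · intro hx h ho hv
    have hle : relationSubgroup v ≤ h.ker :=
      relationSubgroup_le (Subgroup.isClosed_of_isOpen _ ho) hv
    refine hx (QuotientGroup.lift _ h hle) ?_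
    have : IsOpen ((fun y : FreeProP p g => (y : PresentedGroupProP v)) ⁻¹'
        (QuotientGroup.lift _ h hle).ker) := by
      exact ho
    exact isOpen_coinduced.2 this
  · intro hx h ho
    refine hx (h.comp (presentedMk v)) (ho.preimage (continuous_presentedMk v)) fun i => ?_
    have : presentedMk v (v i) = 1 :=
      (QuotientGroup.eq_one_iff _).2 (relator_mem_relationSubgroup v i)
    rw [MonoidHom.comp_apply, this, map_one]

variable {G : Type*} [Group G] [TopologicalSpace G]

/-- The tuple `y` induces an isomorphism between the largest quotients of `G` and of the group
presented by `v` which act faithfully on sets of `m` letters. -/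
def MatchesAt (hG : IsProP p G) (m : ℕ) (y : Fin g → G) (v : Fin g → schurRelators p g) : Prop :=
  (∀ x, FreeProP.lift hG y x ∈ finKer m G ↔ presentedMk v x ∈ finKer m (PresentedGroupProP v)) ∧
    ∀ z, ∃ x, (FreeProP.lift hG y x)⁻¹ * z ∈ finKer m G

theorem matchesAt_congr_left (hG : IsProP p G) (hfg : IsTopFG G) {m : ℕ} {y y' : Fin g → G}
    (h : ∀ i, (y i)⁻¹ * y' i ∈ finKer m G) {v : Fin g → schurRelators p g}
    (hy : MatchesAt hG m y v) : MatchesAt hG m y' v := by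
  have := hG.topologicalGroup
  have hd : DiscreteTopology (G ⧸ finKer m G) :=
    QuotientGroup.discreteTopology (isOpen_finKer hfg m)
  have key : (QuotientGroup.mk' (finKer m G)).comp (FreeProP.lift hG y) =
      (QuotientGroup.mk' (finKer m G)).comp (FreeProP.lift hG y') := by
    refine FreeProP.hom_ext (QuotientGroup.continuous_mk.comp (FreeProP.continuous_lift hG y))
      (QuotientGroup.continuous_mk.comp (FreeProP.continuous_lift hG y')) fun i => ?_
    rw [MonoidHom.comp_apply, MonoidHom.comp_apply, FreeProP.lift_gen, FreeProP.lift_gen]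
    exact QuotientGroup.eq.2 (h i)
  have key' : ∀ x, ((FreeProP.lift hG y x : G) : G ⧸ finKer m G) = (FreeProP.lift hG y' x : G) :=
    fun x => DFunLike.congr_fun key x
  refine ⟨fun x => ?_, fun z => ?_⟩
  · rw [← hy.1, ← QuotientGroup.eq_one_iff, ← QuotientGroup.eq_one_iff, key']
  · obtain ⟨x, hx⟩ := hy.2 z
    refine ⟨x, ?_⟩
    rw [← QuotientGroup.eq] at hx ⊢
    rw [← key', hx]

theorem matchesAt_congr_right (hG : IsProP p G) {m : ℕ} {y : Fin g → G}
    {v w : Fin g → schurRelators p g}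
    (h : ∀ i, (v i : FreeProP p g)⁻¹ * w i ∈ finKer m (FreeProP p g))
    (hy : MatchesAt hG m y v) : MatchesAt hG m y w := by
  refine ⟨fun x => ?_, hy.2⟩
  rw [hy.1, mem_finKer_presented, mem_finKer_presented]
  refine forall_congr' fun k => forall_congr' fun ho => ?_
  refine imp_congr_left (forall_congr' fun i => ?_)
  have := mem_finKer.1 (h i) k ho
  rw [map_mul, map_inv, inv_mul_eq_one] at this
  rw [this]

theorem presentingTuples_subset_matchesAt (hG : IsProP p G) {v : Fin g → schurRelators p g}
    (hv : v ∈ presentingTuples p g G) : ∃ y, ∀ m, MatchesAt hG m y v := by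
  obtain ⟨e⟩ := hv
  have := hG.t2Space
  let f : FreeProP p g →* G := (e : PresentedGroupProP v →* G).comp (presentedMk v)
  have hf : Continuous f := e.continuous.comp (continuous_presentedMk v)
  refine ⟨fun i => f (FreeProP.gen p g i), fun m => ?_⟩
  rw [MatchesAt, ← FreeProP.eq_lift hG hf]
  refine ⟨fun x => ⟨fun h => ?_, fun h => map_mem_finKer (f := (e : PresentedGroupProP v →* G))
    e.continuous h⟩, fun z => ?_⟩
  · have := map_mem_finKer (f := (e.symm : G →* PresentedGroupProP v)) e.symm.continuous h
    change e.symm (e (presentedMk v x)) ∈ _ at this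
    rwa [e.symm_apply_apply] at this
  · obtain ⟨x, hx⟩ := presentedMk_surjective v (e.symm z)
    refine ⟨x, ?_⟩
    have : f x = z := by
      change e (presentedMk v x) = z
      rw [hx, e.apply_symm_apply]
    rw [this, inv_mul_cancel]
    exact one_mem _

theorem mem_presentingTuples_of_matchesAt (hG : IsProP p G) {v : Fin g → schurRelators p g}
    {y : Fin g → G} (h : ∀ m, MatchesAt hG m y v) : v ∈ presentingTuples p g G := by
  have := hG.t2Space
  have := hG.compact
  have := hG.topologicalGroup
  have hs : Function.Surjective (FreeProP.lift hG y) := by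
    intro z
    have hcl : IsClosed (Set.range (FreeProP.lift hG y)) :=
      (isCompact_range (FreeProP.continuous_lift hG y)).isClosed
    refine hG.mem_of_forall_openNormal hcl fun U hU ho => ?_
    obtain ⟨n, hn⟩ := exists_finKer_le ho
    obtain ⟨x, hx⟩ := (h n).2 z
    exact ⟨_, ⟨x, rfl⟩, hn hx⟩
  obtain ⟨e, -⟩ := exists_continuousMulEquiv_of_ker_eq (continuous_presentedMk v)
    (presentedMk_surjective v) (FreeProP.continuous_lift hG y) hs (by
      ext x
      rw [MonoidHom.mem_ker, MonoidHom.mem_ker]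
      constructor
      · intro hx
        refine (hG.eq_of_forall_finKer fun m => ?_).symm
        rw [inv_one, one_mul, (h m).1, hx]
        exact one_mem _
      · intro hx
        refine ((isProP_presented v).eq_of_forall_finKer fun m => ?_).symm
        rw [inv_one, one_mul, ← (h m).1, hx]
        exact one_mem _)
  exact ⟨e⟩

/-- A compatible tuple for all levels comes from compactness of `G ^ g`: the tuples that match up to
level `n` form a decreasing sequence of closed sets. Each set on the right depends on `v` modulo an
open subgroup only. -/
theorem presentingTuples_eq_iInter (hG : IsProP p G) (hfg : IsTopFG G) :
    presentingTuples p g G = ⋂ n, {v | ∃ y, ∀ m ≤ n, MatchesAt hG m y v} := by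
  have := hG.topologicalGroup
  have := hG.compact
  refine Set.Subset.antisymm (fun v hv => ?_) fun v hv => ?_
  · obtain ⟨y, hy⟩ := presentingTuples_subset_matchesAt hG hv
    exact Set.mem_iInter.2 fun n => ⟨y, fun m _ => hy m⟩
  · rw [Set.mem_iInter] at hv
    have hcl : ∀ m, IsClosed {y | MatchesAt hG m y v} := by
      intro m
      rw [← isOpen_compl_iff, isOpen_iff_mem_nhds]
      intro y hy
      have ho : IsOpen {y' : Fin g → G | ∀ i, (y' i)⁻¹ * y i ∈ finKer m G} := by
        have : {y' : Fin g → G | ∀ i, (y' i)⁻¹ * y i ∈ finKer m G} =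
            ⋂ i, (fun y' : Fin g → G => (y' i)⁻¹ * y i) ⁻¹' (finKer m G) := by
          ext y'
          simp
        rw [this]
        exact isOpen_iInter_of_finite fun i => (isOpen_finKer hfg m).preimage (by fun_prop)
      refine Filter.mem_of_superset (ho.mem_nhds fun i => ?_) fun y' hy' h => hy ?_
      · rw [inv_mul_cancel]
        exact one_mem _
      · exact matchesAt_congr_left hG hfg hy' h
    obtain ⟨y, hy⟩ := IsCompact.nonempty_iInter_of_sequence_nonempty_isCompact_isClosed
      (fun n => {y | ∀ m ≤ n, MatchesAt hG m y v}) (fun n y hy m hm => hy m (hm.trans n.le_succ))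
      hv (IsClosed.isCompact (by simpa using hcl 0)) (fun n => by
        have : {y | ∀ m ≤ n, MatchesAt hG m y v} = ⋂ m, ⋂ _ : m ≤ n, {y | MatchesAt hG m y v} := by
          ext y
          simp
        rw [this]
        exact isClosed_iInter fun m => isClosed_iInter fun _ => hcl m)
    rw [Set.mem_iInter] at hy
    exact mem_presentingTuples_of_matchesAt hG fun m => hy m m le_rfl

theorem measurableSet_presentingTuples (hG : IsProP p G) (hfg : IsTopFG G) :
    MeasurableSet (presentingTuples p g G) := by
  rw [presentingTuples_eq_iInter hG hfg]
  refine MeasurableSet.iInter fun n => ?_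
  have ho : IsOpen ((⨅ m : Fin (n + 1), finKer m (FreeProP p g) : Subgroup (FreeProP p g)) :
      Set (FreeProP p g)) := by
    rw [Subgroup.coe_iInf]
    exact isOpen_iInter_of_finite fun m => isOpen_finKer FreeProP.isTopFG m
  refine measurableSet_of_saturated ho ?_
  rintro v ⟨y, hy⟩ w hw
  refine ⟨y, fun m hm => matchesAt_congr_right hG (fun i => ?_) (hy m hm)⟩
  exact Subgroup.mem_iInf.1 (hw i) ⟨m, by omega⟩

end PresentingTuples

/-! ### Generating tuples inverted by an involution -/

section EquivariantGenerators

variable {p g : ℕ} [hp : Fact p.Prime] {G : Type*} [Group G] [TopologicalSpace G]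

theorem FreeProP.lift_surjective (hG : IsProP p G) {y : Fin g → G}
    (hy : Dense (Subgroup.closure (Set.range y) : Set G)) :
    Function.Surjective (FreeProP.lift hG y) := by
  have := hG.t2Space
  have hcl : IsClosed ((FreeProP.lift hG y).range : Set G) := by
    rw [MonoidHom.coe_range]
    exact (isCompact_range (FreeProP.continuous_lift hG y)).isClosed
  have hle : Subgroup.closure (Set.range y) ≤ (FreeProP.lift hG y).range := by
    rw [Subgroup.closure_le]
    rintro _ ⟨i, rfl⟩
    exact ⟨FreeProP.gen p g i, FreeProP.lift_gen hG y i⟩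
  exact fun z => closure_minimal (SetLike.coe_subset_coe.2 hle) hcl (hy z)

theorem FreeProP.dense_closure_map_gen {f : FreeProP p g →* G} (hf : Continuous f)
    (hs : Function.Surjective f) :
    Dense (Subgroup.closure (Set.range fun i => f (FreeProP.gen p g i)) : Set G) := by
  have h := hs.denseRange.dense_image hf (FreeProP.dense_closure_gen (p := p) (g := g))
  rwa [← Subgroup.coe_map, MonoidHom.map_closure, ← Set.range_comp] at h

/-- The tuples of topological generators which are inverted by `σ`. -/
def invertedGenerators (g : ℕ) (σ : contAut G) : Set (Fin g → G) :=
  {y | (∀ i, σ.1 (y i) = (y i)⁻¹) ∧ Dense (Subgroup.closure (Set.range y) : Set G)}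

theorem lift_sig (hG : IsProP p G) {σ : contAut G} {y : Fin g → G}
    (hy : y ∈ invertedGenerators g σ) (x : FreeProP p g) :
    FreeProP.lift hG y (FreeProP.sig p g x) = σ.1 (FreeProP.lift hG y x) := by
  have := hG.t2Space
  exact FreeProP.map_sig (FreeProP.continuous_lift hG y) (σ := (σ.1 : G →* G)) σ.2.1
    (fun i => by rw [FreeProP.lift_gen]; exact hy.1 i) x

theorem map_gen_mem_invertedGenerators {σ : contAut G} {f : FreeProP p g →* G} (hf : Continuous f)
    (hs : Function.Surjective f) (hσ : ∀ x, f (FreeProP.sig p g x) = σ.1 (f x)) :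
    (fun i => f (FreeProP.gen p g i)) ∈ invertedGenerators g σ :=
  ⟨fun i => by rw [← hσ, FreeProP.sig_gen, map_inv], FreeProP.dense_closure_map_gen hf hs⟩

variable [IsTopologicalGroup G]

/-- An isomorphism carries the involution induced from `F` to some Schur involution of `G`. This is
conjugate to `σ`, and composing with a conjugating automorphism makes the presentation equivariant.
-/
theorem exists_equivariant_presentation (h2 : p ≠ 2) (hg : 1 ≤ g) (hG : IsProP p G)
    (hfg : IsTopFG G) {σ : contAut G} (hσ : IsSchurInvolution σ) {v : Fin g → schurRelators p g}
    (hv : v ∈ presentingTuples p g G) :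
    ∃ f : FreeProP p g →* G, Continuous f ∧ Function.Surjective f ∧
      f.ker = relationSubgroup v ∧ ∀ x, f (FreeProP.sig p g x) = σ.1 (f x) := by
  obtain ⟨e⟩ := hv
  have := hG.t2Space
  let f : FreeProP p g →* G := (e : PresentedGroupProP v →* G).comp (presentedMk v)
  have hf : Continuous f := e.continuous.comp (continuous_presentedMk v)
  have hs : Function.Surjective f := e.surjective.comp (presentedMk_surjective v)
  have hker : f.ker = relationSubgroup v := by
    rw [← ker_presentedMk]
    ext x
    change e (presentedMk v x) = 1 ↔ presentedMk v x = 1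
    exact map_eq_one_iff e e.injective
  obtain ⟨τ, hτ⟩ := exists_contAut_descent hf hs FreeProP.continuous_sig FreeProP.sig_sig
    fun x hx => by
      rw [hker] at hx ⊢
      exact sig_mem_relationSubgroup v hx
  have hτ' := isSchurInvolution_of_covered h2 hg hf hs
    (hker.le.trans (relationSubgroup_le_frattini v)) hτ
  obtain ⟨ρ, hρ⟩ := hG.exists_conj_involution hfg h2 hσ hτ'
  refine ⟨(ρ.1 : G →* G).comp f, ρ.2.1.comp hf, ρ.1.surjective.comp hs, ?_, fun x => ?_⟩
  · rw [← hker]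
    ext x
    change ρ.1 (f x) = 1 ↔ f x = 1
    exact map_eq_one_iff ρ.1 ρ.1.injective
  · change ρ.1 (f (FreeProP.sig p g x)) = σ.1 (ρ.1 (f x))
    rw [← hτ]
    exact congrArg (fun α : contAut G => α.1 (f x)) hρ

/-- `Aut_σ(G)` acts simply transitively on the generating tuples inverted by `σ` with given
relations. -/
theorem nonempty_autSigma_equiv (h2 : p ≠ 2) (hg : 1 ≤ g) (hG : IsProP p G)
    (hfg : IsTopFG G) {σ : contAut G} (hσ : IsSchurInvolution σ) {v : Fin g → schurRelators p g}
    (hv : v ∈ presentingTuples p g G) :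
    Nonempty (autSigma σ ≃
      {y // y ∈ invertedGenerators g σ ∧ relationSubgroup v = (FreeProP.lift hG y).ker}) := by
  have := hG.t2Space
  obtain ⟨f, hf, hs, hker, hfσ⟩ := exists_equivariant_presentation h2 hg hG hfg hσ hv
  have hcomm : ∀ (α : autSigma σ) (x : G), α.1.1 (σ.1 x) = σ.1 (α.1.1 x) := fun α x =>
    congrArg (fun β : contAut G => β.1 x) (Subgroup.mem_centralizer_singleton_iff.1 α.2)
  let F : autSigma σ → FreeProP p g →* G := fun α => (α.1.1 : G →* G).comp f
  have hF : ∀ α, Continuous (F α) := fun α => α.1.2.1.comp hf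
  have hFs : ∀ α, Function.Surjective (F α) := fun α => α.1.1.surjective.comp hs
  let Φ : autSigma σ → {y // y ∈ invertedGenerators g σ ∧
      relationSubgroup v = (FreeProP.lift hG y).ker} := fun α =>
    ⟨fun i => F α (FreeProP.gen p g i),
      map_gen_mem_invertedGenerators (hF α) (hFs α) fun x => by
        change α.1.1 (f _) = σ.1 (α.1.1 (f x))
        rw [hfσ, hcomm], by
      rw [← FreeProP.eq_lift hG (hF α), ← hker]
      ext x
      change f x = 1 ↔ α.1.1 (f x) = 1
      exact (map_eq_one_iff α.1.1 α.1.1.injective).symm⟩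
  refine ⟨Equiv.ofBijective Φ ⟨fun α β h => ?_, fun y => ?_⟩⟩
  · have h1 : F α = F β := FreeProP.hom_ext (hF α) (hF β) fun i =>
      congrFun (congrArg Subtype.val h) i
    refine Subtype.ext (Subtype.ext (MulEquiv.ext fun z => ?_))
    obtain ⟨x, rfl⟩ := hs z
    exact DFunLike.congr_fun h1 x
  · have hys := FreeProP.lift_surjective hG y.2.1.2
    obtain ⟨e, he⟩ := exists_continuousMulEquiv_of_ker_eq hf hs (FreeProP.continuous_lift hG y.1)
      hys (hker.trans y.2.2)
    -- Two presentations with the same kernel differ by an automorphism, which commutes with `σ`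
    -- because both are equivariant.
    let α : contAut G := ⟨e.toMulEquiv, e.continuous, e.symm.continuous⟩
    have hα : α ∈ autSigma σ := by
      rw [autSigma, Subgroup.mem_centralizer_singleton_iff]
      refine Subtype.ext (MulEquiv.ext fun z => ?_)
      obtain ⟨x, rfl⟩ := hs z
      change e (σ.1 (f x)) = σ.1 (e (f x))
      rw [← hfσ, he, he, lift_sig hG y.2.1]
    refine ⟨⟨α, hα⟩, Subtype.ext (funext fun i => ?_)⟩
    change e (f (FreeProP.gen p g i)) = y.1 i
    rw [he, FreeProP.lift_gen]

theorem mem_presentingTuples_of_ker_eq (hG : IsProP p G) {σ : contAut G} {y : Fin g → G}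
    (hy : y ∈ invertedGenerators g σ) {v : Fin g → schurRelators p g}
    (h : relationSubgroup v = (FreeProP.lift hG y).ker) : v ∈ presentingTuples p g G := by
  have := hG.t2Space
  obtain ⟨e, -⟩ := exists_continuousMulEquiv_of_ker_eq (continuous_presentedMk v)
    (presentedMk_surjective v) (FreeProP.continuous_lift hG y)
    (FreeProP.lift_surjective hG hy.2) ((ker_presentedMk v).trans h)
  exact ⟨e⟩

end EquivariantGenerators

/-! ### Counting inverted elements -/

section InvertedElements

variable {p g : ℕ} [hp : Fact p.Prime]

/-- For a lift `x` of `d`, the inverted root of `x σ(x)⁻¹` maps to the square root of `d²`, which is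
`d`. -/
theorem exists_inverted_preimage (h2 : p ≠ 2) {D : Type*} [Group D] [TopologicalSpace D]
    (hD : IsProP p D) {σ : D →* D} {ψ : FreeProP p g →* D} (hψ : Function.Surjective ψ)
    (hσ : ∀ x, ψ (FreeProP.sig p g x) = σ (ψ x)) {d : D} (hd : σ d = d⁻¹) :
    ∃ z, FreeProP.sig p g z = z⁻¹ ∧ ψ z = d := by
  obtain ⟨x, rfl⟩ := hψ d
  obtain ⟨z, hz, hz', -⟩ := FreeProP.isProP.exists_inverted h2 (σ := FreeProP.sig p g)
    FreeProP.sig_sig x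
  refine ⟨z, hz', hD.sq_injective h2 ?_⟩
  rw [← map_mul, hz, map_mul, map_inv, hσ, hd, inv_inv]

theorem basis_forall_eq_zero_iff {S : Type*} {n : ℕ} {W : Submodule (ZMod p) (S → ZMod p)}
    (b : Module.Basis (Fin n) (ZMod p) W) (x : S) :
    (∀ j, (b j).1 x = 0) ↔ ∀ χ ∈ W, χ x = 0 := by
  refine ⟨fun h χ hχ => ?_, fun h j => h _ (b j).2⟩
  have h1 := congrArg Subtype.val (b.sum_repr ⟨χ, hχ⟩)
  have h3 := congrFun h1 x
  simp only [Submodule.coe_sum, Submodule.coe_smul, Finset.sum_apply, Pi.smul_apply, h, smul_zero,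
    Finset.sum_const_zero] at h3
  exact h3.symm

theorem basis_linearIndependent_coe {S : Type*} {n : ℕ} {W : Submodule (ZMod p) (S → ZMod p)}
    (b : Module.Basis (Fin n) (ZMod p) W) :
    LinearIndependent (ZMod p) fun j => ((b j : W) : S → ZMod p) :=
  b.linearIndependent.map' W.subtype (Submodule.ker_subtype W)

/-! ### Inverted elements with prescribed values in the Frattini quotient -/

section Fibers

variable {G : Type*} [Group G] [TopologicalSpace G] {σ : G →* G} {n : ℕ}

/-- The elements inverted by `σ` on which the basis `b` of `H¹(G, ℤ/p)` takes the values `a`. -/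
def invertedFiber (σ : G →* G) (b : Module.Basis (Fin n) (ZMod p) (contH1 p G))
    (a : Fin n → ZMod p) : Set G :=
  {x | σ x = x⁻¹ ∧ ∀ j, (b j).1 x = a j}

variable (b : Module.Basis (Fin n) (ZMod p) (contH1 p G))

/-- For `r` with the values `a`, the root of `r σ(r)⁻¹` is inverted and has the values `(a + a) / 2
= a`. -/
theorem exists_mem_invertedFiber (h2 : p ≠ 2) (hG : IsProP p G) (hσ : ∀ x, σ (σ x) = x)
    (hχ : ∀ χ ∈ contH1 p G, ∀ x, χ (σ x) = -χ x) (a : Fin n → ZMod p) :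
    (invertedFiber σ b a).Nonempty := by
  obtain ⟨r, hr⟩ := exists_joint_value (fun j => (b j).2.2) (basis_linearIndependent_coe b) a
  obtain ⟨z, hz, hz', -⟩ := hG.exists_inverted h2 hσ r
  refine ⟨z, hz', fun j => ?_⟩
  have h3 : (b j).1 (z * z) = (b j).1 (r * (σ r)⁻¹) := congrArg _ hz
  rw [(b j).2.2, (b j).2.2, additive_inv (b j).2.2, hχ _ (b j).2, neg_neg, hr, ← two_mul,
    ← two_mul] at h3
  exact mul_left_cancel₀ (ZMod.two_ne_zero_of_odd_prime h2) h3

variable {b}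

theorem mul_mul_mem_invertedFiber {a c : Fin n → ZMod p} {z s : G} (hz : z ∈ invertedFiber σ b a)
    (hs : s ∈ invertedFiber σ b c) : z * s * z ∈ invertedFiber σ b (a + c + a) := by
  refine ⟨?_, fun j => ?_⟩
  · rw [map_mul, map_mul, hz.1, hs.1]
    group
  · rw [(b j).2.2, (b j).2.2, hz.2, hs.2]
    rfl

theorem inv_mem_invertedFiber {a : Fin n → ZMod p} {z : G} (hz : z ∈ invertedFiber σ b a) :
    z⁻¹ ∈ invertedFiber σ b (-a) :=
  ⟨by rw [map_inv, hz.1], fun j => by rw [additive_inv (b j).2.2, hz.2]; rfl⟩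

variable (b)

/-- Products of inverted elements need not be inverted, but `z s z` is. Taking `z` with values `a /
2` identifies the fibre over `0` with the fibre over `a`. -/
theorem exists_half_section (h2 : p ≠ 2) (hG : IsProP p G) (hσ : ∀ x, σ (σ x) = x)
    (hχ : ∀ χ ∈ contH1 p G, ∀ x, χ (σ x) = -χ x) :
    ∃ Z : (Fin n → ZMod p) → G,
      (∀ a, ∀ s ∈ invertedFiber σ b 0, Z a * s * Z a ∈ invertedFiber σ b a) ∧
        ∀ a, ∀ s ∈ invertedFiber σ b a, (Z a)⁻¹ * s * (Z a)⁻¹ ∈ invertedFiber σ b 0 := by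
  choose Z hZ using exists_mem_invertedFiber b h2 hG hσ hχ
  have hhalf : ∀ a : Fin n → ZMod p, (2 : ZMod p)⁻¹ • a + (2 : ZMod p)⁻¹ • a = a := by
    intro a
    rw [← two_smul (ZMod p), smul_inv_smul₀ (ZMod.two_ne_zero_of_odd_prime h2)]
  refine ⟨fun a => Z ((2 : ZMod p)⁻¹ • a), fun a s hs => ?_, fun a s hs => ?_⟩
  · have := mul_mul_mem_invertedFiber (hZ ((2 : ZMod p)⁻¹ • a)) hs
    rwa [add_zero, hhalf] at this
  · have := mul_mul_mem_invertedFiber (inv_mem_invertedFiber (hZ ((2 : ZMod p)⁻¹ • a))) hs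
    have h1 : -((2 : ZMod p)⁻¹ • a) + a + -((2 : ZMod p)⁻¹ • a) = 0 := by
      nth_rw 2 [← hhalf a]
      abel
    rwa [h1] at this

/-- The number of invertible `n × n` matrices over `ℤ/p`. -/
noncomputable def numInvertible (p n : ℕ) : ℕ :=
  Nat.card {A : Matrix (Fin n) (Fin n) (ZMod p) // A.det ≠ 0}

theorem numInvertible_pos (p n : ℕ) [Fact p.Prime] : 0 < numInvertible p n := by
  have : Nonempty {A : Matrix (Fin n) (Fin n) (ZMod p) // A.det ≠ 0} :=
    ⟨⟨1, by rw [Matrix.det_one]; exact one_ne_zero⟩⟩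
  exact Nat.card_pos

/-- An inverted tuple generates exactly when its matrix of values is invertible; for a given matrix
each entry ranges over a fibre, and all fibres have the size of the one over `0`. -/
theorem ncard_invertedGenerators (h2 : p ≠ 2) (hG : IsProP p G)
    (b : Module.Basis (Fin g) (ZMod p) (contH1 p G)) {σ : contAut G}
    (hσ : ∀ x, σ.1 (σ.1 x) = x) (hχ : ∀ χ ∈ contH1 p G, ∀ x, χ (σ.1 x) = -χ x) :
    (invertedGenerators g σ).ncard =
      numInvertible p g * (invertedFiber (σ.1 : G →* G) b 0).ncard ^ g := by
  have := hG.topologicalGroup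
  obtain ⟨Z, hZ, hZ'⟩ := exists_half_section b h2 hG (σ := (σ.1 : G →* G)) hσ hχ
  let f : {A : Matrix (Fin g) (Fin g) (ZMod p) // A.det ≠ 0} ×
      (Fin g → invertedFiber (σ.1 : G →* G) b 0) → invertedGenerators g σ := fun q =>
    ⟨fun i => Z (q.1.1 i) * (q.2 i).1 * Z (q.1.1 i), fun i => (hZ _ _ (q.2 i).2).1, by
      rw [dense_closure_iff_separating hG b]
      convert q.1.2 using 2
      ext i j
      exact (hZ _ _ (q.2 i).2).2 j⟩
  have hf : Function.Bijective f := by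
    constructor
    · rintro ⟨A, s⟩ ⟨B, t⟩ h
      have h1 : ∀ i, Z (A.1 i) * (s i).1 * Z (A.1 i) = Z (B.1 i) * (t i).1 * Z (B.1 i) := fun i =>
        congrFun (congrArg Subtype.val h) i
      have h3 : A = B := by
        refine Subtype.ext (Matrix.ext fun i j => ?_)
        exact ((hZ (A.1 i) _ (s i).2).2 j).symm.trans
          ((congrArg (b j).1 (h1 i)).trans ((hZ (B.1 i) _ (t i).2).2 j))
      subst h3
      refine Prod.ext rfl (funext fun i => Subtype.ext ?_)
      exact mul_left_cancel (mul_right_cancel (h1 i))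
    · rintro ⟨y, hy1, hy2⟩
      rw [dense_closure_iff_separating hG b] at hy2
      have hy3 : ∀ i, y i ∈ invertedFiber (σ.1 : G →* G) b fun j => (b j).1 (y i) :=
        fun i => ⟨hy1 i, fun j => rfl⟩
      refine ⟨⟨⟨_, hy2⟩, fun i => ⟨_, hZ' _ _ (hy3 i)⟩⟩, Subtype.ext (funext fun i => ?_)⟩
      change Z (fun j => (b j).1 (y i)) * (_ * y i * _) * Z (fun j => (b j).1 (y i)) = y i
      group
  rw [← Nat.card_coe_set_eq, ← Nat.card_congr (Equiv.ofBijective f hf), Nat.card_prod,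
    Nat.card_fun, Nat.card_eq_fintype_card (α := Fin g), Fintype.card_fin, Nat.card_coe_set_eq]
  rfl

end Fibers

theorem exists_basis_contH1 {G : Type*} [Group G] [TopologicalSpace G] (hg : 1 ≤ g)
    (hG : genRank p G = g) : Nonempty (Module.Basis (Fin g) (ZMod p) (contH1 p G)) := by
  have : Module.Finite (ZMod p) (contH1 p G) :=
    Module.finite_of_finrank_pos (by rw [genRank] at hG; omega)
  exact ⟨Module.finBasisOfFinrankEq _ _ hG⟩

theorem invertedFiber_zero_freeProP (h2 : p ≠ 2)
    (b : Module.Basis (Fin g) (ZMod p) (contH1 p (FreeProP p g))) :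
    invertedFiber (FreeProP.sig p g) b 0 = schurRelators p g := by
  ext x
  rw [FreeProP.mem_schurRelators_iff h2, FreeProP.isProP.mem_frattiniProP_iff,
    ← basis_forall_eq_zero_iff b, and_comm]
  rfl

/-- Inverted elements lift to inverted elements, and by equality of generator ranks every character
of `F` is inflated from `G`, so the lift of an element of `Φ(G)` lies in `Φ(F)`. -/
theorem image_schurRelators (h2 : p ≠ 2) {G : Type*} [Group G] [TopologicalSpace G]
    (hG : IsProP p G) (hgen : genRank p G = g) {σ : G →* G} {π : FreeProP p g →* G}
    (hc : Continuous π) (hs : Function.Surjective π)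
    (hσ : ∀ x, π (FreeProP.sig p g x) = σ (π x))
    (b : Module.Basis (Fin g) (ZMod p) (contH1 p G)) :
    π '' schurRelators p g = invertedFiber σ b 0 := by
  have := hG.t2Space
  ext d
  constructor
  · rintro ⟨s, hs', rfl⟩
    refine ⟨by rw [← hσ, FreeProP.sig_relator hs', map_inv], fun j => ?_⟩
    exact eq_zero_of_mem_frattiniProP (FreeProP.relator_mem_frattini hs')
      (contH1Infl p π hc (b j)).2
  · rintro ⟨h1, h3⟩
    obtain ⟨z, hz, rfl⟩ := exists_inverted_preimage h2 hG hs hσ h1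
    refine ⟨z, ?_, rfl⟩
    rw [FreeProP.mem_schurRelators_iff h2, FreeProP.isProP.mem_frattiniProP_iff]
    refine ⟨fun χ hχ => ?_, hz⟩
    obtain ⟨ψ, hψ⟩ := FreeProP.contH1Infl_surjective hc hs hgen ⟨χ, hχ⟩
    have h4 : ψ.1 (π z) = χ z := congrFun (congrArg Subtype.val hψ) z
    rw [← h4]
    exact (basis_forall_eq_zero_iff b _).1 h3 _ ψ.2

/-- Each inverted element lifts to some `z s z` with `s` a relator and at most `p ^ g` choices of
`z`. No condition on the generator rank of `D` enters, so only an inequality results. -/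
theorem ncard_inverted_le (h2 : p ≠ 2) (hg : 1 ≤ g) {D : Type*} [Group D] [TopologicalSpace D]
    [Finite D] (hD : IsProP p D) {σ : D →* D} {ψ : FreeProP p g →* D}
    (hψ : Function.Surjective ψ) (hσ : ∀ x, ψ (FreeProP.sig p g x) = σ (ψ x)) :
    {d | σ d = d⁻¹}.ncard ≤ p ^ g * (ψ '' schurRelators p g).ncard := by
  obtain ⟨b⟩ := exists_basis_contH1 hg (FreeProP.genRank_eq (p := p) (g := g))
  obtain ⟨Z, -, hZ'⟩ := exists_half_section b h2 FreeProP.isProP (σ := FreeProP.sig p g)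
    FreeProP.sig_sig fun χ hχ => FreeProP.additive_sig hχ.2 hχ.1
  let f : (Fin g → ZMod p) × (ψ '' schurRelators p g) → D := fun q =>
    ψ (Z q.1) * q.2.1 * ψ (Z q.1)
  have hsub : {d | σ d = d⁻¹} ⊆ Set.range f := by
    intro d hd
    obtain ⟨z, hz, rfl⟩ := exists_inverted_preimage h2 hD hψ hσ hd
    have h1 := hZ' (fun j => (b j).1 z) z ⟨hz, fun j => rfl⟩
    rw [invertedFiber_zero_freeProP h2] at h1
    refine ⟨⟨fun j => (b j).1 z, ⟨_, _, h1, rfl⟩⟩, ?_⟩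
    change ψ (Z _) * ψ _ * ψ (Z _) = ψ z
    rw [← map_mul, ← map_mul]
    congr 1
    group
  calc _ ≤ (Set.range f).ncard := Set.ncard_le_ncard hsub
    _ ≤ Nat.card ((Fin g → ZMod p) × (ψ '' schurRelators p g)) := by
      rw [← Nat.card_coe_set_eq]
      exact Finite.card_range_le f
    _ = _ := by
      rw [Nat.card_prod, Nat.card_fun, Nat.card_zmod, Nat.card_eq_fintype_card (α := Fin g),
        Fintype.card_fin, Nat.card_coe_set_eq]

end InvertedElements

/-! ### The mass of finite Schur `σ`-groups -/

section MassFormula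

variable {p g : ℕ} [hp : Fact p.Prime]

/-- The relators in `R` on which the basis `b` of invariant homomorphisms takes the values `a`. -/
def relatorFiber {R : Subgroup (FreeProP p g)} [R.Normal] {n : ℕ}
    (b : Module.Basis (Fin n) (ZMod p) (invHom p R)) (a : Fin n → ZMod p) :
    Set (schurRelators p g) :=
  {x | ∃ h : (x : FreeProP p g) ∈ R, ∀ j, (b j).1 ⟨x, h⟩ = a j}

/-! ### Distribution of random relators under invariant homomorphisms -/

section Fiber

variable {R : Subgroup (FreeProP p g)} [R.Normal] {n : ℕ}
  (b : Module.Basis (Fin n) (ZMod p) (invHom p R))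

theorem measurableSet_relatorFiber (hR : IsOpen (R : Set (FreeProP p g))) (a : Fin n → ZMod p) :
    MeasurableSet (relatorFiber b a) := by
  have h1 : IsOpen {r : R | ∀ j, (b j).1 r = a j} := by
    have : {r : R | ∀ j, (b j).1 r = a j} = ⋂ j, (b j).1 ⁻¹' {a j} := by
      ext r
      simp
    rw [this]
    exact isOpen_iInter_of_finite fun j => (isOpen_discrete _).preimage (b j).2.1
  have h3 := hR.isOpenMap_subtype_val _ h1
  have h4 : relatorFiber b a = Subtype.val ⁻¹' (Subtype.val '' {r : R | ∀ j, (b j).1 r = a j}) := by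
    ext x
    constructor
    · rintro ⟨h, hx⟩
      exact ⟨⟨x, h⟩, hx, rfl⟩
    · rintro ⟨r, hr, hrx⟩
      have h5 : (x : FreeProP p g) ∈ R := hrx ▸ r.2
      refine ⟨h5, ?_⟩
      have : (⟨x, h5⟩ : R) = r := Subtype.ext hrx.symm
      rw [this]
      exact hr
  rw [h4]
  exact measurable_subtype_coe h3.measurableSet

/-- Because `σ` negates the invariant homomorphisms, the inverted root of `r σ(r)⁻¹` has the same
values as `r`. -/
theorem exists_relator_value (h2 : p ≠ 2) (hRc : IsClosed (R : Set (FreeProP p g)))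
    (hRF : R ≤ frattiniProP p (FreeProP p g)) (hRs : ∀ x ∈ R, FreeProP.sig p g x ∈ R)
    (hχ : ∀ χ ∈ invHom p R, ∀ r : R, χ ⟨FreeProP.sig p g r, hRs r r.2⟩ = -χ r)
    (a : Fin n → ZMod p) : (relatorFiber b a).Nonempty := by
  obtain ⟨r, hr⟩ := exists_joint_value (fun j => (b j).2.2.1) (basis_linearIndependent_coe b) a
  obtain ⟨z, hz, hz', hzR⟩ := FreeProP.isProP.exists_inverted h2 (σ := FreeProP.sig p g)
    FreeProP.sig_sig (r : FreeProP p g)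
  have hzR' : z ∈ R := hzR R hRc r.2 (hRs r r.2)
  refine ⟨⟨z, (FreeProP.mem_schurRelators_iff h2).2 ⟨hRF hzR', hz'⟩⟩, hzR', fun j => ?_⟩
  have hadd := (b j).2.2.1
  have h3 : (b j).1 (⟨z, hzR'⟩ * ⟨z, hzR'⟩) =
      (b j).1 (r * ⟨FreeProP.sig p g r, hRs r r.2⟩⁻¹) := congrArg _ (Subtype.ext hz)
  rw [hadd, hadd, additive_inv hadd, hχ _ (b j).2, neg_neg, hr, ← two_mul, ← two_mul] at h3
  exact mul_left_cancel₀ (ZMod.two_ne_zero_of_odd_prime h2) h3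

/-- Translate by a parameter `t₀` whose relator has the values `a`: conjugation does not change
invariant homomorphisms, so all values are shifted by `a`. -/
theorem relatorMeasure_relatorFiber_eq (hR : IsOpen (R : Set (FreeProP p g)))
    {a : Fin n → ZMod p} (ha : (relatorFiber b a).Nonempty) :
    relatorMeasure p g (relatorFiber b 0) = relatorMeasure p g (relatorFiber b a) := by
  obtain ⟨r₀, hr₀, hr₀a⟩ := ha
  obtain ⟨t₀, rfl⟩ := toRelator_surjective r₀
  refine relatorMeasure_eq_of_translate (measurableSet_relatorFiber b hR 0)
    (measurableSet_relatorFiber b hR a) t₀ fun t => ?_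
  have hRn : R.Normal := inferInstance
  have hmem : ((toRelator p g t : FreeProP p g) ∈ R) ↔
      (toRelator p g (t * t₀) : FreeProP p g) ∈ R := by
    rw [coe_toRelator_mul, Subgroup.mul_mem_cancel_right R hr₀]
    have := hRn.mem_comm_iff (a := (t₀ : FreeProP p g)⁻¹ * toRelator p g t)
      (b := (t₀ : FreeProP p g))
    rw [this, mul_inv_cancel_left]
  have hval : ∀ (h : (toRelator p g t : FreeProP p g) ∈ R)
      (h' : (toRelator p g (t * t₀) : FreeProP p g) ∈ R) j,
      (b j).1 ⟨_, h'⟩ = (b j).1 ⟨_, h⟩ + a j := by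
    intro h h' j
    have h3 : (t₀ : FreeProP p g)⁻¹ * toRelator p g t * (t₀ : FreeProP p g) ∈ R := by
      have := hRn.conj_mem _ h (t₀ : FreeProP p g)⁻¹
      rwa [inv_inv] at this
    have h4 : (⟨_, h'⟩ : R) = ⟨_, h3⟩ * ⟨_, hr₀⟩ := Subtype.ext (coe_toRelator_mul t t₀)
    rw [h4, (b j).2.2.1, hr₀a]
    congr 1
    exact (b j).2.2.2 (t₀ : FreeProP p g)⁻¹ ⟨_, h⟩ ⟨_, h3⟩ (by rw [inv_inv])
  constructor
  · rintro ⟨h, hx⟩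
    refine ⟨hmem.1 h, fun j => ?_⟩
    rw [hval h, hx, Pi.zero_apply, zero_add]
  · rintro ⟨h, hx⟩
    refine ⟨hmem.2 h, fun j => ?_⟩
    have := hx j
    rw [hval (hmem.2 h)] at this
    simpa using this

theorem relatorMeasure_relatorFiber (hR : IsOpen (R : Set (FreeProP p g)))
    (hne : ∀ a, (relatorFiber b a).Nonempty) (a : Fin n → ZMod p) :
    ((p ^ n : ℕ) : ℝ≥0∞) * relatorMeasure p g (relatorFiber b a) =
      relatorMeasure p g {x | (x : FreeProP p g) ∈ R} := by
  have h : {x : schurRelators p g | (x : FreeProP p g) ∈ R} = ⋃ a, relatorFiber b a := by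
    ext x
    simp only [Set.mem_iUnion]
    exact ⟨fun h => ⟨fun j => (b j).1 ⟨x, h⟩, h, fun j => rfl⟩, fun ⟨a, h, _⟩ => h⟩
  rw [h, measure_iUnion (fun a c hac => Set.disjoint_left.2 ?_)
    (measurableSet_relatorFiber b hR), tsum_fintype]
  · simp_rw [← fun c => relatorMeasure_relatorFiber_eq b hR (hne c)]
    rw [Finset.sum_const, Finset.card_univ, nsmul_eq_mul, Fintype.card_fun, ZMod.card,
      Fintype.card_fin]
  · rintro x ⟨h, hx⟩ ⟨h', hx'⟩
    exact hac (funext fun j => (hx j).symm.trans (hx' j))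

theorem relationSubgroup_eq_iff (hRc : IsClosed (R : Set (FreeProP p g)))
    (b : Module.Basis (Fin g) (ZMod p) (invHom p R)) (v : Fin g → schurRelators p g) :
    relationSubgroup v = R ↔
      ∃ A : {A : Matrix (Fin g) (Fin g) (ZMod p) // A.det ≠ 0}, ∀ i, v i ∈ relatorFiber b (A.1 i) := by
  constructor
  · intro h
    have hv : ∀ i, (v i : FreeProP p g) ∈ R := fun i => h ▸ relator_mem_relationSubgroup v i
    exact ⟨⟨_, (closedNormalClosure_eq_iff FreeProP.isProP hRc b fun i => ⟨v i, hv i⟩).1 h⟩,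
      fun i => ⟨hv i, fun j => rfl⟩⟩
  · rintro ⟨A, hA⟩
    choose hv hA using hA
    refine (closedNormalClosure_eq_iff FreeProP.isProP hRc b fun i => ⟨v i, hv i⟩).2 ?_
    convert A.2 using 2
    ext i j
    exact hA i j

theorem measurableSet_relationSubgroup_eq (hR : IsOpen (R : Set (FreeProP p g)))
    (b : Module.Basis (Fin g) (ZMod p) (invHom p R)) :
    MeasurableSet {v : Fin g → schurRelators p g | relationSubgroup v = R} := by
  have h : {v : Fin g → schurRelators p g | relationSubgroup v = R} =
      ⋃ A : {A : Matrix (Fin g) (Fin g) (ZMod p) // A.det ≠ 0},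
        ⋂ i, (fun v => v i) ⁻¹' relatorFiber b (A.1 i) := by
    ext v
    simp only [Set.mem_ofPred_eq, Set.mem_iUnion, Set.mem_iInter, Set.mem_preimage]
    exact relationSubgroup_eq_iff (Subgroup.isClosed_of_isOpen R hR) b v
  rw [h]
  exact MeasurableSet.iUnion fun A => MeasurableSet.iInter fun i =>
    measurable_pi_apply i (measurableSet_relatorFiber b hR _)

/-- The event is the disjoint union, over invertible matrices of values, of products of `g` fibres,
and each of the `p ^ g` fibres has an equal share of the relators in `R`. -/
theorem relatorTupleMeasure_relationSubgroup_eq (hR : IsOpen (R : Set (FreeProP p g)))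
    (b : Module.Basis (Fin g) (ZMod p) (invHom p R)) (hne : ∀ a, (relatorFiber b a).Nonempty) :
    relatorTupleMeasure p g {v | relationSubgroup v = R} =
      numInvertible p g * (((p ^ g : ℕ) : ℝ≥0∞)⁻¹ *
        relatorMeasure p g {x | (x : FreeProP p g) ∈ R}) ^ g := by
  have h : {v : Fin g → schurRelators p g | relationSubgroup v = R} =
      ⋃ A : {A : Matrix (Fin g) (Fin g) (ZMod p) // A.det ≠ 0},
        {v | ∀ i, v i ∈ relatorFiber b (A.1 i)} := by
    ext v
    simp only [Set.mem_ofPred_eq, Set.mem_iUnion]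
    exact relationSubgroup_eq_iff (Subgroup.isClosed_of_isOpen R hR) b v
  have hp0 : ((p ^ g : ℕ) : ℝ≥0∞) ≠ 0 := by
    exact_mod_cast pow_ne_zero g hp.out.ne_zero
  have hd : ∀ a, relatorMeasure p g (relatorFiber b a) = ((p ^ g : ℕ) : ℝ≥0∞)⁻¹ *
      relatorMeasure p g {x | (x : FreeProP p g) ∈ R} := by
    intro a
    rw [← relatorMeasure_relatorFiber b hR hne a, ← mul_assoc,
      ENNReal.inv_mul_cancel hp0 (ENNReal.natCast_ne_top _), one_mul]
  rw [h, measure_iUnion (fun A B hAB => Set.disjoint_left.2 ?_) fun A => ?_, tsum_fintype]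
  · simp_rw [relatorTupleMeasure_forall, hd]
    rw [Finset.sum_const, Finset.prod_const, Finset.card_univ, Finset.card_univ, nsmul_eq_mul,
      Fintype.card_fin, numInvertible, Nat.card_eq_fintype_card]
  · intro v hv hv'
    refine hAB (Subtype.ext (Matrix.ext fun i j => ?_))
    obtain ⟨h1, h3⟩ := hv i
    obtain ⟨h4, h5⟩ := hv' i
    exact (h3 j).symm.trans (h5 j)
  · have : {v : Fin g → schurRelators p g | ∀ i, v i ∈ relatorFiber b (A.1 i)} =
        ⋂ i, (fun v => v i) ⁻¹' relatorFiber b (A.1 i) := by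
      ext v
      simp
    rw [this]
    exact MeasurableSet.iInter fun i => measurable_pi_apply i (measurableSet_relatorFiber b hR _)

end Fiber

/-- The constant of proportionality between `Meas(G)` and `1 / |Aut_σ(G)|`. -/
noncomputable def massConst (p g : ℕ) : ℝ≥0∞ :=
  numInvertible p g * numInvertible p g * (((p ^ g : ℕ) : ℝ≥0∞)⁻¹) ^ g

theorem massConst_ne_zero : massConst p g ≠ 0 := by
  have h := (numInvertible_pos p g).ne'
  refine mul_ne_zero (mul_ne_zero ?_ ?_) (pow_ne_zero _ ?_)
  · exact_mod_cast h
  · exact_mod_cast h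
  · exact ENNReal.inv_ne_zero.2 (ENNReal.natCast_ne_top _)

theorem massConst_ne_top : massConst p g ≠ ∞ := by
  refine ENNReal.mul_ne_top (ENNReal.mul_ne_top (ENNReal.natCast_ne_top _)
    (ENNReal.natCast_ne_top _)) (ENNReal.pow_ne_top (ENNReal.inv_ne_top.2 ?_))
  exact_mod_cast pow_ne_zero g hp.out.ne_zero

variable {G : Type*} [Group G] [TopologicalSpace G] [IsTopologicalGroup G]

/-- A random relator is uniform on the inverted elements of `Φ(G)`, so it lies in the kernel with
probability the inverse of their number. The relation rank provides `g` independent invariant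
homomorphisms. -/
theorem IsSchurSigma.measure_ker_eq (h2 : p ≠ 2) (hg : 1 ≤ g) (hG : IsSchurSigma p g G)
    [Finite G] {σ : contAut G}
    (b : Module.Basis (Fin g) (ZMod p) (contH1 p G)) {y : Fin g → G}
    (hy : y ∈ invertedGenerators g σ) :
    MeasurableSet {v : Fin g → schurRelators p g |
        relationSubgroup v = (FreeProP.lift hG.proP y).ker} ∧
      relatorTupleMeasure p g {v | relationSubgroup v = (FreeProP.lift hG.proP y).ker} =
        numInvertible p g * (((p ^ g : ℕ) : ℝ≥0∞)⁻¹ *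
          ((invertedFiber (σ.1 : G →* G) b 0).ncard : ℝ≥0∞)⁻¹) ^ g := by
  have := hG.proP.t2Space
  have := hG.finite_ab
  have hd : DiscreteTopology G := inferInstance
  set π := FreeProP.lift hG.proP y with hπ
  have hc : Continuous π := FreeProP.continuous_lift hG.proP y
  have hs : Function.Surjective π := FreeProP.lift_surjective hG.proP hy.2
  have hsig : ∀ x, π (FreeProP.sig p g x) = σ.1 (π x) := lift_sig hG.proP hy
  have hker := FreeProP.ker_le_frattini hc hs hG.genRank_eq
  have hR : IsOpen (π.ker : Set (FreeProP p g)) := (isOpen_discrete {(1 : G)}).preimage hc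
  have hRs : ∀ x ∈ π.ker, FreeProP.sig p g x ∈ π.ker := fun x hx => by
    rw [MonoidHom.mem_ker] at hx ⊢
    rw [hsig, hx, map_one]
  have hdim : Module.finrank (ZMod p) (invHom p π.ker) = g := by
    rw [← FreeProP.relRank_eq_finrank_invHom hG.proP hc hs hker, hG.relRank_eq]
  have hfin : Module.Finite (ZMod p) (invHom p π.ker) :=
    Module.finite_of_finrank_pos (by omega)
  let c := Module.finBasisOfFinrankEq _ _ hdim
  refine ⟨measurableSet_relationSubgroup_eq hR c, ?_⟩
  rw [relatorTupleMeasure_relationSubgroup_eq hR c fun a =>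
    exists_relator_value c h2 (FreeProP.isClosed_ker hc) hker hRs
      (fun χ hχ r => FreeProP.invHom_sig hc hs hRs hdim hχ r) a]
  have h1 := image_schurRelators h2 hG.proP hG.genRank_eq (σ := (σ.1 : G →* G)) hc hs hsig b
  have h3 : relatorMeasure p g {x | π x = 1} = ((π '' schurRelators p g).ncard : ℝ≥0∞)⁻¹ :=
    relatorMeasure_fiber hc (h1 ▸ ⟨map_one _ |>.trans inv_one.symm, fun j =>
      additive_one (b j).2.2⟩)
  rw [h1] at h3
  rw [← h3]
  rfl

/-- `Meas(G)` times `|Aut_σ(G)|`, for a finite Schur `σ`-group `G`. -/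
theorem IsSchurSigma.card_mul_meas (h2 : p ≠ 2) (hg : 1 ≤ g) (hG : IsSchurSigma p g G)
    [Finite G] {σ : contAut G} (hσ : IsSchurInvolution σ) :
    (Nat.card (autSigma σ) : ℝ≥0∞) * meas p g G = massConst p g := by
  classical
  have := hG.proP.t2Space
  obtain ⟨b⟩ := exists_basis_contH1 hg hG.genRank_eq
  let T : Finset (Fin g → G) := (Set.toFinite (invertedGenerators g σ)).toFinset
  have hT : ∀ y, y ∈ T ↔ y ∈ invertedGenerators g σ := fun y => Set.Finite.mem_toFinset _
  -- Double counting of pairs `(v, y)`: each `v` in `Y(G)` belongs to exactly `|Aut_σ(G)|` tuples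
  -- `y`.
  have h1 := mul_measure_eq_sum (relatorTupleMeasure p g) T
    (E := fun y => {v | relationSubgroup v = (FreeProP.lift hG.proP y).ker})
    (fun y hy => (hG.measure_ker_eq h2 hg b ((hT y).1 hy)).1)
    (measurableSet_presentingTuples hG.proP hG.topFG) (c := Nat.card (autSigma σ))
    (fun v hv => by
      obtain ⟨e⟩ := nonempty_autSigma_equiv h2 hg hG.proP hG.topFG hσ hv
      rw [Nat.card_congr e, ← Nat.card_eq_finsetCard]
      refine Nat.card_congr (Equiv.subtypeEquivRight fun y => ?_)
      rw [Finset.mem_filter, hT]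
      rfl)
    (fun y hy v hv => mem_presentingTuples_of_ker_eq hG.proP ((hT y).1 hy) hv)
  rw [meas, h1, Finset.sum_congr rfl fun y hy => (hG.measure_ker_eq h2 hg b ((hT y).1 hy)).2,
    Finset.sum_const, nsmul_eq_mul]
  have h3 : T.card = numInvertible p g * (invertedFiber (σ.1 : G →* G) b 0).ncard ^ g := by
    rw [← ncard_invertedGenerators h2 hG.proP b hσ.apply_apply fun χ hχ => hσ.additive hχ,
      Set.ncard_eq_toFinset_card _ (Set.toFinite _)]
  have h4 : ((invertedFiber (σ.1 : G →* G) b 0).ncard : ℝ≥0∞) ≠ 0 := by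
    have : (invertedFiber (σ.1 : G →* G) b 0).ncard ≠ 0 :=
      Set.ncard_ne_zero_of_mem (a := (1 : G))
        ⟨map_one _ |>.trans inv_one.symm, fun j => additive_one (b j).2.2⟩ (Set.toFinite _)
    exact_mod_cast this
  rw [h3, Nat.cast_mul, Nat.cast_pow, massConst, mul_pow]
  calc _ = (numInvertible p g * numInvertible p g * (((p ^ g : ℕ) : ℝ≥0∞)⁻¹) ^ g) *
        (((invertedFiber (σ.1 : G →* G) b 0).ncard : ℝ≥0∞) *
          ((invertedFiber (σ.1 : G →* G) b 0).ncard : ℝ≥0∞)⁻¹) ^ g := by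
        rw [mul_pow]
        ring
    _ = _ := by rw [ENNReal.mul_inv_cancel h4 (ENNReal.natCast_ne_top _), one_pow, mul_one]

end MassFormula

/-! ### The mass of infinite Schur `σ`-groups -/

section InfiniteMass

variable {p g : ℕ} [hp : Fact p.Prime] {G : Type*} [Group G] [TopologicalSpace G]
  [IsTopologicalGroup G]

theorem IsProP.exists_stable_openNormal_separating (hG : IsProP p G) {σ : contAut G}
    (hσ : ∀ x, σ.1 (σ.1 x) = x) {C : Set G} (hC : C.Finite) (h1 : (1 : G) ∉ C) :
    ∃ U : Subgroup G, U.Normal ∧ IsOpen (U : Set G) ∧ (∀ x ∈ U, σ.1 x ∈ U) ∧ ∀ c ∈ C, c ∉ U := by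
  have := hG.t2Space
  obtain ⟨V, hVn, hVo, hV⟩ := hG.exists_openNormal_separating hC.isClosed h1
  refine ⟨V ⊓ V.comap (σ.1 : G →* G), inferInstance, hVo.inter (hVo.preimage σ.2.1), ?_,
    fun c hc hcU => hV c hc (by rw [mul_one]; exact inv_mem hcU.1)⟩
  rintro x ⟨h1, h3⟩
  refine ⟨h3, ?_⟩
  change σ.1 (σ.1 x) ∈ V
  rwa [hσ]

/-- Given `L` automorphisms commuting with `σ`, `L · Meas(G)` is bounded. -/
theorem card_mul_meas_le (h2 : p ≠ 2) (hg : 1 ≤ g) (hG : IsProP p G) (hfg : IsTopFG G)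
    {σ : contAut G} (hσ : IsSchurInvolution σ) (S : Finset (autSigma σ)) :
    (S.card : ℝ≥0∞) * meas p g G ≤ ((p ^ g : ℕ) : ℝ≥0∞) ^ g := by
  classical
  have := hG.t2Space
  have hx : ∀ α β : autSigma σ, ∃ x : G, α ≠ β → α.1.1 x ≠ β.1.1 x := by
    intro α β
    by_cases h : α = β
    · exact ⟨1, fun h' => (h' h).elim⟩
    · by_contra! hx
      exact h (Subtype.ext (Subtype.ext (MulEquiv.ext fun x => (hx x).2)))
  choose x hx using hx
  -- `x α β` is a point where `α` and `β` differ; `U` is small enough that any two members of `S`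
  -- still differ there modulo `U`.
  obtain ⟨U, hUn, hUo, hUs, hU⟩ := hG.exists_stable_openNormal_separating (σ := σ)
    hσ.apply_apply (C := (fun q : autSigma σ × autSigma σ => (q.1.1.1 (x q.1 q.2))⁻¹ *
      q.2.1.1 (x q.1 q.2)) '' {q | q.1 ∈ S ∧ q.2 ∈ S ∧ q.1 ≠ q.2})
    (Set.Finite.image _ (((S ×ˢ S).finite_toSet).subset fun q hq => by
      rw [Finset.coe_product]
      exact ⟨hq.1, hq.2.1⟩)) (by
      rintro ⟨q, ⟨-, -, hq⟩, h⟩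
      exact hx _ _ hq (inv_mul_eq_one.1 h))
  have hfin : Finite (G ⧸ U) := hG.finite_quotient hUo
  have hd : DiscreteTopology (G ⧸ U) := QuotientGroup.discreteTopology hUo
  have hQ : IsProP p (G ⧸ U) := hG.quotient U (Subgroup.isClosed_of_isOpen U hUo)
  let τ : G ⧸ U →* G ⧸ U := QuotientGroup.map U U (σ.1 : G →* G) hUs
  have hτ : ∀ z : G, τ (z : G ⧸ U) = (σ.1 z : G) := fun z => rfl
  let I : Set (G ⧸ U) := {d | τ d = d⁻¹}
  let T : Finset (Fin g → G ⧸ U) :=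
    (Set.toFinite {q | (∀ i, q i ∈ I) ∧ Function.Surjective (FreeProP.lift hQ q)}).toFinset
  have hT : ∀ q, q ∈ T ↔ (∀ i, q i ∈ I) ∧ Function.Surjective (FreeProP.lift hQ q) :=
    fun q => Set.Finite.mem_toFinset _
  have hTcard : T.card ≤ I.ncard ^ g := by
    rw [← Nat.card_eq_finsetCard, ← Nat.card_coe_set_eq]
    refine (Nat.card_le_card_of_injective (fun q : T => fun i => (⟨q.1 i, ((hT _).1 q.2).1 i⟩ : I))
      fun q q' h => Subtype.ext (funext fun i => congrArg Subtype.val (congrFun h i))).trans ?_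
    rw [Nat.card_fun, Nat.card_eq_fintype_card (α := Fin g), Fintype.card_fin]
  have hI0 : (I.ncard : ℝ≥0∞) ≠ 0 := by
    have : I.ncard ≠ 0 := Set.ncard_ne_zero_of_mem (a := (1 : G ⧸ U))
      (map_one _ |>.trans inv_one.symm) (Set.toFinite _)
    exact_mod_cast this
  have hsig : ∀ q ∈ T, ∀ z, FreeProP.lift hQ q (FreeProP.sig p g z) = τ (FreeProP.lift hQ q z) :=
    fun q hq z => FreeProP.map_sig (FreeProP.continuous_lift hQ q) continuous_of_discreteTopology
      (fun i => by rw [FreeProP.lift_gen]; exact ((hT q).1 hq).1 i) z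
  have hle : ∀ q ∈ T, relatorMeasure p g {z | FreeProP.lift hQ q z = 1} ≤
      ((p ^ g : ℕ) : ℝ≥0∞) * (I.ncard : ℝ≥0∞)⁻¹ := by
    intro q hq
    have h1 : (1 : G ⧸ U) ∈ FreeProP.lift hQ q '' schurRelators p g :=
      ⟨1, ⟨1, one_mem _, by simp⟩, map_one _⟩
    rw [relatorMeasure_fiber (FreeProP.continuous_lift hQ q) h1]
    have h3 := ncard_inverted_le h2 hg hQ ((hT q).1 hq).2 (hsig q hq)
    set N := (FreeProP.lift hQ q '' schurRelators p g).ncard with hN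
    have hN0 : (N : ℝ≥0∞) ≠ 0 := by
      have : N ≠ 0 := Set.ncard_ne_zero_of_mem h1 (Set.toFinite _)
      exact_mod_cast this
    have h4 : (I.ncard : ℝ≥0∞) ≤ ((p ^ g : ℕ) : ℝ≥0∞) * N := by exact_mod_cast h3
    calc (N : ℝ≥0∞)⁻¹ = (I.ncard : ℝ≥0∞) * (I.ncard : ℝ≥0∞)⁻¹ * (N : ℝ≥0∞)⁻¹ := by
          rw [ENNReal.mul_inv_cancel hI0 (ENNReal.natCast_ne_top _), one_mul]
      _ ≤ ((p ^ g : ℕ) : ℝ≥0∞) * N * (I.ncard : ℝ≥0∞)⁻¹ * (N : ℝ≥0∞)⁻¹ := by gcongr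
      _ = ((p ^ g : ℕ) : ℝ≥0∞) * (I.ncard : ℝ≥0∞)⁻¹ * (N * (N : ℝ≥0∞)⁻¹) := by ring
      _ = _ := by rw [ENNReal.mul_inv_cancel hN0 (ENNReal.natCast_ne_top _), mul_one]
  have hE : ∀ q : Fin g → G ⧸ U, MeasurableSet
      {v : Fin g → schurRelators p g | ∀ i, v i ∈ {z : schurRelators p g |
        FreeProP.lift hQ q z = 1}} := by
    intro q
    have : {v : Fin g → schurRelators p g | ∀ i, v i ∈ {z : schurRelators p g |
        FreeProP.lift hQ q z = 1}} =
        ⋂ i, (fun v => v i) ⁻¹' {z : schurRelators p g | FreeProP.lift hQ q z = 1} := by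
      ext v
      simp
    rw [this]
    refine MeasurableSet.iInter fun i => measurable_pi_apply i ?_
    have ho : IsOpen {z : FreeProP p g | FreeProP.lift hQ q z = 1} :=
      (isOpen_discrete {1}).preimage (FreeProP.continuous_lift hQ q)
    exact measurable_subtype_coe ho.measurableSet
  -- Composing an equivariant presentation by `v` with the members of `S` gives `|S|` distinct
  -- inverted surjections to `G ⧸ U` killing `v`. There are at most `|I| ^ g` such surjections, each
  -- killing a random tuple with probability at most `(p ^ g / |I|) ^ g`.
  have key := mul_measure_le_sum (relatorTupleMeasure p g) T (fun q _ => hE q)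
    (B := presentingTuples p g G) (c := S.card) fun v hv => by
      obtain ⟨f, hf, hs, hker, hfσ⟩ := exists_equivariant_presentation h2 hg hG hfg hσ hv
      let Q : autSigma σ → FreeProP p g →* G ⧸ U := fun α =>
        (QuotientGroup.mk' U).comp ((α.1.1 : G →* G).comp f)
      have hQc : ∀ α, Continuous (Q α) := fun α =>
        QuotientGroup.continuous_mk.comp (α.1.2.1.comp hf)
      have hQs : ∀ α, Function.Surjective (Q α) := fun α =>
        (QuotientGroup.mk'_surjective U).comp (α.1.1.surjective.comp hs)
      have hcomm : ∀ (α : autSigma σ) (z : G), α.1.1 (σ.1 z) = σ.1 (α.1.1 z) := fun α z =>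
        congrArg (fun β : contAut G => β.1 z) (Subgroup.mem_centralizer_singleton_iff.1 α.2)
      refine Finset.card_le_card_of_injOn (fun α i => Q α (FreeProP.gen p g i)) ?_ ?_
      · intro α hα
        rw [Finset.coe_filter]
        refine ⟨(hT _).2 ⟨fun i => ?_, ?_⟩, fun i => ?_⟩
        · change ((σ.1 (α.1.1 (f (FreeProP.gen p g i))) : G) : G ⧸ U) =
            ((α.1.1 (f (FreeProP.gen p g i)) : G) : G ⧸ U)⁻¹
          rw [← hcomm, ← hfσ, FreeProP.sig_gen, map_inv, map_inv]
          rfl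
        · rw [← FreeProP.eq_lift hQ (hQc α)]
          exact hQs α
        · change FreeProP.lift hQ (fun i => Q α (FreeProP.gen p g i)) (v i) = 1
          rw [← FreeProP.eq_lift hQ (hQc α)]
          have h1 : f (v i) = 1 := by
            rw [← MonoidHom.mem_ker, hker]
            exact relator_mem_relationSubgroup v i
          change ((α.1.1 (f (v i)) : G) : G ⧸ U) = 1
          rw [h1, map_one]
          rfl
      · intro α hα β hβ h
        by_contra hne
        have h1 : Q α = Q β := FreeProP.hom_ext (hQc α) (hQc β) fun i => congrFun h i
        obtain ⟨z, hz⟩ := hs (x α β)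
        have h3 : ((α.1.1 (f z) : G) : G ⧸ U) = (β.1.1 (f z) : G) := DFunLike.congr_fun h1 z
        rw [hz, QuotientGroup.eq] at h3
        exact hU _ ⟨(α, β), ⟨hα, hβ, hne⟩, rfl⟩ h3
  refine key.trans ?_
  calc _ ≤ ∑ q ∈ T, (((p ^ g : ℕ) : ℝ≥0∞) * (I.ncard : ℝ≥0∞)⁻¹) ^ g := by
        refine Finset.sum_le_sum fun q hq => ?_
        rw [relatorTupleMeasure_forall, Finset.prod_const, Finset.card_univ, Fintype.card_fin]
        exact pow_le_pow_left' (hle q hq) g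
    _ = T.card * (((p ^ g : ℕ) : ℝ≥0∞) ^ g * ((I.ncard : ℝ≥0∞)⁻¹) ^ g) := by
        rw [Finset.sum_const, nsmul_eq_mul, mul_pow]
    _ ≤ ((I.ncard : ℝ≥0∞) ^ g) * (((p ^ g : ℕ) : ℝ≥0∞) ^ g * ((I.ncard : ℝ≥0∞)⁻¹) ^ g) := by
        gcongr
        exact_mod_cast hTcard
    _ = ((p ^ g : ℕ) : ℝ≥0∞) ^ g * ((I.ncard : ℝ≥0∞) * (I.ncard : ℝ≥0∞)⁻¹) ^ g := by
        rw [mul_pow]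
        ring
    _ = _ := by rw [ENNReal.mul_inv_cancel hI0 (ENNReal.natCast_ne_top _), one_pow, mul_one]

theorem meas_eq_zero_of_infinite (h2 : p ≠ 2) (hg : 1 ≤ g) (hG : IsProP p G) (hfg : IsTopFG G)
    {σ : contAut G} (hσ : IsSchurInvolution σ) [Infinite (autSigma σ)] : meas p g G = 0 := by
  by_contra hne
  have hfin : meas p g G ≠ ∞ := measure_ne_top _ _
  obtain ⟨n, hn⟩ := ENNReal.exists_nat_mul_gt hne
    (ENNReal.pow_ne_top (n := g) (ENNReal.natCast_ne_top (p ^ g)))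
  obtain ⟨S, hS⟩ := Infinite.exists_subset_card_eq (autSigma σ) n
  have := card_mul_meas_le h2 hg hG hfg hσ S
  rw [hS] at this
  exact absurd this (not_le.2 hn)

/-- `Meas(G) = C / |Aut_σ(G)|`. -/
theorem IsSchurSigma.meas_eq (h2 : p ≠ 2) (hg : 1 ≤ g) (hG : IsSchurSigma p g G)
    {σ : contAut G} (hσ : IsSchurInvolution σ) :
    meas p g G = massConst p g / ((ENat.card (autSigma σ) : ℕ∞) : ℝ≥0∞) := by
  rcases finite_or_infinite (autSigma σ) with h | h
  · have := hG.finite_ab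
    have hfin := hG.proP.finite_of_finite_autSigma h2 hσ
    have hpos : (Nat.card (autSigma σ) : ℝ≥0∞) ≠ 0 := by
      exact_mod_cast Nat.card_pos.ne'
    rw [ENat.card_eq_coe_natCard, ENat.toENNReal_coe, ← hG.card_mul_meas h2 hg hσ, mul_comm,
      ENNReal.mul_div_cancel_right hpos (ENNReal.natCast_ne_top _)]
  · rw [meas_eq_zero_of_infinite h2 hg hG.proP hG.topFG hσ, ENat.card_eq_top_of_infinite,
      ENat.toENNReal_top, ENNReal.div_top]

end InfiniteMass

/-! ### The measure on isomorphism classes -/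

section ClassMeasure

variable {p g : ℕ} [hp : Fact p.Prime]

theorem measurable_presentedClass : Measurable (presentedClass p g) := fun _ h => h

theorem presentedClass_eq_cls_iff {v : schurTuples p g} {G : SchurSigmaGrp p g} :
    presentedClass p g v = G.cls ↔ v.1 ∈ presentingTuples p g G.carrier :=
  Quotient.eq (r := SchurSigmaGrp.isoSetoid p g)

theorem SchurSigmaClass.exists_cls_eq (c : SchurSigmaClass p g) :
    ∃ G : SchurSigmaGrp p g, G.cls = c :=
  Quotient.exists_rep c

theorem measurableSet_cls (G : SchurSigmaGrp p g) : MeasurableSet {G.cls} := by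
  have h : presentedClass p g ⁻¹' {G.cls} =
      Subtype.val ⁻¹' presentingTuples p g G.carrier := by
    ext v
    exact presentedClass_eq_cls_iff
  change MeasurableSet (presentedClass p g ⁻¹' {G.cls})
  rw [h]
  exact measurable_subtype_coe
    (measurableSet_presentingTuples G.isSchurSigma.proP G.isSchurSigma.topFG)

instance : MeasurableSingletonClass (SchurSigmaClass p g) :=
  ⟨fun c => by
    obtain ⟨G, rfl⟩ := c.exists_cls_eq
    exact measurableSet_cls G⟩

/-- `schurTuples` is only known to be null measurable, so the pullback is evaluated through null
measurable images. -/
theorem schurMeas_apply (h2 : p ≠ 2) (hg : 1 ≤ g) {A : Set (SchurSigmaClass p g)}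
    (hA : MeasurableSet A) :
    schurMeas p g A = relatorTupleMeasure p g (Subtype.val '' (presentedClass p g ⁻¹' A)) := by
  have hnull : ∀ s : Set (schurTuples p g), MeasurableSet s →
      NullMeasurableSet (Subtype.val '' s) (relatorTupleMeasure p g) := fun s hs =>
    MeasureTheory.Measure.MeasurableSet.nullMeasurableSet_subtype_coe (nullMeasurableSet_schurTuples h2 hg) hs
  rw [schurMeas, Measure.map_apply measurable_presentedClass hA]
  exact Measure.comap_apply₀ _ _ Subtype.val_injective hnull
    (measurable_presentedClass hA).nullMeasurableSet

theorem isProbabilityMeasure_schurMeas (h2 : p ≠ 2) (hg : 1 ≤ g) :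
    IsProbabilityMeasure (schurMeas p g) := by
  refine ⟨?_⟩
  rw [schurMeas_apply h2 hg MeasurableSet.univ, Set.preimage_univ, Set.image_univ,
    Subtype.range_coe, ← measure_univ (μ := relatorTupleMeasure p g)]
  exact measure_of_measure_compl_eq_zero (measure_compl_schurTuples h2 hg)

theorem schurMeas_cls (h2 : p ≠ 2) (hg : 1 ≤ g) (G : SchurSigmaGrp p g) :
    schurMeas p g {G.cls} = meas p g G.carrier := by
  have h : Subtype.val '' (presentedClass p g ⁻¹' {G.cls}) =
      presentingTuples p g G.carrier ∩ schurTuples p g := by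
    ext v
    constructor
    · rintro ⟨w, hw, rfl⟩
      exact ⟨presentedClass_eq_cls_iff.1 hw, w.2⟩
    · rintro ⟨h1, h3⟩
      exact ⟨⟨v, h3⟩, presentedClass_eq_cls_iff.2 h1, rfl⟩
  rw [schurMeas_apply h2 hg (measurableSet_cls G), h, meas]
  exact measure_inter_conull (measure_compl_schurTuples h2 hg)

theorem hasMassInvAutSigma_schurMeas (h2 : p ≠ 2) (hg : 1 ≤ g) :
    HasMassInvAutSigma (schurMeas p g) (massConst p g) := fun G σ hσ => by
  rw [schurMeas_cls h2 hg, G.isSchurSigma.meas_eq h2 hg hσ]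

/-- A finite group is determined by a multiplication table on some `Fin n`; the topology is
discrete. -/
theorem countable_finiteSchurClasses : (finiteSchurClasses p g).Countable := by
  have hex : ∀ c : finiteSchurClasses p g, ∃ (G : SchurSigmaGrp p g) (n : ℕ)
      (e : G.carrier ≃ Fin n), G.cls = c.1 := by
    rintro ⟨_, G, rfl, hG⟩
    exact ⟨G, _, Finite.equivFin G.carrier, rfl⟩
  choose G n e hG using hex
  have hd : ∀ c, DiscreteTopology (G c).carrier := fun c => by
    have := (G c).isSchurSigma.proP.t2Space
    have := Finite.of_equiv _ (e c).symm
    infer_instance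
  let f : finiteSchurClasses p g → Σ n : ℕ, Fin n → Fin n → Fin n := fun c =>
    ⟨n c, fun i j => e c ((e c).symm i * (e c).symm j)⟩
  have hf : Function.Injective f := by
    intro c d hcd
    have key : ∀ (m k : ℕ) (ec : (G c).carrier ≃ Fin m) (ed : (G d).carrier ≃ Fin k),
        (⟨m, fun i j => ec (ec.symm i * ec.symm j)⟩ : Σ n : ℕ, Fin n → Fin n → Fin n) =
          ⟨k, fun i j => ed (ed.symm i * ed.symm j)⟩ →
        Nonempty ((G c).carrier ≃ₜ* (G d).carrier) := by
      intro m k ec ed h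
      obtain ⟨rfl, h⟩ := Sigma.mk.inj_iff.1 h
      have h' := eq_of_heq h
      have := hd c
      have := hd d
      refine ⟨{ (ec.trans ed.symm) with
        map_mul' := fun x y => ?_
        continuous_toFun := continuous_of_discreteTopology
        continuous_invFun := continuous_of_discreteTopology }⟩
      have h1 := congrFun (congrFun h' (ec x)) (ec y)
      simp only [Equiv.symm_apply_apply] at h1
      change ed.symm (ec (x * y)) = ed.symm (ec x) * ed.symm (ec y)
      rw [h1, Equiv.symm_apply_apply]
    refine Subtype.ext ?_
    rw [← hG c, ← hG d]
    exact Quotient.sound (key _ _ (e c) (e d) hcd)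
  exact (hf.countable : Countable (finiteSchurClasses p g)).to_set

theorem measurableSet_finiteSchurClasses : MeasurableSet (finiteSchurClasses p g) :=
  countable_finiteSchurClasses.measurableSet

theorem measure_eq_tsum_singleton {α : Type*} [MeasurableSpace α] [MeasurableSingletonClass α]
    (μ : Measure α) {S : Set α} (hS : S.Countable) : μ S = ∑' x : S, μ {x.1} := by
  conv_lhs => rw [← Set.biUnion_of_singleton S]
  refine measure_biUnion hS (fun x _ y _ hxy => ?_) fun x _ => measurableSet_singleton x
  exact Set.disjoint_singleton.2 hxy

/-- On countable sets both measures are sums of point masses, which are in the constant ratio `c` to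
`massConst`. -/
theorem HasMassInvAutSigma.eq_mul_schurMeas (h2 : p ≠ 2) (hg : 1 ≤ g)
    {Q : Measure (SchurSigmaClass p g)} {c : ℝ≥0∞} (hQ : HasMassInvAutSigma Q c)
    {S : Set (SchurSigmaClass p g)} (hS : S.Countable) :
    Q S = c / massConst p g * schurMeas p g S := by
  rw [measure_eq_tsum_singleton Q hS, measure_eq_tsum_singleton _ hS, ← ENNReal.tsum_mul_left]
  refine tsum_congr fun x => ?_
  obtain ⟨G, hG⟩ := x.1.exists_cls_eq
  obtain ⟨σ, hσ⟩ := G.isSchurSigma.exists_involution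
  rw [← hG, hQ G σ hσ, hasMassInvAutSigma_schurMeas h2 hg G σ hσ, div_eq_mul_inv, div_eq_mul_inv,
    div_eq_mul_inv, mul_assoc, ← mul_assoc _ (massConst p g),
    ENNReal.inv_mul_cancel massConst_ne_zero massConst_ne_top, one_mul]

theorem cls_mem_finiteSchurClasses (h2 : p ≠ 2) {G : SchurSigmaGrp p g} {σ : contAut G.carrier}
    (hσ : IsSchurInvolution σ) [Finite (autSigma σ)] : G.cls ∈ finiteSchurClasses p g := by
  have := G.isSchurSigma.finite_ab
  exact ⟨G, rfl, G.isSchurSigma.proP.finite_of_finite_autSigma h2 hσ⟩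

/-- Conditioning scales the finite classes and kills all others. The others have infinite
`Aut_σ(G)`, since a finite one forces `G` to be finite, so their prescribed mass is `0` as well. -/
theorem hasMassInvAutSigma_cond (h2 : p ≠ 2) (hg : 1 ≤ g) :
    HasMassInvAutSigma (ProbabilityTheory.cond (schurMeas p g) (finiteSchurClasses p g))
      ((schurMeas p g (finiteSchurClasses p g))⁻¹ * massConst p g) := by
  intro G σ hσ
  have hmass := hasMassInvAutSigma_schurMeas h2 hg G σ hσ
  rw [ProbabilityTheory.cond_apply measurableSet_finiteSchurClasses]
  rcases finite_or_infinite (autSigma σ) with h | h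
  · rw [Set.inter_eq_right.2 (Set.singleton_subset_iff.2 (cls_mem_finiteSchurClasses h2 hσ)),
      hmass, mul_div_assoc]
  · rw [ENat.card_eq_top_of_infinite, ENat.toENNReal_top, ENNReal.div_top] at hmass ⊢
    rw [measure_mono_null Set.inter_subset_right hmass, mul_zero]

theorem HasMassInvAutSigma.eq_cond (h2 : p ≠ 2) (hg : 1 ≤ g)
    {Q : Measure (SchurSigmaClass p g)} [IsProbabilityMeasure Q]
    (hQA : Q (finiteSchurClasses p g)ᶜ = 0) {c : ℝ≥0∞} (hQ : HasMassInvAutSigma Q c) :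
    schurMeas p g (finiteSchurClasses p g) ≠ 0 ∧
      Q = ProbabilityTheory.cond (schurMeas p g) (finiteSchurClasses p g) := by
  have hm : MeasurableSet (finiteSchurClasses p g) := measurableSet_finiteSchurClasses
  -- Total mass `1` on the finite classes fixes the scaling factor and excludes that these are null.
  have h1 : c / massConst p g * schurMeas p g (finiteSchurClasses p g) = 1 := by
    rw [← hQ.eq_mul_schurMeas h2 hg countable_finiteSchurClasses,
      ← measure_univ (μ := Q)]
    exact measure_of_measure_compl_eq_zero hQA
  refine ⟨fun h0 => ?_, Measure.ext fun S hS => ?_⟩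
  · rw [h0, mul_zero] at h1
    exact zero_ne_one h1
  · rw [ProbabilityTheory.cond_apply hm, ← ENNReal.eq_inv_of_mul_eq_one_left h1,
      ← hQ.eq_mul_schurMeas h2 hg (countable_finiteSchurClasses.mono Set.inter_subset_left),
      Set.inter_comm]
    exact (measure_inter_conull hQA).symm

end ClassMeasure

theorem corollary2p4 (p : ℕ) [Fact p.Prime] (hp : p ≠ 2) (g : ℕ) (hg : 1 ≤ g) :
    -- `Meas` is a probability measure on the Schur `σ`-groups of rank `g`, with mass `Meas(G)` at `G`
    IsProbabilityMeasure (schurMeas p g) ∧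
    (∀ G : SchurSigmaGrp p g, MeasurableSet {G.cls} ∧
      schurMeas p g {G.cls} = meas p g G.carrier) ∧
    -- the mass of each `G` is proportional to `1 / |Aut_σ(G)|`
    (∃ C : ℝ≥0∞, C ≠ 0 ∧ C ≠ ∞ ∧ HasMassInvAutSigma (schurMeas p g) C) ∧
    -- a probability measure carried by the finite groups has mass proportional to `1 / |Aut_σ(G)|`
    -- exactly when it is `Meas`, conditioned on the finite groups
    MeasurableSet (finiteSchurClasses p g) ∧
    ∀ Q : Measure (SchurSigmaClass p g),
      (IsProbabilityMeasure Q ∧ Q (finiteSchurClasses p g)ᶜ = 0 ∧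
          ∃ c : ℝ≥0∞, HasMassInvAutSigma Q c) ↔
        (schurMeas p g (finiteSchurClasses p g) ≠ 0 ∧
          Q = ProbabilityTheory.cond (schurMeas p g) (finiteSchurClasses p g)) := by
  have hprob := isProbabilityMeasure_schurMeas hp hg
  refine ⟨hprob, fun G => ⟨measurableSet_cls G, schurMeas_cls hp hg G⟩,
    ⟨massConst p g, massConst_ne_zero, massConst_ne_top, hasMassInvAutSigma_schurMeas hp hg⟩,
    measurableSet_finiteSchurClasses, fun Q => ⟨?_, ?_⟩⟩
  · rintro ⟨hQ, hQA, c, hc⟩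
    exact hc.eq_cond hp hg hQA
  · rintro ⟨h0, rfl⟩
    refine ⟨ProbabilityTheory.cond_isProbabilityMeasure h0, ?_, _, hasMassInvAutSigma_cond hp hg⟩
    rw [ProbabilityTheory.cond_apply measurableSet_finiteSchurClasses, Set.inter_compl_self,
      measure_empty, mul_zero]
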